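/- For $0<q<1$ and complex $a$, let $(a;q)_n=\prod_{k=0}^{n-1}(1-aq^k)$ and $\theta_q(x)=\sum_{n\in\mathbb Z}q^{n(n-1)/2}x^n$ for $x\in\mathbb C^*$. Consider the formal power series $${}_3\varphi_1(a_1,a_2,a_3;b_1;q,x)=\sum_{n\ge 0}\frac{(a_1;q)_n(a_2;q)_n(a_3;q)_n}{(b_1;q)_n(q;q)_n}\left\{(-1)^nq^{n(n-1)/2}\right\}^{-1}x^n .$$ Its $q$-Borel transform is the series obtained by multiplying the coefficient of $x^n$ by $q^{n(n-1)/2}$ (and writing $\xi$ for $x$). Let $\varphi$ be the analytic continuation of the $q$-Borel transform from a neighbourhood of $0$ along the ray $\{t\lambda : t\ge 0\}$, $\lambda\in\mathbb C^*$. The resummed function ${}_3f_1$ is its $q$-Laplace transform $${}_3f_1(a_1,a_2,a_3;b_1;q;\lambda,x)=\sum_{n\in\mathbb Z}\frac{\varphi(\lambda q^n)}{\theta_q(\lambda q^n/x)} .$$ Let ${}_2F_2(a,b;c,d;z)=\sum_{n\ge0}\frac{(a)_n(b)_n}{(c)_n(d)_n\,n!}z^n$ with $(a)_n=a(a+1)\cdots(a+n-1)$.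 **Theorem.** Let $\alpha_1,\alpha_2,\alpha_3,\beta_1\in\mathbb C$ be such that $\alpha_i-\alpha_j\notin\mathbb Z$ for $i\ne j$ and $\beta_1\notin\{0,-1,-2,\dots\}$. Let $\lambda,x\in\mathbb C^*$, with principal arguments satisfying $|\arg\lambda|<\pi$, $|\arg x|<\pi$ and $|\arg x-\arg\lambda|<\pi$. Then, for all $q<1$ close enough to $1$, the continuation $\varphi$ for the parameters $a_j=q^{\alpha_j}$, $b_1=q^{\beta_1}$ exists, no denominator $\theta_q(\lambda q^n(1-q)/x)$, $n\in\mathbb Z$, vanishes and the series defining ${}_3f_1(q^{\alpha_1},q^{\alpha_2},q^{\alpha_3};q^{\beta_1};q;\lambda,\tfrac{x}{1-q})$ converges absolutely. Moreover $$\begin{aligned} &\lim_{q\to1^-}{}_3f_1\!\left(q^{\alpha_1},q^{\alpha_2},q^{\alpha_3};q^{\beta_1};q;\lambda,\frac{x}{1-q}\right)\\ &=\frac{\Gamma(\beta_1)\Gamma(\alpha_2-\alpha_1)\Gamma(\alpha_3-\alpha_1)}{\Gamma(\alpha_2)\Gamma(\alpha_3)\Gamma(\beta_1-\alpha_1)}x^{-\alpha_1}{}_2F_2\!\left(\alpha_1,\alpha_1+1-\beta_1;\alpha_1+1-\alpha_2,\alpha_1+1-\alpha_3;\frac1x\right)\\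 &+\frac{\Gamma(\beta_1)\Gamma(\alpha_1-\alpha_2)\Gamma(\alpha_3-\alpha_2)}{\Gamma(\alpha_1)\Gamma(\alpha_3)\Gamma(\beta_1-\alpha_2)}x^{-\alpha_2}{}_2F_2\!\left(\alpha_2,\alpha_2+1-\beta_1;\alpha_2+1-\alpha_1,\alpha_2+1-\alpha_3;\frac1x\right)\\ &+\frac{\Gamma(\beta_1)\Gamma(\alpha_2-\alpha_3)\Gamma(\alpha_1-\alpha_3)}{\Gamma(\alpha_2)\Gamma(\alpha_1)\Gamma(\beta_1-\alpha_3)}x^{-\alpha_3}{}_2F_2\!\left(\alpha_3,\alpha_3+1-\beta_1;\alpha_3+1-\alpha_2,\alpha_3+1-\alpha_1;\frac1x\right), \end{aligned}$$ where $x^{-\alpha_j}$ is the principal branch and $1/\Gamma$ is $0$ at the poles of $\Gamma$. -/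

import Mathlib

open Filter Topology

noncomputable section

/-- The `q`-shifted factorial `(a; q)_n = (1 - a)(1 - a q) ⋯ (1 - a q^(n-1))`. -/
def qShiftedFactorial (a q : ℂ) (n : ℕ) : ℂ :=
  ∏ k ∈ Finset.range n, (1 - a * q ^ k)

/-- The basic hypergeometric series `₃φ₁(a₁, a₂, a₃; b₁; q, x)` as a formal power series in `x`
(its radius of convergence is zero in general). -/
def basicPhi31 (a₁ a₂ a₃ b₁ q : ℂ) : PowerSeries ℂ :=
  PowerSeries.mk fun n =>
    (qShiftedFactorial a₁ q n * qShiftedFactorial a₂ q n * qShiftedFactorial a₃ q n) /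
      (qShiftedFactorial b₁ q n * qShiftedFactorial q q n) *
      ((-1) ^ n * q ^ (n * (n - 1) / 2))⁻¹

/-- The theta function of Jacobi with base `q`, `θ_q(x) = ∑_{n ∈ ℤ} q^(n(n-1)/2) x^n`. -/
def qTheta (q x : ℂ) : ℂ :=
  ∑' n : ℤ, q ^ (n * (n - 1) / 2) * x ^ n

/-- The `q`-Borel transformation `∑ aₙ xⁿ ↦ ∑ aₙ q^(n(n-1)/2) ξⁿ` of formal power series. -/
def qBorel (q : ℂ) (f : PowerSeries ℂ) : PowerSeries ℂ :=
  PowerSeries.mk fun n => PowerSeries.coeff n f * q ^ (n * (n - 1) / 2)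

/-- `φ` is the analytic continuation of the power series `ψ` along the closed ray from `0` through
`lam`: the series converges to `φ` near `0`, and `φ` is analytic in a neighbourhood of every point
of the ray. (By the identity theorem the values of `φ` on the ray are determined by `ψ`.) -/
structure IsRayContinuation (ψ : PowerSeries ℂ) (lam : ℂ) (φ : ℂ → ℂ) : Prop where
  hasSum_near_zero : ∀ᶠ ξ in 𝓝 (0 : ℂ), HasSum (fun n : ℕ => PowerSeries.coeff n ψ * ξ ^ n) (φ ξ)
  analyticOnNhd : AnalyticOnNhd ℂ φ {ξ : ℂ | ∃ t : ℝ, 0 ≤ t ∧ ξ = t * lam}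

/-- The general term of the `q`-Laplace transform of `φ` along the spiral `lam q^ℤ`. -/
def qLaplaceTerm (q lam : ℂ) (φ : ℂ → ℂ) (x : ℂ) (n : ℤ) : ℂ :=
  φ (lam * q ^ n) / qTheta q (lam * q ^ n / x)

/-- The `q`-Laplace transformation
`(L φ)(x) = ∑_{n ∈ ℤ} φ(lam q^n) / θ_q(lam q^n / x)`. -/
def qLaplace (q lam : ℂ) (φ : ℂ → ℂ) (x : ℂ) : ℂ :=
  ∑' n : ℤ, qLaplaceTerm q lam φ x n

open Classical in
/-- The `q`-Borel-Laplace transform of a formal power series `f`: the `q`-Laplace transform of the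
analytic continuation of the `q`-Borel transform of `f` along the ray through `lam`
(and `0` if there is no such continuation). -/
def qBorelLaplace (q lam : ℂ) (f : PowerSeries ℂ) (x : ℂ) : ℂ :=
  if h : ∃ φ : ℂ → ℂ, IsRayContinuation (qBorel q f) lam φ then qLaplace q lam h.choose x else 0

/-- The resummed function `₃f₁(a₁, a₂, a₃; b₁; q; lam, x)`. -/
def resummedF31 (a₁ a₂ a₃ b₁ q lam x : ℂ) : ℂ :=
  qBorelLaplace q lam (basicPhi31 a₁ a₂ a₃ b₁ q) x

/-- The generalized hypergeometric function
`₂F₂(a, b; c, d; z) = ∑ (a)ₙ (b)ₙ / ((c)ₙ (d)ₙ n!) zⁿ`. -/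
def hypergeom22 (a b c d z : ℂ) : ℂ :=
  ∑' n : ℕ, ((ascPochhammer ℂ n).eval a * (ascPochhammer ℂ n).eval b) /
    ((ascPochhammer ℂ n).eval c * (ascPochhammer ℂ n).eval d * (n.factorial : ℂ)) * z ^ n

end

open Filter Topology

noncomputable section

/-- The infinite `q`-shifted factorial `(a; q)_∞`. -/
def qPochInf (a q : ℂ) : ℂ := ∏' k : ℕ, (1 - a * q ^ k)

theorem qShiftedFactorial_zero (a q : ℂ) : qShiftedFactorial a q 0 = 1 := by
  simp [qShiftedFactorial]

theorem qShiftedFactorial_succ (a q : ℂ) (n : ℕ) :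
    qShiftedFactorial a q (n + 1) = qShiftedFactorial a q n * (1 - a * q ^ n) := by
  simp [qShiftedFactorial, Finset.prod_range_succ]

theorem qShiftedFactorial_add (a q : ℂ) (m n : ℕ) :
    qShiftedFactorial a q (m + n) =
      qShiftedFactorial a q m * qShiftedFactorial (a * q ^ m) q n := by
  simp [qShiftedFactorial, Finset.prod_range_add, pow_add, mul_assoc]

theorem qShiftedFactorial_ne_zero {a q : ℂ} {n : ℕ} (h : ∀ k < n, 1 - a * q ^ k ≠ 0) :
    qShiftedFactorial a q n ≠ 0 :=
  Finset.prod_ne_zero_iff.2 fun k hk => h k (Finset.mem_range.1 hk)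

theorem summable_norm_qFactor {q : ℂ} (hq : ‖q‖ < 1) (a : ℂ) :
    Summable fun k : ℕ => ‖-(a * q ^ k)‖ := by
  simpa using (summable_geometric_of_lt_one (norm_nonneg q) hq).mul_left ‖a‖

theorem multipliable_qFactor {q : ℂ} (hq : ‖q‖ < 1) (a : ℂ) :
    Multipliable fun k : ℕ => 1 - a * q ^ k := by
  simpa [sub_eq_add_neg] using multipliable_one_add_of_summable (summable_norm_qFactor hq a)

theorem tendsto_qShiftedFactorial {q : ℂ} (hq : ‖q‖ < 1) (a : ℂ) :
    Tendsto (qShiftedFactorial a q) atTop (𝓝 (qPochInf a q)) :=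
  (multipliable_qFactor hq a).tendsto_prod_tprod_nat

theorem qPochInf_ne_zero {a q : ℂ} (hq : ‖q‖ < 1) (h : ∀ k : ℕ, 1 - a * q ^ k ≠ 0) :
    qPochInf a q ≠ 0 := by
  have := tprod_one_add_ne_zero_of_summable (f := fun k : ℕ => -(a * q ^ k))
    (by simpa [sub_eq_add_neg] using h) (summable_norm_qFactor hq a)
  simpa [qPochInf, sub_eq_add_neg] using this

theorem qPochInf_eq_zero {a q : ℂ} (hq : ‖q‖ < 1) {k : ℕ} (h : 1 - a * q ^ k = 0) :
    qPochInf a q = 0 := by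
  refine tendsto_nhds_unique (tendsto_qShiftedFactorial hq a) (tendsto_const_nhds.congr' ?_)
  filter_upwards [eventually_gt_atTop k] with n hn
  exact (Finset.prod_eq_zero (Finset.mem_range.2 hn) h).symm

theorem qPochInf_eq_mul {q : ℂ} (hq : ‖q‖ < 1) (a : ℂ) (m : ℕ) :
    qPochInf a q = qShiftedFactorial a q m * qPochInf (a * q ^ m) q := by
  refine tendsto_nhds_unique ((tendsto_qShiftedFactorial hq a).comp (tendsto_add_atTop_nat m)) ?_
  have := (tendsto_qShiftedFactorial hq (a * q ^ m)).const_mul (qShiftedFactorial a q m)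
  refine this.congr fun n => ?_
  simp [add_comm n m, qShiftedFactorial_add]

theorem continuous_qPochInf {q : ℂ} (hq : ‖q‖ < 1) : Continuous fun a => qPochInf a q := by
  rw [continuous_iff_continuousAt]
  intro a
  have := tendsto_tprod_one_add_of_dominated_convergence (𝓕 := 𝓝 a)
    (f := fun b (k : ℕ) => -(b * q ^ k)) (g := fun k => -(a * q ^ k))
    (bound := fun k => (‖a‖ + 1) * ‖q‖ ^ k)
    ((summable_geometric_of_lt_one (norm_nonneg q) hq).mul_left _)
    (fun k => by
      have : Continuous fun b : ℂ => -(b * q ^ k) := by fun_prop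
      exact this.tendsto a)
    (by
      filter_upwards [Metric.ball_mem_nhds a one_pos] with b hb k
      rw [norm_neg, norm_mul, norm_pow]
      gcongr
      have : b = a + (b - a) := by ring
      rw [this]
      refine (norm_add_le _ _).trans ?_
      gcongr
      exact (mem_ball_iff_norm.1 hb).le)
  simpa [ContinuousAt, qPochInf, sub_eq_add_neg] using this

theorem exists_norm_qShiftedFactorial_le {q : ℂ} (hq : ‖q‖ < 1) (A : ℝ) :
    ∃ M > 0, ∀ a : ℂ, ‖a‖ ≤ A → ∀ n, ‖qShiftedFactorial a q n‖ ≤ M := by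
  have hq' : ‖((‖q‖ : ℝ) : ℂ)‖ < 1 := by simpa using hq
  obtain ⟨M, hM⟩ := (tendsto_qShiftedFactorial hq' (-(|A| : ℝ) : ℂ)).norm.bddAbove_range
  refine ⟨|M| + 1, by positivity, fun a ha n => ?_⟩
  have h1 : ‖qShiftedFactorial (-(|A| : ℝ) : ℂ) (‖q‖ : ℝ) n‖ ≤ M := hM ⟨n, rfl⟩
  refine le_trans ?_ (h1.trans ((le_abs_self M).trans (by linarith)))
  rw [qShiftedFactorial, qShiftedFactorial, norm_prod, norm_prod]
  refine Finset.prod_le_prod (fun _ _ => norm_nonneg _) fun k _ => ?_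
  have h2 : (1 - -(|A| : ℝ) * ((‖q‖ : ℝ) : ℂ) ^ k : ℂ) = ((1 + |A| * ‖q‖ ^ k : ℝ) : ℂ) := by
    push_cast; ring
  rw [h2, Complex.norm_real, Real.norm_of_nonneg (by positivity)]
  refine (norm_sub_le _ _).trans ?_
  rw [norm_one, norm_mul, norm_pow]
  gcongr
  exact ha.trans (le_abs_self A)

theorem exists_le_norm_qShiftedFactorial {a q : ℂ} (hq : ‖q‖ < 1)
    (h : ∀ k : ℕ, 1 - a * q ^ k ≠ 0) :
    ∃ M > 0, ∀ n, ‖(qShiftedFactorial a q n)⁻¹‖ ≤ M := by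
  obtain ⟨M, hM⟩ := ((tendsto_qShiftedFactorial hq a).inv₀
    (qPochInf_ne_zero hq h)).norm.bddAbove_range
  exact ⟨|M| + 1, by positivity, fun n => (hM ⟨n, rfl⟩ : _ ≤ M).trans
    ((le_abs_self M).trans (by linarith))⟩

theorem one_sub_pow_succ_ne_zero {q : ℂ} (hq : ‖q‖ < 1) (k : ℕ) : 1 - q * q ^ k ≠ 0 := by
  intro h
  have : ‖q ^ (k + 1)‖ = 1 := by
    rw [pow_succ']; rw [sub_eq_zero] at h; rw [← h, norm_one]
  rw [norm_pow] at this
  exact (pow_lt_one₀ (norm_nonneg q) hq (Nat.succ_ne_zero k)).ne this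

theorem qShiftedFactorial_self_ne_zero {q : ℂ} (hq : ‖q‖ < 1) (n : ℕ) :
    qShiftedFactorial q q n ≠ 0 :=
  qShiftedFactorial_ne_zero fun k _ => one_sub_pow_succ_ne_zero hq k

theorem qPochInf_self_ne_zero {q : ℂ} (hq : ‖q‖ < 1) : qPochInf q q ≠ 0 :=
  qPochInf_ne_zero hq (one_sub_pow_succ_ne_zero hq)

/-- Reversal of a `q`-shifted factorial with a negative shift of the parameter. -/
theorem qShiftedFactorial_mul_inv_pow {c q : ℂ} (hc : c ≠ 0) (hq : q ≠ 0) (k : ℕ) :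
    qShiftedFactorial (c * (q ^ k)⁻¹) q k =
      (-c) ^ k / q ^ ((k + 1).choose 2) * qShiftedFactorial (q / c) q k := by
  induction k with
  | zero => simp [qShiftedFactorial]
  | succ k ih =>
    have h1 : qShiftedFactorial (c * (q ^ (k + 1))⁻¹) q (k + 1) =
        (1 - c * (q ^ (k + 1))⁻¹) * qShiftedFactorial (c * (q ^ k)⁻¹) q k := by
      rw [add_comm k 1, qShiftedFactorial_add]
      congr 1
      · simp [qShiftedFactorial]
      · congr 1
        field_simp
        ring
    rw [h1, ih, qShiftedFactorial_succ, show (k + 1 + 1).choose 2 = (k + 1) + (k + 1).choose 2 by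
      rw [Nat.choose_succ_succ' (k + 1) 1, Nat.choose_one_right]]
    rw [pow_add q (k + 1)]
    field_simp
    ring

open Polynomial in
/-- Partial fraction expansion with simple poles at `(r i)⁻¹`. -/
theorem eval_div_prod_one_sub_eq_sum {F ι : Type*} [Field F] [DecidableEq ι] {s : Finset ι}
    {r : ι → F} (hr : ∀ i ∈ s, r i ≠ 0) (hinj : Set.InjOn r s) {P : F[X]}
    (hP : P.degree < s.card) {w : F} (hw : ∀ i ∈ s, 1 - r i * w ≠ 0) :
    P.eval w / ∏ i ∈ s, (1 - r i * w) =
      ∑ i ∈ s, P.eval (r i)⁻¹ / (∏ l ∈ s.erase i, (1 - r l * (r i)⁻¹)) / (1 - r i * w) := by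
  have hinj' : Set.InjOn (fun i => (r i)⁻¹) s := fun i hi j hj h => hinj hi hj (inv_injective h)
  conv_lhs => rw [Lagrange.eq_interpolate hinj' hP]
  rw [Lagrange.interpolate_apply, eval_finsetSum, Finset.sum_div]
  refine Finset.sum_congr rfl fun i hi => ?_
  rw [eval_mul, eval_C, Lagrange.basis, eval_prod, ← Finset.mul_prod_erase s _ hi]
  have h1 : ∀ l ∈ s.erase i, eval w (Lagrange.basisDivisor (r i)⁻¹ (r l)⁻¹) =
      (1 - r l * w) / (1 - r l * (r i)⁻¹) := by
    intro l hl
    have hls := Finset.mem_of_mem_erase hl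
    have hl0 := hr l hls
    have hi0 := hr i hi
    have hne : r i - r l ≠ 0 := fun h =>
      Finset.ne_of_mem_erase hl (hinj hls hi (sub_eq_zero.1 h).symm)
    have hne' : r l - r i ≠ 0 := by rwa [← neg_sub, neg_ne_zero]
    have h2 : 1 - r l * (r i)⁻¹ = (r i - r l) / r i := by field_simp
    have h3 : (r i)⁻¹ - (r l)⁻¹ = (r l - r i) / (r i * r l) := by field_simp
    simp only [Lagrange.basisDivisor, eval_mul, eval_C, eval_sub, eval_X]
    rw [h2, h3]
    field_simp
    ring
  rw [Finset.prod_congr rfl h1, Finset.prod_div_distrib]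
  have h4 : ∏ l ∈ s.erase i, (1 - r l * w) ≠ 0 :=
    Finset.prod_ne_zero_iff.2 fun l hl => hw l (Finset.mem_of_mem_erase hl)
  have h5 := hw i hi
  generalize (∏ l ∈ s.erase i, (1 - r l * w)) = A at h4 ⊢
  generalize (∏ l ∈ s.erase i, (1 - r l * (r i)⁻¹)) = B
  generalize 1 - r i * w = D at h5 ⊢
  field_simp

theorem prod_erase_one_sub_pow (q : ℂ) (k r : ℕ) :
    ∏ i ∈ (Finset.range (k + 1 + r)).erase k, (1 - q ^ i * (q ^ k)⁻¹) =
      qShiftedFactorial ((q ^ k)⁻¹) q k * ∏ i ∈ Finset.range r, (1 - q ^ (k + 1 + i) * (q ^ k)⁻¹) := by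
  induction r with
  | zero =>
    simp [Finset.range_add_one, qShiftedFactorial, mul_comm]
  | succ r ih =>
    rw [← add_assoc, Finset.range_add_one, Finset.erase_insert_of_ne (by omega),
      Finset.prod_insert (by simp), ih, Finset.prod_range_succ]
    ring

theorem prod_erase_one_sub_pow' {q : ℂ} (hq : q ≠ 0) {k M : ℕ} (hk : k < M) :
    ∏ i ∈ (Finset.range M).erase k, (1 - q ^ i * (q ^ k)⁻¹) =
      qShiftedFactorial ((q ^ k)⁻¹) q k * qShiftedFactorial q q (M - 1 - k) := by
  obtain ⟨r, rfl⟩ := Nat.exists_eq_add_of_lt hk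
  rw [show k + r + 1 = k + 1 + r by ring, prod_erase_one_sub_pow]
  congr 1
  rw [qShiftedFactorial, show k + 1 + r - 1 - k = r by omega]
  refine Finset.prod_congr rfl fun i _ => ?_
  congr 1
  rw [pow_add, pow_add]
  field_simp

theorem pow_injective_of_norm_lt_one {q : ℂ} (hq0 : q ≠ 0) (hq : ‖q‖ < 1) :
    Function.Injective fun k : ℕ => q ^ k := by
  intro i j h
  have h' : ‖q‖ ^ i = ‖q‖ ^ j := by simpa using congrArg norm h
  exact pow_right_injective₀ (norm_pos_iff.2 hq0) hq.ne h'

open Polynomial in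
theorem inv_qShiftedFactorial_eq_sum {q c : ℂ} (hq0 : q ≠ 0) (hq : ‖q‖ < 1) {M n : ℕ}
    (hn : n < M) (hc : ∀ k < M, 1 - c * q ^ k ≠ 0) :
    c ^ n / qShiftedFactorial c q M =
      ∑ k ∈ Finset.range M, ((q ^ k)⁻¹) ^ n /
        (qShiftedFactorial ((q ^ k)⁻¹) q k * qShiftedFactorial q q (M - 1 - k)) /
          (1 - c * q ^ k) := by
  have := eval_div_prod_one_sub_eq_sum (s := Finset.range M) (r := fun k => q ^ k)
    (fun i _ => pow_ne_zero i hq0) (pow_injective_of_norm_lt_one hq0 hq).injOn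
    (P := X ^ n) (by simpa using hn) (w := c)
    (by intro i hi; rw [mul_comm]; exact hc i (Finset.mem_range.1 hi))
  simp only [eval_pow, eval_X] at this
  rw [qShiftedFactorial, Finset.prod_congr rfl fun k _ => by rw [mul_comm c], this]
  refine Finset.sum_congr rfl fun k hk => ?_
  rw [prod_erase_one_sub_pow' hq0 (Finset.mem_range.1 hk), mul_comm c]

theorem two_mul_choose_succ_two (k : ℕ) : 2 * (((k + 1).choose 2 : ℕ) : ℤ) = k * (k + 1) := by
  have h := Nat.choose_two_right (k + 1)
  have h2 := Nat.div_mul_cancel (Nat.even_mul_pred_self (k + 1)).two_dvd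
  rw [← h, Nat.add_sub_cancel] at h2
  zify at h2
  linarith

/-- The finite form of the partial fraction expansion of `1 / ((c; q)_∞ (q/c; q)_∞)`. -/
theorem inv_qShiftedFactorial_mul_eq_sum {q c : ℂ} (hq0 : q ≠ 0) (hq : ‖q‖ < 1) (hc0 : c ≠ 0)
    (hc : ∀ m : ℤ, 1 - c * q ^ m ≠ 0) (N : ℕ) :
    (qShiftedFactorial c q (N + 1) * qShiftedFactorial (q / c) q N)⁻¹ =
      ∑ m ∈ Finset.Icc (-N : ℤ) N, (-1) ^ m * q ^ (m * (m + 1) / 2) /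
        (qShiftedFactorial q q (N - m).toNat * qShiftedFactorial q q (N + m).toNat) /
          (1 - c * q ^ m) := by
  have h := inv_qShiftedFactorial_eq_sum (q := q) (c := c * (q ^ N)⁻¹) hq0 hq
    (M := N + (N + 1)) (n := N) (by omega)
    (by
      intro k _
      have := hc (k - N)
      rwa [zpow_sub₀ hq0, zpow_natCast, zpow_natCast, div_eq_mul_inv, mul_comm (q ^ k),
        ← mul_assoc] at this)
  have h2 : c * (q ^ N)⁻¹ * q ^ N = c := by field_simp
  rw [qShiftedFactorial_add, qShiftedFactorial_mul_inv_pow hc0 hq0, h2] at h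
  have hA : qShiftedFactorial c q (N + 1) ≠ 0 := qShiftedFactorial_ne_zero fun k _ => by
    simpa using hc k
  have hB : qShiftedFactorial (q / c) q N ≠ 0 := qShiftedFactorial_ne_zero fun k _ => by
    have := hc (-(k + 1))
    intro h0
    apply this
    rw [zpow_neg, ← Nat.cast_succ, zpow_natCast, pow_succ']
    have h3 : q * q ^ k = c := by
      rw [sub_eq_zero, div_mul_eq_mul_div, eq_div_iff hc0, one_mul] at h0
      exact h0.symm
    rw [h3]; field_simp; simp
  have h3 : (c * (q ^ N)⁻¹) ^ N / ((-c) ^ N / q ^ (N + 1).choose 2 * qShiftedFactorial (q / c) q N *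
      qShiftedFactorial c q (N + 1)) = ((-1) ^ N * q ^ (N + 1).choose 2 * ((q ^ N) ^ N)⁻¹) *
      (qShiftedFactorial c q (N + 1) * qShiftedFactorial (q / c) q N)⁻¹ := by
    rw [neg_pow c, mul_pow, inv_pow]
    have hQ : (q ^ N) ^ N ≠ 0 := pow_ne_zero _ (pow_ne_zero _ hq0)
    generalize (q ^ N) ^ N = Q at hQ ⊢
    have : ((-1 : ℂ) ^ N) * (-1) ^ N = 1 := by rw [← mul_pow]; simp
    field_simp
    linear_combination (-1 : ℂ) * this
  have h4 : ((-1 : ℂ) ^ N * q ^ (N + 1).choose 2 * ((q ^ N) ^ N)⁻¹) ≠ 0 := by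
    simp [hq0]
  rw [h3] at h
  apply mul_left_cancel₀ h4
  rw [h, Finset.mul_sum]
  refine Finset.sum_bij (fun k _ => (k : ℤ) - N) ?_ ?_ ?_ ?_
  · intro k hk
    have := Finset.mem_range.1 hk
    rw [Finset.mem_Icc]; omega
  · intro i _ j _ hij
    simpa using hij
  · intro m hm
    rw [Finset.mem_Icc] at hm
    exact ⟨(m + N).toNat, by rw [Finset.mem_range]; omega, by omega⟩
  · intro k hk
    have hk' := Finset.mem_range.1 hk
    have e1 : ((N : ℤ) - ((k : ℤ) - N)).toNat = N + (N + 1) - 1 - k := by omega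
    have e2 : ((N : ℤ) + ((k : ℤ) - N)).toNat = k := by omega
    have e3 := qShiftedFactorial_mul_inv_pow (one_ne_zero : (1 : ℂ) ≠ 0) hq0 k
    rw [one_mul, div_one] at e3
    have e4 : 1 - c * (q ^ N)⁻¹ * q ^ k = 1 - c * q ^ ((k : ℤ) - N) := by
      rw [zpow_sub₀ hq0]; simp; ring
    rw [e1, e2, e3, e4, mul_comm (qShiftedFactorial q q (N + (N + 1) - 1 - k))]
    have e5 : (q ^ k)⁻¹ ^ N * q ^ ((k + 1).choose 2) =
        q ^ (N + 1).choose 2 * ((q ^ N) ^ N)⁻¹ * q ^ (((k : ℤ) - N) * ((k : ℤ) - N + 1) / 2) := by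
      simp only [← zpow_natCast, ← zpow_neg, ← zpow_mul, ← zpow_add₀ hq0]
      congr 1
      have a1 := Int.ediv_mul_cancel (Int.even_mul_succ_self ((k : ℤ) - N)).two_dvd
      have a2 := two_mul_choose_succ_two k
      have a3 := two_mul_choose_succ_two N
      nlinarith
    have e6 : ((-1 : ℂ) ^ k)⁻¹ = (-1) ^ N * (-1) ^ ((k : ℤ) - N) := by
      rw [zpow_sub₀ (by norm_num), ← inv_pow]
      norm_num
      rw [mul_div_cancel₀ _ (pow_ne_zero _ (by norm_num))]
    have e7 : (q ^ k)⁻¹ ^ N / ((-1) ^ k / q ^ (k + 1).choose 2 * qShiftedFactorial q q k *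
        qShiftedFactorial q q (N + (N + 1) - 1 - k)) = ((q ^ k)⁻¹ ^ N * q ^ ((k + 1).choose 2)) *
        ((-1 : ℂ) ^ k)⁻¹ / (qShiftedFactorial q q k *
        qShiftedFactorial q q (N + (N + 1) - 1 - k)) := by
      field_simp
    rw [e7, e5, e6]
    ring

theorem two_mul_tri (n : ℤ) : 2 * (n * (n - 1) / 2) = n * (n - 1) := by
  rw [mul_comm]; exact Int.ediv_mul_cancel (Int.even_mul_pred_self n).two_dvd

theorem tri_add (m n : ℤ) :
    (m + n) * (m + n - 1) / 2 = m * (m - 1) / 2 + n * (n - 1) / 2 + m * n := by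
  have h1 := two_mul_tri m
  have h2 := two_mul_tri n
  have h3 := two_mul_tri (m + n)
  nlinarith

theorem qTheta_term_eq_jacobi (t w : ℂ) (n : ℤ) :
    Complex.exp (-t) ^ (n * (n - 1) / 2) * Complex.exp w ^ n =
      jacobiTheta₂_term n ((w + t / 2) / (2 * Real.pi * Complex.I))
        (Complex.I * t / (2 * Real.pi)) := by
  rw [jacobiTheta₂_term, ← Complex.exp_int_mul, ← Complex.exp_int_mul, ← Complex.exp_add]
  congr 1
  have h := congrArg (fun k : ℤ => (k : ℂ)) (two_mul_tri n)
  push_cast at h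
  have hpi : (Real.pi : ℂ) ≠ 0 := by exact_mod_cast Real.pi_ne_zero
  have hI := Complex.I_sq
  field_simp
  rw [hI]
  linear_combination (-t) * h

theorem qTheta_exp (t w : ℂ) :
    qTheta (Complex.exp (-t)) (Complex.exp w) =
      jacobiTheta₂ ((w + t / 2) / (2 * Real.pi * Complex.I))
        (Complex.I * t / (2 * Real.pi)) :=
  tsum_congr fun n => qTheta_term_eq_jacobi t w n

theorem im_I_mul_div_two_pi {t : ℂ} (ht : 0 < t.re) :
    0 < (Complex.I * t / (2 * Real.pi)).im := by
  have : Complex.I * t / (2 * Real.pi) = ((2 * Real.pi)⁻¹ : ℝ) * (Complex.I * t) := by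
    push_cast; field_simp
  rw [this, Complex.im_ofReal_mul, Complex.I_mul_im]
  positivity

theorem exists_exp_neg_eq {q : ℂ} (hq0 : q ≠ 0) (hq : ‖q‖ < 1) :
    ∃ t : ℂ, 0 < t.re ∧ Complex.exp (-t) = q := by
  refine ⟨-Complex.log q, ?_, by rw [neg_neg, Complex.exp_log hq0]⟩
  rw [Complex.neg_re, Complex.log_re, neg_pos]
  exact Real.log_neg (norm_pos_iff.2 hq0) hq

theorem summable_norm_qTheta_term {q x : ℂ} (hq0 : q ≠ 0) (hq : ‖q‖ < 1) (hx : x ≠ 0) :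
    Summable fun n : ℤ => ‖q ^ (n * (n - 1) / 2) * x ^ n‖ := by
  obtain ⟨t, ht, rfl⟩ := exists_exp_neg_eq hq0 hq
  rw [← Complex.exp_log hx]
  simp_rw [qTheta_term_eq_jacobi]
  exact ((summable_jacobiTheta₂_term_iff _ _).2 (im_I_mul_div_two_pi ht)).norm

theorem qTheta_mul_zpow {q x : ℂ} (hq0 : q ≠ 0) (hx : x ≠ 0) (m : ℤ) :
    qTheta q (x * q ^ m) * (q ^ (m * (m - 1) / 2) * x ^ m) = qTheta q x := by
  conv_rhs => rw [qTheta, ← (Equiv.addRight m).tsum_eq]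
  rw [qTheta, ← tsum_mul_right]
  refine tsum_congr fun n => ?_
  simp only [Equiv.coe_addRight]
  rw [tri_add, zpow_add₀ hq0, zpow_add₀ hq0, zpow_add₀ hx, mul_zpow, ← zpow_mul, mul_comm m n]
  ring

theorem qTheta_ne_zero_mul_zpow_iff {q x : ℂ} (hq0 : q ≠ 0) (hx : x ≠ 0) (m : ℤ) :
    qTheta q (x * q ^ m) ≠ 0 ↔ qTheta q x ≠ 0 := by
  rw [← qTheta_mul_zpow hq0 hx m]
  simp [hq0, hx, zpow_ne_zero]

theorem qTheta_neg_self {q : ℂ} (hq0 : q ≠ 0) : qTheta q (-q) = 0 := by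
  have h : qTheta q (-q) = -qTheta q (-q) := by
    conv_lhs => rw [qTheta, ← (Equiv.subLeft (-1 : ℤ)).tsum_eq]
    rw [qTheta, ← tsum_neg]
    refine tsum_congr fun n => ?_
    have h1 : (-1 - n) * (-1 - n - 1) / 2 = n * (n - 1) / 2 + (2 * n + 1) := by
      have h1 := two_mul_tri n
      have h2 := two_mul_tri (-1 - n)
      nlinarith
    have h2 : (-1 : ℂ) ^ (-1 - n) = -(-1) ^ n := by
      rw [zpow_sub₀ (by norm_num), zpow_neg_one]
      rcases Int.even_or_odd n with h | h <;> simp [h.neg_one_zpow]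
    rw [Equiv.subLeft_apply, h1, neg_eq_neg_one_mul q, mul_zpow, mul_zpow, h2, zpow_add₀ hq0,
      show q ^ (2 * n + 1) = q ^ n * q ^ (n + 1) by rw [← zpow_add₀ hq0]; congr 1; ring]
    have h3 : q ^ (n + 1) * q ^ (-1 - n) = 1 := by
      rw [← zpow_add₀ hq0, show n + 1 + (-1 - n) = 0 by ring, zpow_zero]
    linear_combination (-(q ^ (n * (n - 1) / 2) * q ^ n * (-1) ^ n)) * h3
  linear_combination h / 2

theorem analyticAt_qTheta_const_mul {q a x : ℂ} (hq0 : q ≠ 0) (hq : ‖q‖ < 1) (ha : a ≠ 0)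
    (hx : x ∈ Complex.slitPlane) : AnalyticAt ℂ (fun y => qTheta q (a * y)) x := by
  obtain ⟨t, ht, rfl⟩ := exists_exp_neg_eq hq0 hq
  have h1 : AnalyticAt ℂ (fun z => jacobiTheta₂ z (Complex.I * t / (2 * Real.pi)))
      ((Complex.log a + Complex.log x + t / 2) / (2 * Real.pi * Complex.I)) := by
    have : Differentiable ℂ (fun z => jacobiTheta₂ z (Complex.I * t / (2 * Real.pi))) :=
      fun z => differentiableAt_jacobiTheta₂_fst z (im_I_mul_div_two_pi ht)
    exact this.analyticAt _
  have h2 : AnalyticAt ℂ (fun y => (Complex.log a + Complex.log y + t / 2) /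
      (2 * Real.pi * Complex.I)) x :=
    ((analyticAt_const.add (analyticAt_clog hx)).add analyticAt_const).div_const
  have h3 := h1.comp_of_eq h2 rfl
  refine h3.congr ?_
  filter_upwards [Complex.isOpen_slitPlane.mem_nhds hx] with y hy
  have hy0 : y ≠ 0 := Complex.slitPlane_ne_zero hy
  rw [Function.comp_apply, ← qTheta_exp, Complex.exp_add, Complex.exp_log ha, Complex.exp_log hy0]

theorem continuousAt_qTheta {q x : ℂ} (hq0 : q ≠ 0) (hq : ‖q‖ < 1) (hx : x ≠ 0) :
    ContinuousAt (qTheta q) x := by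
  have h := (analyticAt_qTheta_const_mul hq0 hq hx Complex.one_mem_slitPlane).continuousAt
  have h2 : ContinuousAt (fun y : ℂ => y / x) x := by fun_prop
  have h3 := ContinuousAt.comp_of_eq h h2 (div_self hx)
  refine h3.congr (Eventually.of_forall fun y => ?_)
  simp only [Function.comp_apply]
  rw [mul_div_cancel₀ _ hx]

theorem exists_norm_inv_one_sub_mul_zpow_le {q c : ℂ} (hq : ‖q‖ < 1) (hq0 : q ≠ 0)
    (hc0 : c ≠ 0) :
    ∃ A > 0, ∀ m : ℤ, ‖(1 - c * q ^ m)⁻¹‖ ≤ A := by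
  have hp := tendsto_pow_atTop_nhds_zero_of_norm_lt_one hq
  have h1 : Tendsto (fun n : ℕ => (1 - c * q ^ n)⁻¹) atTop (𝓝 (1 - c * 0)⁻¹) :=
    ((hp.const_mul c).const_sub 1).inv₀ (by simp)
  have h2 : Tendsto (fun n : ℕ => q ^ n * (q ^ n - c)⁻¹) atTop (𝓝 (0 * (0 - c)⁻¹)) :=
    hp.mul ((hp.sub_const c).inv₀ (by simpa using hc0))
  obtain ⟨A, hA⟩ := h1.norm.bddAbove_range
  obtain ⟨B, hB⟩ := h2.norm.bddAbove_range
  refine ⟨max (max A B) 1, by positivity, fun m => ?_⟩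
  obtain ⟨n, rfl | rfl⟩ := m.eq_nat_or_neg
  · rw [zpow_natCast]
    exact ((hA ⟨n, rfl⟩ : _ ≤ A).trans (le_max_left _ _)).trans (le_max_left _ _)
  · have : (1 - c * q ^ (-(n : ℤ)))⁻¹ = q ^ n * (q ^ n - c)⁻¹ := by
      have hn : q ^ n ≠ 0 := pow_ne_zero n hq0
      rw [zpow_neg, zpow_natCast, show 1 - c * (q ^ n)⁻¹ = (q ^ n - c) * (q ^ n)⁻¹ by field_simp,
        mul_inv, inv_inv, mul_comm]
    rw [this]
    exact ((hB ⟨n, rfl⟩ : _ ≤ B).trans (le_max_right _ _)).trans (le_max_left _ _)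

/-- The partial fraction expansion of `(q; q)_∞² / ((c; q)_∞ (q/c; q)_∞)`. -/
theorem tsum_neg_one_zpow_div_one_sub {q c : ℂ} (hq0 : q ≠ 0) (hq : ‖q‖ < 1) (hc0 : c ≠ 0)
    (hc : ∀ m : ℤ, 1 - c * q ^ m ≠ 0) :
    ∑' m : ℤ, (-1) ^ m * q ^ (m * (m + 1) / 2) / (1 - c * q ^ m) =
      qPochInf q q ^ 2 / (qPochInf c q * qPochInf (q / c) q) := by
  obtain ⟨A, hA, hA'⟩ := exists_norm_inv_one_sub_mul_zpow_le hq hq0 hc0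
  obtain ⟨B, hB, hB'⟩ := exists_le_norm_qShiftedFactorial hq (one_sub_pow_succ_ne_zero hq)
  have hE := qPochInf_self_ne_zero hq
  have hlim := tendsto_qShiftedFactorial hq q
  have htoNat : Tendsto Int.toNat atTop atTop :=
    tendsto_atTop.2 fun b => (eventually_ge_atTop (b : ℤ)).mono fun a ha => by omega
  have key := tendsto_tsum_of_dominated_convergence (𝓕 := (atTop : Filter ℕ))
    (f := fun N (m : ℤ) => if m ∈ Finset.Icc (-N : ℤ) N then (-1) ^ m * q ^ (m * (m + 1) / 2) /
        (qShiftedFactorial q q (N - m).toNat * qShiftedFactorial q q (N + m).toNat) /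
          (1 - c * q ^ m) else 0)
    (g := fun m => (-1) ^ m * q ^ (m * (m + 1) / 2) / (qPochInf q q * qPochInf q q) /
          (1 - c * q ^ m))
    (bound := fun m => ‖q ^ (m * (m - 1) / 2) * q ^ m‖ * (B * B) * A)
    (((summable_norm_qTheta_term hq0 hq hq0).mul_right _).mul_right _)
    (fun m => by
      have h1 : Tendsto (fun N : ℕ => qShiftedFactorial q q ((N : ℤ) - m).toNat) atTop
          (𝓝 (qPochInf q q)) := hlim.comp (htoNat.comp
            (tendsto_atTop_add_const_right _ (-m) tendsto_natCast_atTop_atTop))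
      have h2 : Tendsto (fun N : ℕ => qShiftedFactorial q q ((N : ℤ) + m).toNat) atTop
          (𝓝 (qPochInf q q)) := hlim.comp (htoNat.comp
            (tendsto_atTop_add_const_right _ m tendsto_natCast_atTop_atTop))
      refine (((tendsto_const_nhds (x := (-1 : ℂ) ^ m * q ^ (m * (m + 1) / 2))).div (h1.mul h2)
        (mul_ne_zero hE hE)).div_const (1 - c * q ^ m)).congr' ?_
      filter_upwards [eventually_ge_atTop m.natAbs] with N hN
      rw [if_pos (by rw [Finset.mem_Icc]; omega)]
      rfl)
    (Eventually.of_forall fun N m => by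
      split_ifs
      · have e : m * (m + 1) / 2 = m * (m - 1) / 2 + m := by
          have h1 := two_mul_tri m
          have h2 := two_mul_tri (m + 1)
          rw [add_sub_cancel_right, mul_comm (m + 1)] at h2
          nlinarith
        rw [e, zpow_add₀ hq0, div_eq_mul_inv, div_eq_mul_inv, mul_inv, norm_mul, norm_mul,
          norm_mul ((-1 : ℂ) ^ m), norm_mul (qShiftedFactorial _ _ _)⁻¹,
          norm_zpow (-1 : ℂ), norm_neg, norm_one, one_zpow, one_mul]
        exact mul_le_mul (mul_le_mul_of_nonneg_left (mul_le_mul (hB' _) (hB' _) (norm_nonneg _)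
          hB.le) (norm_nonneg _)) (hA' _) (norm_nonneg _) (by positivity)
      · rw [norm_zero]; positivity)
  have hE1 : qPochInf c q ≠ 0 := qPochInf_ne_zero hq fun k => by simpa using hc k
  have hE2 : qPochInf (q / c) q ≠ 0 := qPochInf_ne_zero hq fun k h0 => by
    rw [sub_eq_zero, div_mul_eq_mul_div, eq_div_iff hc0, one_mul] at h0
    apply hc (-(k + 1 : ℕ))
    rw [zpow_neg, zpow_natCast, pow_succ', ← h0, mul_inv_cancel₀ hc0, sub_self]
  have lim2 : Tendsto (fun N => (qShiftedFactorial c q (N + 1) *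
      qShiftedFactorial (q / c) q N)⁻¹) atTop (𝓝 (qPochInf c q * qPochInf (q / c) q)⁻¹) :=
    (((tendsto_qShiftedFactorial hq c).comp (tendsto_add_atTop_nat 1)).mul
      (tendsto_qShiftedFactorial hq (q / c))).inv₀ (mul_ne_zero hE1 hE2)
  have := tendsto_nhds_unique (key.congr fun N => ?_) lim2
  · rw [div_eq_mul_inv (qPochInf q q ^ 2), ← this, ← tsum_mul_left]
    refine tsum_congr fun m => ?_
    field_simp
  · rw [inv_qShiftedFactorial_mul_eq_sum hq0 hq hc0 hc,
      tsum_eq_sum (s := Finset.Icc (-N : ℤ) N) fun m hm => if_neg hm]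
    exact Finset.sum_congr rfl fun m hm => if_pos hm

theorem summable_zpow_div_one_sub {q z c : ℂ} (hq0 : q ≠ 0) (hq : ‖q‖ < 1) (hzq : ‖q‖ < ‖z‖)
    (hz : ‖z‖ < 1) (hc0 : c ≠ 0) (hc : ∀ m : ℤ, 1 - c * q ^ m ≠ 0) :
    Summable fun n : ℤ => ‖z ^ n / (1 - c * q ^ n)‖ := by
  have hz0 : z ≠ 0 := norm_pos_iff.1 ((norm_nonneg q).trans_lt hzq)
  obtain ⟨A, hA, hA'⟩ := exists_norm_inv_one_sub_mul_zpow_le hq hq0 hc0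
  have hq1 : ‖q⁻¹‖ ≠ 0 := by simpa using hq0
  obtain ⟨B, hB, hB'⟩ := exists_norm_inv_one_sub_mul_zpow_le (c := c⁻¹) hq hq0 (inv_ne_zero hc0)
  apply Summable.of_nat_of_neg
  · refine Summable.of_nonneg_of_le (fun _ => norm_nonneg _) (fun n => ?_)
      ((summable_geometric_of_lt_one (norm_nonneg z) hz).mul_right A)
    rw [div_eq_mul_inv, norm_mul, zpow_natCast, norm_pow]
    gcongr
    simpa using hA' n
  · have hr : ‖q‖ / ‖z‖ < 1 := (div_lt_one (norm_pos_iff.2 hz0)).2 hzq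
    refine Summable.of_nonneg_of_le (fun _ => norm_nonneg _) (fun n => ?_)
      ((summable_geometric_of_lt_one (by positivity) hr).mul_right (B * ‖c⁻¹‖))
    have h1 : z ^ (-(n : ℤ)) / (1 - c * q ^ (-(n : ℤ))) =
        -((q / z) ^ n * ((1 - c⁻¹ * q ^ (n : ℤ))⁻¹ * c⁻¹)) := by
      have hn : q ^ n ≠ 0 := pow_ne_zero n hq0
      have hn' : z ^ n ≠ 0 := pow_ne_zero n hz0
      have h2 := hc (-n)
      have h3 : 1 - c⁻¹ * q ^ (n : ℤ) = -(1 - c * q ^ (-(n : ℤ))) * (c⁻¹ * q ^ n) := by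
        rw [zpow_neg, zpow_natCast]; field_simp; ring
      rw [h3, div_pow, zpow_neg, zpow_natCast]
      field_simp
    rw [h1, norm_neg, norm_mul, norm_mul, norm_pow, norm_div]
    gcongr
    exact hB' n

theorem tsum_theta_shift_step {q c : ℂ} (hq0 : q ≠ 0) (hq : ‖q‖ < 1) (hc0 : c ≠ 0)
    (hc : ∀ m : ℤ, 1 - c * q ^ m ≠ 0) (N : ℤ) :
    ∑' m : ℤ, (-1) ^ m * q ^ (m * (m - 1) / 2) / (1 - c * q ^ (N + 1 - m)) =
      -(c * q ^ N) * ∑' m : ℤ, (-1) ^ m * q ^ (m * (m - 1) / 2) / (1 - c * q ^ (N - m)) := by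
  obtain ⟨A, hA, hA'⟩ := exists_norm_inv_one_sub_mul_zpow_le hq hq0 hc0
  have hsum : Summable fun m : ℤ =>
      (-1) ^ m * q ^ (m * (m - 1) / 2) / (1 - c * q ^ (N - m)) := by
    refine Summable.of_norm_bounded
      ((summable_norm_qTheta_term hq0 hq (neg_ne_zero.2 one_ne_zero)).mul_right A) fun m => ?_
    rw [div_eq_mul_inv, norm_mul, mul_comm ((-1) ^ m)]
    gcongr
    exact hA' _
  have hsum2 : Summable fun m : ℤ => q ^ (m * (m - 1) / 2) * (-q) ^ m :=
    (summable_norm_qTheta_term hq0 hq (neg_ne_zero.2 hq0)).of_norm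
  rw [← (Equiv.addRight (1 : ℤ)).tsum_eq, ← tsum_mul_left]
  have h0 : ∑' m : ℤ, q ^ (m * (m - 1) / 2) * (-q) ^ m = 0 := qTheta_neg_self hq0
  rw [← sub_eq_zero, ← neg_eq_zero, ← h0, ← Summable.tsum_sub _ (hsum.mul_left _), ← tsum_neg]
  · refine tsum_congr fun m => ?_
    have hcm := hc (N - m)
    have e : N + 1 - (m + 1) = N - m := by ring
    have e2 : q ^ N = q ^ (N - m) * q ^ m := by rw [← zpow_add₀ hq0]; simp
    simp only [Equiv.coe_addRight]
    rw [tri_add, e, zpow_add₀ hq0, zpow_add₀ hq0, zpow_add₀ (by norm_num), neg_eq_neg_one_mul q,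
      mul_zpow, e2]
    field_simp
    simp
    ring
  · have := (hsum2.neg).add (hsum.mul_left (-(c * q ^ N)))
    refine this.congr fun m => ?_
    have hcm := hc (N - m)
    have e : N + 1 - (m + 1) = N - m := by ring
    have e2 : q ^ N = q ^ (N - m) * q ^ m := by rw [← zpow_add₀ hq0]; simp
    simp only [Equiv.coe_addRight]
    rw [tri_add, e, zpow_add₀ hq0, zpow_add₀ hq0, zpow_add₀ (by norm_num), neg_eq_neg_one_mul q,
      mul_zpow, e2]
    field_simp
    simp
    ring

theorem tsum_theta_shift {q c : ℂ} (hq0 : q ≠ 0) (hq : ‖q‖ < 1) (hc0 : c ≠ 0)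
    (hc : ∀ m : ℤ, 1 - c * q ^ m ≠ 0) (N : ℤ) :
    ∑' m : ℤ, (-1) ^ m * q ^ (m * (m - 1) / 2) / (1 - c * q ^ (N - m)) =
      (-c) ^ N * q ^ (N * (N - 1) / 2) *
        (qPochInf q q ^ 2 / (qPochInf c q * qPochInf (q / c) q)) := by
  have step := tsum_theta_shift_step hq0 hq hc0 hc
  induction N using Int.induction_on with
  | zero =>
    rw [← tsum_neg_one_zpow_div_one_sub hq0 hq hc0 hc, ← (Equiv.neg ℤ).tsum_eq]
    simp only [zpow_zero, zero_mul, Int.zero_ediv, one_mul]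
    refine tsum_congr fun m => ?_
    rw [Equiv.neg_apply, show -m * (-m - 1) = m * (m + 1) by ring, zpow_neg, ← inv_zpow]
    norm_num
  | succ k ih =>
    rw [step, ih, tri_add, zpow_add₀ hq0, zpow_add₀ hq0, zpow_add₀ (neg_ne_zero.2 hc0)]
    simp
    ring
  | pred k ih =>
    have h := step (-k - 1)
    rw [sub_add_cancel, ih, ← sub_eq_zero] at h
    have e := tri_add (-k - 1) 1
    rw [sub_add_cancel, mul_one] at e
    have hne : c * q ^ (-(k : ℤ) - 1) ≠ 0 := mul_ne_zero hc0 (zpow_ne_zero _ hq0)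
    apply mul_left_cancel₀ hne
    rw [e, zpow_add₀ hq0, zpow_add₀ hq0,
      show (-c) ^ (-(k : ℤ)) = (-c) ^ (-(k : ℤ) - 1) * (-c) by
        rw [← zpow_add_one₀ (neg_ne_zero.2 hc0), sub_add_cancel]] at h
    simp at h
    linear_combination h

/-- The bilateral sum of Kronecker as a quotient of theta functions. -/
theorem qTheta_mul_tsum_zpow_div {q z c : ℂ} (hq0 : q ≠ 0) (hq : ‖q‖ < 1) (hzq : ‖q‖ < ‖z‖)
    (hz : ‖z‖ < 1) (hc0 : c ≠ 0) (hc : ∀ m : ℤ, 1 - c * q ^ m ≠ 0) :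
    qTheta q (-z) * ∑' n : ℤ, z ^ n / (1 - c * q ^ n) =
      qPochInf q q ^ 2 / (qPochInf c q * qPochInf (q / c) q) * qTheta q (-(c * z)) := by
  have hz0 : z ≠ 0 := norm_pos_iff.1 ((norm_nonneg q).trans_lt hzq)
  have h1 := summable_norm_qTheta_term hq0 hq (neg_ne_zero.2 hz0)
  have h2 := summable_zpow_div_one_sub hq0 hq hzq hz hc0 hc
  let e : ℤ × ℤ ≃ ℤ × ℤ :=
    { toFun := fun p => (p.2, p.1 - p.2)
      invFun := fun p => (p.1 + p.2, p.1)
      left_inv := fun p => by simp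
      right_inv := fun p => by simp }
  rw [qTheta, tsum_mul_tsum_of_summable_norm h1 h2, ← e.tsum_eq]
  have h3 := (summable_mul_of_summable_norm h1 h2).comp_injective e.injective
  refine (Summable.tsum_prod h3).trans ?_
  rw [qTheta, ← tsum_mul_left]
  refine tsum_congr fun N => ?_
  have h4 := tsum_theta_shift hq0 hq hc0 hc N
  rw [show (-(c * z)) ^ N = (-c) ^ N * z ^ N by rw [← neg_mul, mul_zpow]]
  calc _ = ∑' m : ℤ, z ^ N * ((-1) ^ m * q ^ (m * (m - 1) / 2) / (1 - c * q ^ (N - m))) := by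
        refine tsum_congr fun m => ?_
        simp only [e, Function.comp_apply, Equiv.coe_fn_mk]
        rw [neg_eq_neg_one_mul, mul_zpow, zpow_sub₀ hz0]
        have := zpow_ne_zero m hz0
        field_simp
    _ = _ := by
        rw [tsum_mul_left, h4]
        ring

open Finset in
/-- The coefficients of the expansions at infinity of `₃φ₂(a₁, a₂, a₃; b, 0; q, ·)`. -/
def connectionCoeff (a : Fin 3 → ℂ) (b q : ℂ) (j : Fin 3) (k : ℕ) : ℂ :=
  q ^ (k + 1).choose 2 * (b * q / ∏ l ∈ univ.erase j, a l) ^ k *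
    (qShiftedFactorial (a j) q k * qShiftedFactorial (q * a j / b) q k) /
      ((∏ l ∈ univ.erase j, qShiftedFactorial (q * a j / a l) q k) * qShiftedFactorial q q k)

/-- The residues of `(bw, qw; q)_∞ / (a₁w, a₂w, a₃w; q)_∞` at `w = 1 / aⱼ`. -/
def residueCoeff (a : Fin 3 → ℂ) (b q : ℂ) (j : Fin 3) : ℂ :=
  qPochInf (b / a j) q * qPochInf (q / a j) q /
    ((∏ l ∈ Finset.univ.erase j, qPochInf (a l / a j) q) * qPochInf q q)

theorem qShiftedFactorial_mul_inv_pow_of_le {c q : ℂ} (hc : c ≠ 0) (hq : q ≠ 0) {k M : ℕ}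
    (hk : k ≤ M) :
    qShiftedFactorial (c * (q ^ k)⁻¹) q M =
      (-c) ^ k / q ^ ((k + 1).choose 2) * qShiftedFactorial (q / c) q k *
        qShiftedFactorial c q (M - k) := by
  conv_lhs => rw [← Nat.add_sub_cancel' hk]
  rw [qShiftedFactorial_add, qShiftedFactorial_mul_inv_pow hc hq]
  congr 2
  field_simp

open Finset in
theorem prod_erase_product {q : ℂ} (hq0 : q ≠ 0) {a : Fin 3 → ℂ} (ha : ∀ j, a j ≠ 0) (j : Fin 3)
    {k M : ℕ} (hk : k < M) :
    ∏ p ∈ (univ ×ˢ range M).erase (j, k), (1 - a p.1 * q ^ p.2 * (a j * q ^ k)⁻¹) =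
      (∏ l ∈ univ.erase j, qShiftedFactorial (a l / a j * (q ^ k)⁻¹) q M) *
        (qShiftedFactorial ((q ^ k)⁻¹) q k * qShiftedFactorial q q (M - 1 - k)) := by
  have hset : (univ ×ˢ range M).erase (j, k) =
      ((univ.erase j) ×ˢ range M) ∪ ({j} ×ˢ (range M).erase k) := by
    ext ⟨l, i⟩
    simp only [mem_erase, mem_product, mem_univ, true_and, mem_union, mem_singleton, ne_eq,
      Prod.mk.injEq]
    tauto
  have hdisj : Disjoint ((univ.erase j) ×ˢ range M) ({j} ×ˢ (range M).erase k) := by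
    rw [Finset.disjoint_left]
    rintro ⟨l, i⟩ h1 h2
    simp only [mem_erase, mem_product, mem_singleton] at h1 h2
    exact h1.1.1 h2.1
  have hj := ha j
  rw [hset, prod_union hdisj, prod_product, prod_product, prod_singleton,
    ← prod_erase_one_sub_pow' hq0 hk]
  congr 1
  · refine prod_congr rfl fun l _ => ?_
    rw [qShiftedFactorial]
    refine prod_congr rfl fun i _ => ?_
    field_simp
  · refine prod_congr rfl fun i _ => ?_
    field_simp

theorem mul_pow_injOn {q : ℂ} (hq0 : q ≠ 0) (hq : ‖q‖ < 1) {a : Fin 3 → ℂ} (ha : ∀ j, a j ≠ 0)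
    (hne : ∀ j l, j ≠ l → ∀ m : ℤ, 1 - a l / a j * q ^ m ≠ 0) :
    Function.Injective fun p : Fin 3 × ℕ => a p.1 * q ^ p.2 := by
  rintro ⟨j, k⟩ ⟨l, i⟩ h
  simp only at h
  by_cases hjl : j = l
  · subst hjl
    rw [pow_injective_of_norm_lt_one hq0 hq (mul_left_cancel₀ (ha j) h)]
  · exfalso
    apply hne j l hjl (i - k)
    have hj := ha j
    have hk : q ^ k ≠ 0 := pow_ne_zero k hq0
    rw [zpow_sub₀ hq0, zpow_natCast, zpow_natCast, div_mul_div_comm, ← h, div_self, sub_self]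
    exact mul_ne_zero hj hk

open Finset Polynomial in
theorem qShiftedFactorial_quotient_eq_sum {q : ℂ} (hq0 : q ≠ 0) (hq : ‖q‖ < 1) {a : Fin 3 → ℂ}
    (ha : ∀ j, a j ≠ 0) (b : ℂ) (hne : ∀ j l, j ≠ l → ∀ m : ℤ, 1 - a l / a j * q ^ m ≠ 0)
    {w : ℂ} (hw : ∀ j, ∀ k : ℕ, 1 - a j * q ^ k * w ≠ 0) {M : ℕ} (hM : 0 < M) :
    qShiftedFactorial (b * w) q M * qShiftedFactorial (q * w) q M /
        ∏ j, qShiftedFactorial (a j * w) q M =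
      ∑ j, ∑ k ∈ range M,
        qShiftedFactorial (b / a j * (q ^ k)⁻¹) q M * qShiftedFactorial (q / a j * (q ^ k)⁻¹) q M /
          ((∏ l ∈ univ.erase j, qShiftedFactorial (a l / a j * (q ^ k)⁻¹) q M) *
            (qShiftedFactorial ((q ^ k)⁻¹) q k * qShiftedFactorial q q (M - 1 - k))) /
          (1 - a j * q ^ k * w) := by
  let P : ℂ[X] := (∏ i ∈ range M, (1 - C (b * q ^ i) * X)) * ∏ i ∈ range M, (1 - C (q * q ^ i) * X)
  have hlin : ∀ c : ℂ, ((1 : ℂ[X]) - C c * X).natDegree ≤ 1 := fun c => by compute_degree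
  have hPd : P.natDegree ≤ M + M := by
    refine natDegree_mul_le.trans (add_le_add ?_ ?_) <;>
    · refine (natDegree_prod_le _ _).trans ((sum_le_sum fun i _ => hlin _).trans ?_)
      simp
  have hP : P.degree < ((univ : Finset (Fin 3)) ×ˢ range M).card := by
    refine degree_le_natDegree.trans_lt ?_
    rw [Nat.cast_lt]
    simp
    omega
  have hPe : ∀ x, P.eval x = qShiftedFactorial (b * x) q M * qShiftedFactorial (q * x) q M := by
    intro x
    simp only [P, eval_mul, eval_prod, eval_sub, eval_one, eval_C, eval_X, qShiftedFactorial]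
    congr 1 <;> exact prod_congr rfl fun i _ => by ring
  have key := eval_div_prod_one_sub_eq_sum (s := (univ : Finset (Fin 3)) ×ˢ range M)
    (r := fun p => a p.1 * q ^ p.2) (fun p _ => mul_ne_zero (ha p.1) (pow_ne_zero _ hq0))
    (mul_pow_injOn hq0 hq ha hne).injOn hP (w := w) (fun p _ => hw p.1 p.2)
  rw [hPe, prod_product, sum_product] at key
  convert key using 1
  · congr 1
    refine prod_congr rfl fun j _ => ?_
    rw [qShiftedFactorial]
    exact prod_congr rfl fun i _ => by ring
  · refine sum_congr rfl fun j _ => sum_congr rfl fun k hk => ?_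
    rw [prod_erase_product hq0 ha j (mem_range.1 hk), hPe]
    have hj := ha j
    congr 3
    · congr 1
      field_simp
    · congr 1
      field_simp

open Finset in
theorem residue_quotient_eq {q b : ℂ} (hq0 : q ≠ 0) {a : Fin 3 → ℂ}
    (ha : ∀ j, a j ≠ 0) (hb : b ≠ 0) (j : Fin 3) {k M : ℕ} (hk : k < M) :
    qShiftedFactorial (b / a j * (q ^ k)⁻¹) q M * qShiftedFactorial (q / a j * (q ^ k)⁻¹) q M /
        ((∏ l ∈ univ.erase j, qShiftedFactorial (a l / a j * (q ^ k)⁻¹) q M) *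
          (qShiftedFactorial ((q ^ k)⁻¹) q k * qShiftedFactorial q q (M - 1 - k))) =
      (-1) ^ k * connectionCoeff a b q j k *
        (qShiftedFactorial (b / a j) q (M - k) * qShiftedFactorial (q / a j) q (M - k) /
          ((∏ l ∈ univ.erase j, qShiftedFactorial (a l / a j) q (M - k)) *
            qShiftedFactorial q q (M - 1 - k))) := by
  have hj := ha j
  have e0 := qShiftedFactorial_mul_inv_pow (one_ne_zero : (1 : ℂ) ≠ 0) hq0 k
  rw [one_mul, div_one] at e0
  rw [qShiftedFactorial_mul_inv_pow_of_le (div_ne_zero hb hj) hq0 hk.le,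
    qShiftedFactorial_mul_inv_pow_of_le (div_ne_zero hq0 hj) hq0 hk.le, e0,
    prod_congr rfl fun l _ => qShiftedFactorial_mul_inv_pow_of_le (div_ne_zero (ha l) hj) hq0 hk.le,
    prod_mul_distrib, prod_mul_distrib, connectionCoeff]
  have e1 : ∏ l ∈ univ.erase j, ((-(a l / a j)) ^ k / q ^ (k + 1).choose 2) =
      (∏ l ∈ univ.erase j, a l) ^ k / ((a j) ^ k * q ^ (k + 1).choose 2) ^ 2 := by
    have e2 : ∀ l ∈ univ.erase j, (-(a l / a j)) ^ k / q ^ (k + 1).choose 2 =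
        (-1) ^ k * (a l) ^ k / ((a j) ^ k * q ^ (k + 1).choose 2) := fun l _ => by
      rw [neg_pow, div_pow]; field_simp
    rw [prod_congr rfl e2, prod_div_distrib, prod_mul_distrib, prod_const, prod_const,
      card_erase_of_mem (mem_univ j)]
    simp only [Fintype.card_fin, card_univ, Nat.add_one_sub_one, prod_pow]
    rw [← pow_mul (-1 : ℂ), mul_comm k 2, pow_mul (-1 : ℂ)]
    simp
  have hA : ∏ l ∈ univ.erase j, a l ≠ 0 := prod_ne_zero_iff.2 fun l _ => ha l
  have e3 : ∀ l ∈ univ.erase j, qShiftedFactorial (q / (a l / a j)) q k =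
      qShiftedFactorial (q * a j / a l) q k := fun l _ => by
    congr 1; have := ha l; field_simp
  have e4 : q / (b / a j) = q * a j / b := by field_simp
  have e5 : q / (q / a j) = a j := by field_simp
  rw [e1, prod_congr rfl e3, e4, e5, neg_pow (b / a j), neg_pow (q / a j), div_pow, div_pow, div_pow,
    mul_pow]
  have hs : ((-1 : ℂ) ^ k) * (-1) ^ k = 1 := by rw [← mul_pow]; simp
  have hs0 : ((-1 : ℂ) ^ k) ≠ 0 := pow_ne_zero _ (by norm_num)
  generalize ((-1 : ℂ) ^ k) = s at hs hs0 ⊢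
  generalize q ^ (k + 1).choose 2 = T at *
  generalize (∏ l ∈ univ.erase j, a l) = A at *
  have hs' : s⁻¹ = s := inv_eq_of_mul_eq_one_left hs
  simp only [div_eq_mul_inv, mul_inv, inv_inv, hs', mul_pow]
  by_cases hT : T = 0
  · simp [hT]
  have hjk : a j ^ k ≠ 0 := pow_ne_zero _ hj
  generalize a j ^ k = J at hjk ⊢
  field_simp
  rw [pow_two, hs, one_mul]

open Finset in
theorem exists_norm_connectionCoeff_le {q : ℂ} (hq : ‖q‖ < 1) {a : Fin 3 → ℂ}
    {b : ℂ} (j : Fin 3)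
    (hne : ∀ l, j ≠ l → ∀ m : ℕ, 1 - q * a j / a l * q ^ m ≠ 0) :
    ∃ B > 0, ∀ s : ℂ, ‖s‖ ≤ 2 → s ≠ 0 → ∀ k, ‖connectionCoeff (fun l => s * a l) b q j k‖ ≤
      B * (‖q‖ ^ (k + 1).choose 2 * ‖b * q / (s ^ 2 * ∏ l ∈ univ.erase j, a l)‖ ^ k) := by
  obtain ⟨M1, hM1, h1⟩ := exists_norm_qShiftedFactorial_le hq (2 * ‖a j‖)
  obtain ⟨M2, hM2, h2⟩ := exists_norm_qShiftedFactorial_le hq (‖q * 2 * a j / b‖)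
  obtain ⟨M3, hM3, h3⟩ := exists_le_norm_qShiftedFactorial hq (one_sub_pow_succ_ne_zero hq)
  have : ∀ l : Fin 3, ∃ M > 0, j ≠ l → ∀ n, ‖(qShiftedFactorial (q * a j / a l) q n)⁻¹‖ ≤ M := by
    intro l
    by_cases hl : j = l
    · exact ⟨1, one_pos, fun h => absurd hl h⟩
    · obtain ⟨M, hM, h⟩ := exists_le_norm_qShiftedFactorial hq (hne l hl)
      exact ⟨M, hM, fun _ => h⟩
  choose M hM h4 using this
  refine ⟨M1 * M2 * ((∏ l ∈ univ.erase j, M l) * M3),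
    mul_pos (mul_pos hM1 hM2) (mul_pos (prod_pos fun l _ => hM l) hM3), fun s hs hs0 k => ?_⟩
  have e1 : ∏ l ∈ univ.erase j, s * a l = s ^ 2 * ∏ l ∈ univ.erase j, a l := by
    rw [prod_mul_distrib, prod_const, card_erase_of_mem (mem_univ j)]
    simp
  have e2 : ∀ l, q * (s * a j) / (s * a l) = q * a j / a l := fun l => by
    rw [mul_left_comm, mul_div_mul_left _ _ hs0]
  simp only [connectionCoeff, e1, e2]
  rw [div_eq_mul_inv, mul_inv, norm_mul, norm_mul, norm_mul, norm_pow, norm_pow, norm_mul,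
    norm_mul (∏ l ∈ univ.erase j, _)⁻¹, ← prod_inv_distrib, norm_prod, mul_assoc, mul_comm]
  refine mul_le_mul_of_nonneg_right ?_ (by positivity)
  refine mul_le_mul (mul_le_mul (h1 _ ?_ k) (h2 _ ?_ k) (norm_nonneg _) hM1.le)
    (mul_le_mul (prod_le_prod (fun _ _ => norm_nonneg _) fun l hl =>
      h4 l (ne_of_mem_erase hl).symm k) (h3 k) (norm_nonneg _) (prod_nonneg fun l _ => (hM l).le))
    (by positivity) (by positivity)
  · rw [norm_mul]; gcongr
  · rw [norm_div, norm_div, norm_mul, norm_mul, norm_mul, norm_mul]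
    have : ‖(2 : ℂ)‖ = 2 := by simp
    rw [this, mul_assoc]
    gcongr

theorem summable_pow_choose_mul_pow {q : ℂ} (hq0 : q ≠ 0) (hq : ‖q‖ < 1) (r : ℝ) :
    Summable fun k : ℕ => ‖q‖ ^ (k + 1).choose 2 * r ^ k := by
  by_cases hr : r = 0
  · subst hr
    exact summable_of_ne_finset_zero (s := {0}) fun k hk => by
      simp only [Finset.mem_singleton] at hk
      simp [hk]
  have := (summable_norm_qTheta_term hq0 hq
    (mul_ne_zero hq0 (Complex.ofReal_ne_zero.2 hr))).comp_injective Nat.cast_injective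
  rw [← summable_norm_iff]
  refine this.congr fun k => ?_
  have e : ((k : ℤ) * (k - 1) / 2) + k = ((k + 1).choose 2 : ℕ) := by
    have h1 := two_mul_tri k
    have h2 := two_mul_choose_succ_two k
    nlinarith
  rw [Function.comp_apply, mul_zpow, ← mul_assoc, ← zpow_add₀ hq0, e]
  simp

theorem summable_norm_connectionCoeff {q : ℂ} (hq0 : q ≠ 0) (hq : ‖q‖ < 1) {a : Fin 3 → ℂ}
    {b : ℂ} (j : Fin 3) (hne : ∀ l, j ≠ l → ∀ m : ℕ, 1 - q * a j / a l * q ^ m ≠ 0) (z : ℂ) :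
    Summable fun k : ℕ => ‖connectionCoeff a b q j k * z ^ k‖ := by
  obtain ⟨B, hB, h⟩ := exists_norm_connectionCoeff_le (b := b) hq j hne
  refine Summable.of_nonneg_of_le (fun _ => norm_nonneg _) (fun k => ?_)
    ((summable_pow_choose_mul_pow hq0 hq
      (‖b * q / (∏ l ∈ Finset.univ.erase j, a l)‖ * ‖z‖)).mul_left B)
  have := h 1 (by simp) one_ne_zero k
  simp only [one_mul, one_pow] at this
  rw [norm_mul, norm_pow, mul_pow, ← mul_assoc (‖q‖ ^ _), ← mul_assoc]
  gcongr

open Finset in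
/-- Partial fractions of `(bw, qw; q)_∞ / (a₁w, a₂w, a₃w; q)_∞` at an integral power `w` of `q`. -/
theorem qPochInf_quotient_eq_sum_tsum {q b : ℂ} (hq0 : q ≠ 0) (hq : ‖q‖ < 1) {a : Fin 3 → ℂ}
    (ha : ∀ j, a j ≠ 0) (hb : b ≠ 0) (hne : ∀ j l, j ≠ l → ∀ m : ℤ, 1 - a l / a j * q ^ m ≠ 0)
    (hgen : ∀ j, ∀ m : ℤ, 1 - a j * q ^ m ≠ 0) (n : ℤ) :
    qPochInf (b * q ^ n) q * qPochInf (q * q ^ n) q / ∏ j, qPochInf (a j * q ^ n) q =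
      ∑ j, residueCoeff a b q j *
        ∑' k : ℕ, (-1) ^ k * connectionCoeff a b q j k / (1 - a j * q ^ (k + n)) := by
  have hwn : ∀ j, ∀ k : ℕ, 1 - a j * q ^ k * q ^ n ≠ 0 := fun j k => by
    rw [mul_assoc, ← zpow_natCast, ← zpow_add₀ hq0]; exact hgen j _
  have hprod : ∏ j, qPochInf (a j * q ^ n) q ≠ 0 := prod_ne_zero_iff.2 fun j _ =>
    qPochInf_ne_zero hq fun k => by rw [mul_right_comm]; exact hwn j k
  have hlhs : Tendsto (fun M => qShiftedFactorial (b * q ^ n) q M *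
      qShiftedFactorial (q * q ^ n) q M / ∏ j, qShiftedFactorial (a j * q ^ n) q M) atTop
      (𝓝 (qPochInf (b * q ^ n) q * qPochInf (q * q ^ n) q / ∏ j, qPochInf (a j * q ^ n) q)) :=
    ((tendsto_qShiftedFactorial hq _).mul (tendsto_qShiftedFactorial hq _)).div
      (tendsto_finsetProd _ fun j _ => tendsto_qShiftedFactorial hq _) hprod
  refine tendsto_nhds_unique hlhs (Tendsto.congr' ?_ (tendsto_finsetSum (f := fun j M =>
      ∑ k ∈ range M, (-1) ^ k * connectionCoeff a b q j k *
        (qShiftedFactorial (b / a j) q (M - k) * qShiftedFactorial (q / a j) q (M - k) /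
          ((∏ l ∈ univ.erase j, qShiftedFactorial (a l / a j) q (M - k)) *
            qShiftedFactorial q q (M - 1 - k))) / (1 - a j * q ^ (k + n))) univ fun j _ => ?_))
  · filter_upwards [eventually_gt_atTop 0] with M hM
    rw [qShiftedFactorial_quotient_eq_sum hq0 hq ha b hne hwn hM]
    refine sum_congr rfl fun j _ => sum_congr rfl fun k hk => ?_
    rw [residue_quotient_eq hq0 ha hb j (mem_range.1 hk), zpow_add₀ hq0, zpow_natCast, ← mul_assoc (a j)]
  · obtain ⟨A, hA, hA'⟩ := exists_norm_inv_one_sub_mul_zpow_le hq hq0 (ha j)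
    obtain ⟨M1, hM1, h1⟩ := exists_norm_qShiftedFactorial_le hq (‖b / a j‖)
    obtain ⟨M2, hM2, h2⟩ := exists_norm_qShiftedFactorial_le hq (‖q / a j‖)
    obtain ⟨M3, hM3, h3⟩ := exists_le_norm_qShiftedFactorial hq (one_sub_pow_succ_ne_zero hq)
    have hlim : ∀ (c : ℂ) (k : ℕ), Tendsto (fun M => qShiftedFactorial c q (M - k)) atTop
        (𝓝 (qPochInf c q)) := fun c k =>
      (tendsto_qShiftedFactorial hq c).comp (tendsto_sub_atTop_nat k)
    have hnej : ∀ l ∈ univ.erase j, ∀ k : ℕ, 1 - a l / a j * q ^ k ≠ 0 := fun l hl k => by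
      have := hne j l (ne_of_mem_erase hl).symm k
      rwa [zpow_natCast] at this
    have : ∀ l : Fin 3, ∃ M > 0, l ∈ univ.erase j →
        ∀ n, ‖(qShiftedFactorial (a l / a j) q n)⁻¹‖ ≤ M := by
      intro l
      by_cases hl : l ∈ univ.erase j
      · obtain ⟨M, hM, h⟩ := exists_le_norm_qShiftedFactorial hq (hnej l hl)
        exact ⟨M, hM, fun _ => h⟩
      · exact ⟨1, one_pos, fun h => absurd h hl⟩
    choose M4 hM4 h4 using this
    have hsum := summable_norm_connectionCoeff (b := b) hq0 hq j (a := a) (fun l hl m => by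
      have := hne l j hl.symm (m + 1)
      rwa [zpow_add₀ hq0, zpow_natCast, zpow_one, mul_comm (q ^ m), ← mul_assoc,
        div_mul_eq_mul_div, mul_comm (a j)] at this) 1
    simp only [one_pow, mul_one] at hsum
    have hprod4 : 0 < ∏ l ∈ univ.erase j, M4 l := prod_pos fun l _ => hM4 l
    have key := tendsto_tsum_of_dominated_convergence (𝓕 := (atTop : Filter ℕ))
      (f := fun M k => if k ∈ range M then (-1) ^ k * connectionCoeff a b q j k *
        (qShiftedFactorial (b / a j) q (M - k) * qShiftedFactorial (q / a j) q (M - k) /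
          ((∏ l ∈ univ.erase j, qShiftedFactorial (a l / a j) q (M - k)) *
            qShiftedFactorial q q (M - 1 - k))) / (1 - a j * q ^ (k + n)) else 0)
      (g := fun k => residueCoeff a b q j *
        ((-1) ^ k * connectionCoeff a b q j k / (1 - a j * q ^ (k + n))))
      (bound := fun k => ‖connectionCoeff a b q j k‖ *
        (M1 * M2 * ((∏ l ∈ univ.erase j, M4 l) * M3)) * A)
      ((hsum.mul_right _).mul_right _)
      (fun k => by
        have hl1 : Tendsto (fun M => qShiftedFactorial q q (M - 1 - k)) atTop
            (𝓝 (qPochInf q q)) := (tendsto_qShiftedFactorial hq q).comp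
          ((tendsto_sub_atTop_nat k).comp (tendsto_sub_atTop_nat 1))
        have hl2 := (((hlim (b / a j) k).mul (hlim (q / a j) k)).div
          ((tendsto_finsetProd (univ.erase j) fun l _ => hlim (a l / a j) k).mul hl1)
          (mul_ne_zero (prod_ne_zero_iff.2 fun l hl => qPochInf_ne_zero hq (hnej l hl))
            (qPochInf_self_ne_zero hq)))
        have hl3 := (hl2.const_mul ((-1) ^ k * connectionCoeff a b q j k)).div_const
          (1 - a j * q ^ (k + n))
        rw [residueCoeff, mul_div_assoc', mul_comm (_ / _)]
        refine (hl3.congr' ?_)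
        filter_upwards [eventually_gt_atTop k] with M hM
        rw [if_pos (mem_range.2 hM)]
        rfl)
      (Eventually.of_forall fun M k => by
        split_ifs
        · rw [div_eq_mul_inv _ (1 - a j * _), norm_mul, norm_mul, norm_mul ((-1) ^ k), norm_pow,
            norm_neg, norm_one, one_pow, one_mul]
          refine mul_le_mul (mul_le_mul_of_nonneg_left ?_ (norm_nonneg _)) (hA' _) (norm_nonneg _)
            (by positivity)
          rw [div_eq_mul_inv, mul_inv, norm_mul, norm_mul, norm_mul, ← prod_inv_distrib, norm_prod]
          exact mul_le_mul (mul_le_mul (h1 _ le_rfl _) (h2 _ le_rfl _) (norm_nonneg _) hM1.le)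
            (mul_le_mul (prod_le_prod (fun _ _ => norm_nonneg _) fun l hl => h4 l hl _) (h3 _)
              (norm_nonneg _) hprod4.le) (by positivity) (by positivity)
        · rw [norm_zero]; positivity)
    rw [tsum_mul_left] at key
    refine key.congr fun M => ?_
    rw [tsum_eq_sum (s := range M) fun k hk => if_neg hk]
    exact sum_congr rfl fun k hk => if_pos hk

/-- The coefficients of the `q`-Borel transform of `₃φ₁(a₁, a₂, a₃; b; q, ·)`. -/
def borelCoeff (a : Fin 3 → ℂ) (b q : ℂ) (n : ℕ) : ℂ :=
  (∏ j, qShiftedFactorial (a j) q n) / (qShiftedFactorial b q n * qShiftedFactorial q q n) *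
    (-1) ^ n

/-- The connection constants between the origin and infinity of `₃φ₂(a₁, a₂, a₃; b, 0; q, ·)`. -/
def connectionConst (a : Fin 3 → ℂ) (b q : ℂ) (j : Fin 3) : ℂ :=
  (∏ l ∈ Finset.univ.erase j, qPochInf (a l) q) * qPochInf (b / a j) q /
    (qPochInf b q * ∏ l ∈ Finset.univ.erase j, qPochInf (a l / a j) q)

open Finset in
theorem tsum_borelCoeff_eq_tsum_int {q b : ℂ} (hq0 : q ≠ 0) (hq : ‖q‖ < 1) {a : Fin 3 → ℂ}
    (hbn : ∀ k : ℕ, 1 - b * q ^ k ≠ 0) (hgen : ∀ j, ∀ m : ℤ, 1 - a j * q ^ m ≠ 0) (ξ : ℂ) :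
    ∑' n : ℕ, borelCoeff a b q n * ξ ^ n =
      (∏ j, qPochInf (a j) q) / (qPochInf b q * qPochInf q q) *
        ∑' n : ℤ, qPochInf (b * q ^ n) q * qPochInf (q * q ^ n) q /
          (∏ j, qPochInf (a j * q ^ n) q) * (-ξ) ^ n := by
  have hsupp : Function.support (fun n : ℤ => qPochInf (b * q ^ n) q * qPochInf (q * q ^ n) q /
          (∏ j, qPochInf (a j * q ^ n) q) * (-ξ) ^ n) ⊆ Set.range ((↑) : ℕ → ℤ) := by
    intro n hn
    by_contra hn'
    have hneg : n < 0 := by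
      by_contra h
      exact hn' ⟨n.toNat, by omega⟩
    apply hn
    have : qPochInf (q * q ^ n) q = 0 := qPochInf_eq_zero hq (k := (-n - 1).toNat) (by
      rw [← zpow_natCast, ← zpow_one_add₀ hq0, ← zpow_add₀ hq0, sub_eq_zero,
        show 1 + n + ((-n - 1).toNat : ℤ) = 0 by omega, zpow_zero])
    simp [this]
  rw [← Nat.cast_injective.tsum_eq hsupp, ← tsum_mul_left]
  refine tsum_congr fun n => ?_
  have h1 := qPochInf_eq_mul hq b n
  have h2 := qPochInf_eq_mul hq q n
  have h3 : ∏ j, qPochInf (a j) q =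
      (∏ j, qShiftedFactorial (a j) q n) * ∏ j, qPochInf (a j * q ^ n) q := by
    rw [← prod_mul_distrib]; exact prod_congr rfl fun j _ => qPochInf_eq_mul hq _ n
  have hE : ∏ j, qPochInf (a j * q ^ n) q ≠ 0 := prod_ne_zero_iff.2 fun j _ =>
    qPochInf_ne_zero hq fun k => by
      have := hgen j (n + k)
      rwa [zpow_add₀ hq0, zpow_natCast, zpow_natCast, ← mul_assoc] at this
  have hEb := qPochInf_ne_zero hq hbn
  have hEq := qPochInf_self_ne_zero hq
  rw [h1] at hEb
  rw [h2] at hEq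
  rw [zpow_natCast, zpow_natCast, h1, h2, h3, borelCoeff, neg_pow ξ]
  have := left_ne_zero_of_mul hEb
  have := right_ne_zero_of_mul hEb
  have := left_ne_zero_of_mul hEq
  have := right_ne_zero_of_mul hEq
  generalize ∏ j, qPochInf (a j * q ^ n) q = X at *
  generalize qPochInf (b * q ^ n) q = Y at *
  generalize qPochInf (q * q ^ n) q = Z at *
  field_simp

theorem tsum_tsum_residue {q b z : ℂ} (hq0 : q ≠ 0) (hq : ‖q‖ < 1) (hzq : ‖q‖ < ‖z‖)
    (hz : ‖z‖ < 1) {a : Fin 3 → ℂ} (j : Fin 3) (ha : a j ≠ 0)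
    (hne : ∀ l, j ≠ l → ∀ m : ℕ, 1 - q * a j / a l * q ^ m ≠ 0)
    (hgen : ∀ m : ℤ, 1 - a j * q ^ m ≠ 0) :
    HasSum (fun n : ℤ => (∑' k : ℕ, (-1) ^ k * connectionCoeff a b q j k /
        (1 - a j * q ^ (k + n))) * z ^ n)
      ((∑' k : ℕ, connectionCoeff a b q j k * ((-z)⁻¹) ^ k) *
        ∑' n : ℤ, z ^ n / (1 - a j * q ^ n)) := by
  have hz0 : z ≠ 0 := norm_pos_iff.1 ((norm_nonneg q).trans_lt hzq)
  have h1 := summable_norm_connectionCoeff (b := b) hq0 hq j hne ((-z)⁻¹)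
  have h2 := summable_zpow_div_one_sub hq0 hq hzq hz ha hgen
  let e : ℤ × ℕ ≃ ℕ × ℤ :=
    { toFun := fun p => (p.2, p.2 + p.1)
      invFun := fun p => (p.2 - p.1, p.1)
      left_inv := fun p => by simp
      right_inv := fun p => by simp }
  have h3 := summable_mul_of_summable_norm h1 h2
  have h4 := e.summable_iff.2 h3
  rw [tsum_mul_tsum_of_summable_norm h1 h2, ← e.tsum_eq]
  have h5 := h4.hasSum.prod_fiberwise fun n => (h4.prod_factor n).hasSum
  suffices h6 : ∀ n : ℤ, (∑' k : ℕ, (-1) ^ k * connectionCoeff a b q j k /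
      (1 - a j * q ^ (k + n))) * z ^ n = ∑' k : ℕ, ((fun x : ℕ × ℤ =>
        connectionCoeff a b q j x.1 * (-z)⁻¹ ^ x.1 * (z ^ x.2 / (1 - a j * q ^ x.2))) ∘ e)
          (n, k) by
    simp only [h6]
    exact h5
  intro n
  rw [← tsum_mul_right]
  refine tsum_congr fun k => ?_
  simp only [Function.comp_apply, e, Equiv.coe_fn_mk]
  rw [zpow_add₀ hz0, zpow_natCast, inv_pow, neg_pow z]
  have := pow_ne_zero k hz0
  have hs : ((-1 : ℂ) ^ k) * (-1) ^ k = 1 := by rw [← mul_pow]; simp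
  rw [mul_inv, inv_eq_of_mul_eq_one_left hs]
  field_simp

open Finset in
/-- The connection formula between the expansions of `₃φ₂(a₁, a₂, a₃; b, 0; q, -ξ)` at the origin
and at infinity, for parameters that are not integral powers of `q`. -/
theorem qTheta_mul_tsum_borelCoeff_of_generic {q b ξ : ℂ} (hq0 : q ≠ 0) (hq : ‖q‖ < 1)
    (hξq : ‖q‖ < ‖ξ‖) (hξ : ‖ξ‖ < 1) {a : Fin 3 → ℂ} (ha : ∀ j, a j ≠ 0) (hb : b ≠ 0)
    (hbn : ∀ k : ℕ, 1 - b * q ^ k ≠ 0)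
    (hne : ∀ j l, j ≠ l → ∀ m : ℤ, 1 - a l / a j * q ^ m ≠ 0)
    (hgen : ∀ j, ∀ m : ℤ, 1 - a j * q ^ m ≠ 0) :
    qTheta q ξ * ∑' n : ℕ, borelCoeff a b q n * ξ ^ n =
      ∑ j, connectionConst a b q j * qTheta q (a j * ξ) *
        ∑' k : ℕ, connectionCoeff a b q j k * (ξ⁻¹) ^ k := by
  have hnej : ∀ j l, j ≠ l → ∀ m : ℕ, 1 - q * a j / a l * q ^ m ≠ 0 := fun j l hl m => by
    have := hne l j hl.symm (m + 1)
    rwa [zpow_add₀ hq0, zpow_natCast, zpow_one, mul_comm (q ^ m), ← mul_assoc,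
      div_mul_eq_mul_div, mul_comm (a j)] at this
  rw [tsum_borelCoeff_eq_tsum_int hq0 hq hbn hgen]
  have hsum := hasSum_sum (s := univ) fun j (_ : j ∈ univ) =>
    (tsum_tsum_residue (z := -ξ) (b := b) hq0 hq (by rwa [norm_neg]) (by rwa [norm_neg]) j (ha j)
      (hnej j) (hgen j)).mul_left (residueCoeff a b q j)
  have e1 : ∑' n : ℤ, qPochInf (b * q ^ n) q * qPochInf (q * q ^ n) q /
      (∏ j, qPochInf (a j * q ^ n) q) * (-ξ) ^ n =
      ∑ j, residueCoeff a b q j * ((∑' k : ℕ, connectionCoeff a b q j k * ((- -ξ)⁻¹) ^ k) *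
        ∑' n : ℤ, (-ξ) ^ n / (1 - a j * q ^ n)) := by
    rw [← hsum.tsum_eq]
    refine tsum_congr fun n => ?_
    rw [qPochInf_quotient_eq_sum_tsum hq0 hq ha hb hne hgen, sum_mul]
    exact sum_congr rfl fun j _ => mul_assoc _ _ _
  rw [e1, mul_sum, mul_sum]
  refine sum_congr rfl fun j _ => ?_
  have e2 := qTheta_mul_tsum_zpow_div (z := -ξ) hq0 hq (by rwa [norm_neg]) (by rwa [norm_neg])
    (ha j) (hgen j)
  have e3 : -(a j * -ξ) = a j * ξ := by ring
  rw [neg_neg, e3] at e2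
  rw [neg_neg, ← mul_prod_erase univ _ (mem_univ j), connectionConst, residueCoeff]
  have hEj : qPochInf (a j) q ≠ 0 := qPochInf_ne_zero hq fun k => by simpa using hgen j k
  have hEj' : qPochInf (q / a j) q ≠ 0 := qPochInf_ne_zero hq fun k h0 => by
    rw [sub_eq_zero, div_mul_eq_mul_div, eq_div_iff (ha j), one_mul] at h0
    apply hgen j (-(k + 1 : ℕ))
    rw [zpow_neg, zpow_natCast, pow_succ', ← h0, mul_inv_cancel₀ (ha j), sub_self]
  have hEq := qPochInf_self_ne_zero hq
  have hEb := qPochInf_ne_zero hq hbn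
  have hEl : ∏ l ∈ univ.erase j, qPochInf (a l / a j) q ≠ 0 := prod_ne_zero_iff.2 fun l hl =>
    qPochInf_ne_zero hq fun k => by simpa using hne j l (ne_of_mem_erase hl).symm k
  calc _ = (qTheta q ξ * ∑' n : ℤ, (-ξ) ^ n / (1 - a j * q ^ n)) * (qPochInf (a j) q *
      ∏ l ∈ univ.erase j, qPochInf (a l) q) / (qPochInf b q * qPochInf q q) *
      (qPochInf (b / a j) q * qPochInf (q / a j) q /
      ((∏ l ∈ univ.erase j, qPochInf (a l / a j) q) * qPochInf q q)) *
      ∑' k : ℕ, connectionCoeff a b q j k * (ξ⁻¹) ^ k := by ring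
    _ = _ := by
      rw [e2]
      generalize ∏ l ∈ univ.erase j, qPochInf (a l / a j) q = X at *
      generalize qPochInf (q / a j) q = Y at *
      generalize qPochInf (b / a j) q = Z at *
      field_simp

theorem continuous_qShiftedFactorial (q : ℂ) (n : ℕ) :
    Continuous fun a => qShiftedFactorial a q n := by
  unfold qShiftedFactorial
  fun_prop

theorem dense_setOf_one_sub_mul_zpow_ne_zero {q : ℂ} (a : Fin 3 → ℂ) :
    Dense {s : ℂ | ∀ j, ∀ m : ℤ, 1 - s * a j * q ^ m ≠ 0} := by
  have : {s : ℂ | ∀ j, ∀ m : ℤ, 1 - s * a j * q ^ m ≠ 0}ᶜ =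
      ⋃ j, ⋃ m : ℤ, {s : ℂ | 1 - s * a j * q ^ m = 0} := by
    ext s; simp
  rw [← compl_compl {s : ℂ | _}, this]
  refine Set.Countable.dense_compl ℂ (Set.countable_iUnion fun j => Set.countable_iUnion fun m => ?_)
  refine Set.Subsingleton.countable fun s hs t ht => ?_
  simp only [Set.mem_ofPred_eq, mul_assoc, sub_eq_zero] at hs ht
  have h0 : a j * q ^ m ≠ 0 := right_ne_zero_of_mul (a := s) (by rw [← hs]; exact one_ne_zero)
  exact mul_right_cancel₀ h0 (hs.symm.trans ht)

theorem exists_norm_borelCoeff_le {q b : ℂ} (hq : ‖q‖ < 1) (hbn : ∀ k : ℕ, 1 - b * q ^ k ≠ 0)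
    (A : ℝ) :
    ∃ B > 0, ∀ a : Fin 3 → ℂ, (∀ j, ‖a j‖ ≤ A) → ∀ n, ‖borelCoeff a b q n‖ ≤ B := by
  obtain ⟨M, hM, h⟩ := exists_norm_qShiftedFactorial_le hq A
  obtain ⟨M1, hM1, h1⟩ := exists_le_norm_qShiftedFactorial hq hbn
  obtain ⟨M2, hM2, h2⟩ := exists_le_norm_qShiftedFactorial hq (one_sub_pow_succ_ne_zero hq)
  refine ⟨M ^ 3 * (M1 * M2), by positivity, fun a ha n => ?_⟩
  rw [borelCoeff, norm_mul, norm_pow, norm_neg, norm_one, one_pow, mul_one, div_eq_mul_inv,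
    mul_inv, norm_mul, norm_mul]
  refine mul_le_mul ?_ (mul_le_mul (h1 n) (h2 n) (norm_nonneg _) hM1.le) (by positivity)
    (by positivity)
  rw [norm_prod]
  refine (Finset.prod_le_prod (fun _ _ => norm_nonneg _) fun j _ => h _ (ha j) n).trans ?_
  simp

open Finset in
theorem tendsto_tsum_borelCoeff_smul {q b ξ : ℂ} (hq : ‖q‖ < 1) (hξ : ‖ξ‖ < 1) (a : Fin 3 → ℂ)
    (hbn : ∀ k : ℕ, 1 - b * q ^ k ≠ 0) :
    Tendsto (fun s : ℂ => ∑' n : ℕ, borelCoeff (fun l => s * a l) b q n * ξ ^ n) (𝓝 1)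
      (𝓝 (∑' n : ℕ, borelCoeff a b q n * ξ ^ n)) := by
  obtain ⟨B, hB, h⟩ := exists_norm_borelCoeff_le hq hbn (2 * ∑ j, ‖a j‖)
  refine tendsto_tsum_of_dominated_convergence (bound := fun n => B * ‖ξ‖ ^ n)
    ((summable_geometric_of_lt_one (norm_nonneg ξ) hξ).mul_left B) (fun n => ?_) ?_
  · have hc := continuous_qShiftedFactorial q n
    have : Continuous fun s : ℂ => borelCoeff (fun l => s * a l) b q n * ξ ^ n := by
      unfold borelCoeff
      refine Continuous.mul (Continuous.mul (Continuous.div_const ?_ _) continuous_const)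
        continuous_const
      exact continuous_finsetProd _ fun j _ => hc.comp (by fun_prop)
    convert this.tendsto 1 using 1
    simp
  · have hmem : {s : ℂ | ‖s‖ ≤ 2} ∈ 𝓝 (1 : ℂ) :=
      (continuous_norm.tendsto (1 : ℂ)).eventually_le_const (by norm_num)
    filter_upwards [hmem] with s hs n
    rw [norm_mul, norm_pow]
    gcongr
    refine h _ (fun j => ?_) n
    rw [norm_mul]
    exact mul_le_mul hs (single_le_sum (f := fun j => ‖a j‖) (fun _ _ => norm_nonneg _) (mem_univ j))
      (norm_nonneg _) (by norm_num)

open Finset in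
theorem tendsto_tsum_connectionCoeff_smul {q b ξ : ℂ} (hq0 : q ≠ 0) (hq : ‖q‖ < 1)
    {a : Fin 3 → ℂ} (ha : ∀ j, a j ≠ 0) (j : Fin 3)
    (hne : ∀ l, j ≠ l → ∀ m : ℕ, 1 - q * a j / a l * q ^ m ≠ 0) :
    Tendsto (fun s : ℂ => ∑' k : ℕ, connectionCoeff (fun l => s * a l) b q j k * (ξ⁻¹) ^ k) (𝓝 1)
      (𝓝 (∑' k : ℕ, connectionCoeff a b q j k * (ξ⁻¹) ^ k)) := by
  obtain ⟨B, hB, h⟩ := exists_norm_connectionCoeff_le (b := b) hq j hne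
  have hA : ∏ l ∈ univ.erase j, a l ≠ 0 := prod_ne_zero_iff.2 fun l _ => ha l
  refine tendsto_tsum_of_dominated_convergence
    (bound := fun k => B * (‖q‖ ^ (k + 1).choose 2 *
      (4 * ‖b * q / ∏ l ∈ univ.erase j, a l‖ * ‖ξ⁻¹‖) ^ k))
    ((summable_pow_choose_mul_pow hq0 hq _).mul_left B) (fun k => ?_) ?_
  · have hc := continuous_qShiftedFactorial q k
    have : ContinuousAt (fun s : ℂ => connectionCoeff (fun l => s * a l) b q j k * (ξ⁻¹) ^ k) 1 := by
      unfold connectionCoeff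
      refine ContinuousAt.mul (ContinuousAt.div (ContinuousAt.mul (ContinuousAt.mul
        continuousAt_const (ContinuousAt.pow (ContinuousAt.div continuousAt_const ?_ ?_) _))
        (ContinuousAt.mul ?_ ?_)) (ContinuousAt.mul ?_ continuousAt_const) ?_) continuousAt_const
      · fun_prop
      · simpa using hA
      · exact (hc.comp (by fun_prop : Continuous fun s : ℂ => s * a j)).continuousAt
      · exact (hc.comp (by fun_prop : Continuous fun s : ℂ => q * (s * a j) / b)).continuousAt
      · refine tendsto_finsetProd _ fun l _ => ?_
        refine hc.continuousAt.comp (f := fun s : ℂ => q * (s * a j) / (s * a l)) ?_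
        exact ContinuousAt.div (by fun_prop) (by fun_prop) (by simpa using ha l)
      · refine mul_ne_zero (prod_ne_zero_iff.2 fun l hl => ?_) (qShiftedFactorial_self_ne_zero hq k)
        simp only [one_mul]
        exact qShiftedFactorial_ne_zero fun m _ => hne l (ne_of_mem_erase hl).symm m
    convert this.tendsto using 1
    simp
  · have hmem : {s : ℂ | ‖s‖ ≤ 2} ∈ 𝓝 (1 : ℂ) :=
      (continuous_norm.tendsto (1 : ℂ)).eventually_le_const (by norm_num)
    have hmem2 : {s : ℂ | 1 / 2 ≤ ‖s‖} ∈ 𝓝 (1 : ℂ) :=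
      (continuous_norm.tendsto (1 : ℂ)).eventually_const_le (by norm_num)
    filter_upwards [hmem, hmem2] with s hs hs2 k
    have hs0 : s ≠ 0 := by
      rintro rfl
      norm_num at hs2
    rw [norm_mul, norm_pow, mul_pow, ← mul_assoc (‖q‖ ^ _), ← mul_assoc]
    gcongr
    refine (h s hs hs0 k).trans ?_
    gcongr
    rw [norm_div, norm_div, norm_mul (s ^ 2), norm_pow, ← mul_div_assoc]
    have h4 : (1 / 2 : ℝ) ^ 2 ≤ ‖s‖ ^ 2 := by gcongr
    have hA' : 0 < ‖∏ l ∈ univ.erase j, a l‖ := norm_pos_iff.2 hA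
    rw [div_le_div_iff₀ (by positivity) hA']
    nlinarith [mul_nonneg (norm_nonneg (b * q)) hA'.le]

open Finset in
/-- The connection formula between the expansions of `₃φ₂(a₁, a₂, a₃; b, 0; q, -ξ)` at the origin
and at infinity. -/
theorem qTheta_mul_tsum_borelCoeff {q b ξ : ℂ} (hq0 : q ≠ 0) (hq : ‖q‖ < 1)
    (hξq : ‖q‖ < ‖ξ‖) (hξ : ‖ξ‖ < 1) {a : Fin 3 → ℂ} (ha : ∀ j, a j ≠ 0) (hb : b ≠ 0)
    (hbn : ∀ k : ℕ, 1 - b * q ^ k ≠ 0)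
    (hne : ∀ j l, j ≠ l → ∀ m : ℤ, 1 - a l / a j * q ^ m ≠ 0) :
    qTheta q ξ * ∑' n : ℕ, borelCoeff a b q n * ξ ^ n =
      ∑ j, connectionConst a b q j * qTheta q (a j * ξ) *
        ∑' k : ℕ, connectionCoeff a b q j k * (ξ⁻¹) ^ k := by
  have hξ0 : ξ ≠ 0 := norm_pos_iff.1 ((norm_nonneg q).trans_lt hξq)
  have hnej : ∀ j l, j ≠ l → ∀ m : ℕ, 1 - q * a j / a l * q ^ m ≠ 0 := fun j l hl m => by
    have := hne l j hl.symm (m + 1)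
    rwa [zpow_add₀ hq0, zpow_natCast, zpow_one, mul_comm (q ^ m), ← mul_assoc,
      div_mul_eq_mul_div, mul_comm (a j)] at this
  set S := {s : ℂ | ∀ j, ∀ m : ℤ, 1 - s * a j * q ^ m ≠ 0} with hS
  have hdense : Dense S := dense_setOf_one_sub_mul_zpow_ne_zero a
  have : (𝓝[S] (1 : ℂ)).NeBot := mem_closure_iff_nhdsWithin_neBot.1 (hdense 1)
  have hE := continuous_qPochInf hq
  have hl : Tendsto (fun s : ℂ => qTheta q ξ * ∑' n : ℕ, borelCoeff (fun l => s * a l) b q n * ξ ^ n)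
      (𝓝[S] 1) (𝓝 (qTheta q ξ * ∑' n : ℕ, borelCoeff a b q n * ξ ^ n)) :=
    ((tendsto_tsum_borelCoeff_smul hq hξ a hbn).const_mul _).mono_left nhdsWithin_le_nhds
  have hr : Tendsto (fun s : ℂ => ∑ j, connectionConst (fun l => s * a l) b q j *
      qTheta q (s * a j * ξ) * ∑' k : ℕ, connectionCoeff (fun l => s * a l) b q j k * (ξ⁻¹) ^ k)
      (𝓝[S] 1) (𝓝 (∑ j, connectionConst a b q j * qTheta q (a j * ξ) *
        ∑' k : ℕ, connectionCoeff a b q j k * (ξ⁻¹) ^ k)) := by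
    refine (tendsto_finsetSum _ fun j _ => Tendsto.mul (Tendsto.mul ?_ ?_)
      (tendsto_tsum_connectionCoeff_smul hq0 hq ha j (hnej j))).mono_left nhdsWithin_le_nhds
    · have : ContinuousAt (fun s : ℂ => connectionConst (fun l => s * a l) b q j) 1 := by
        unfold connectionConst
        refine ContinuousAt.div (ContinuousAt.mul ?_ ?_) (ContinuousAt.mul continuousAt_const ?_) ?_
        · refine tendsto_finsetProd _ fun l _ => ?_
          exact (hE.comp (by fun_prop : Continuous fun s : ℂ => s * a l)).continuousAt
        · refine hE.continuousAt.comp (f := fun s : ℂ => b / (s * a j)) ?_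
          exact ContinuousAt.div (by fun_prop) (by fun_prop) (by simpa using ha j)
        · refine tendsto_finsetProd _ fun l _ => ?_
          refine hE.continuousAt.comp (f := fun s : ℂ => (s * a l) / (s * a j)) ?_
          exact ContinuousAt.div (by fun_prop) (by fun_prop) (by simpa using ha j)
        · refine mul_ne_zero (qPochInf_ne_zero hq hbn) (prod_ne_zero_iff.2 fun l hl => ?_)
          simp only [one_mul]
          exact qPochInf_ne_zero hq fun k => by simpa using hne j l (ne_of_mem_erase hl).symm k
      convert this.tendsto using 1
      simp
    · have h1 : ContinuousAt (qTheta q) (1 * a j * ξ) :=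
        continuousAt_qTheta hq0 hq (by simp [ha j, hξ0])
      have h2 : ContinuousAt (fun s : ℂ => qTheta q (s * a j * ξ)) 1 :=
        h1.comp (f := fun s : ℂ => s * a j * ξ) (by fun_prop)
      convert h2.tendsto using 1
      simp
  refine tendsto_nhds_unique (hl.congr' ?_) hr
  have hmem : ∀ᶠ s in 𝓝[S] (1 : ℂ), s ≠ 0 :=
    eventually_nhdsWithin_of_eventually_nhds (eventually_ne_nhds one_ne_zero)
  filter_upwards [self_mem_nhdsWithin, hmem] with s hs hs0
  refine qTheta_mul_tsum_borelCoeff_of_generic hq0 hq hξq hξ (fun j => mul_ne_zero hs0 (ha j)) hb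
    hbn (fun j l hjl m => ?_) hs
  rw [mul_div_mul_left _ _ hs0]
  exact hne j l hjl m

/-- Parameters for which the connection formula of `₃φ₂(a₁, a₂, a₃; b, 0; q, ·)` holds. -/
structure IsRegularParam (a : Fin 3 → ℂ) (b q : ℂ) : Prop where
  q_ne_zero : q ≠ 0
  norm_lt_one : ‖q‖ < 1
  ne_zero : ∀ j, a j ≠ 0
  b_ne_zero : b ≠ 0
  one_sub_b : ∀ k : ℕ, 1 - b * q ^ k ≠ 0
  one_sub_div : ∀ j l, j ≠ l → ∀ m : ℤ, 1 - a l / a j * q ^ m ≠ 0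

theorem IsRegularParam.one_sub_mul_div {a : Fin 3 → ℂ} {b q : ℂ} (h : IsRegularParam a b q)
    (j l : Fin 3) (hl : j ≠ l) (m : ℕ) : 1 - q * a j / a l * q ^ m ≠ 0 := by
  have := h.one_sub_div l j hl.symm (m + 1)
  rwa [zpow_add₀ h.q_ne_zero, zpow_natCast, zpow_one, mul_comm (q ^ m), ← mul_assoc,
    div_mul_eq_mul_div, mul_comm (a j)] at this

/-- The expansion at infinity of the `q`-Borel transform. -/
def infinityExpansion (a : Fin 3 → ℂ) (b q ξ : ℂ) : ℂ :=
  (∑ j, connectionConst a b q j * qTheta q (a j * ξ) *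
    ∑' k : ℕ, connectionCoeff a b q j k * (ξ⁻¹) ^ k) / qTheta q ξ

/-- The analytic continuation of the `q`-Borel transform. -/
def borelContinuation (a : Fin 3 → ℂ) (b q ξ : ℂ) : ℂ :=
  if ‖ξ‖ < 1 then ∑' n : ℕ, borelCoeff a b q n * ξ ^ n else infinityExpansion a b q ξ

theorem analyticAt_tsum_mul_pow {c : ℕ → ℂ} {r : ℝ} (hc : Summable fun k => ‖c k‖ * r ^ k) {z : ℂ}
    (hz : ‖z‖ < r) : AnalyticAt ℂ (fun z => ∑' k, c k * z ^ k) z := by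
  have h := Complex.differentiableOn_tsum_of_summable_norm (F := fun k z => c k * z ^ k)
    (U := Metric.ball 0 r) hc (fun k => by fun_prop) Metric.isOpen_ball (fun k w hw => by
      rw [norm_mul, norm_pow]
      have : ‖w‖ ≤ r := (mem_ball_zero_iff.1 hw).le
      gcongr)
  exact h.analyticAt (Metric.isOpen_ball.mem_nhds (mem_ball_zero_iff.2 hz))

theorem summable_norm_borelCoeff_mul_pow {a : Fin 3 → ℂ} {b q : ℂ} (h : IsRegularParam a b q)
    {r : ℝ} (hr0 : 0 ≤ r) (hr : r < 1) : Summable fun n => ‖borelCoeff a b q n‖ * r ^ n := by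
  obtain ⟨B, hB, hle⟩ := exists_norm_borelCoeff_le h.norm_lt_one h.one_sub_b (∑ j, ‖a j‖)
  refine Summable.of_nonneg_of_le (fun n => by positivity) (fun n => ?_)
    ((summable_geometric_of_lt_one hr0 hr).mul_left B)
  gcongr
  exact hle a (fun j => Finset.single_le_sum (f := fun j => ‖a j‖) (fun _ _ => norm_nonneg _)
    (Finset.mem_univ j)) n

theorem analyticAt_infinityExpansion {a : Fin 3 → ℂ} {b q : ℂ} (h : IsRegularParam a b q) {ξ : ℂ}
    (hξ : ξ ∈ Complex.slitPlane) (hθ : qTheta q ξ ≠ 0) :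
    AnalyticAt ℂ (infinityExpansion a b q) ξ := by
  have hξ0 : ξ ≠ 0 := Complex.slitPlane_ne_zero hξ
  refine AnalyticAt.fun_div (Finset.univ.analyticAt_fun_sum fun j _ => ?_) ?_ hθ
  · refine (analyticAt_const.mul (analyticAt_qTheta_const_mul h.q_ne_zero h.norm_lt_one
      (h.ne_zero j) hξ)).mul ?_
    have h1 := summable_norm_connectionCoeff (b := b) h.q_ne_zero h.norm_lt_one j
      (h.one_sub_mul_div j) ((‖ξ⁻¹‖ + 1 : ℝ) : ℂ)
    have h2 : AnalyticAt ℂ (fun z => ∑' k, connectionCoeff a b q j k * z ^ k) ξ⁻¹ := by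
      refine analyticAt_tsum_mul_pow (r := ‖ξ⁻¹‖ + 1) (h1.congr fun k => ?_) (by linarith)
      rw [norm_mul, norm_pow, Complex.norm_real, Real.norm_of_nonneg (by positivity)]
    exact h2.comp_of_eq (f := fun y : ℂ => y⁻¹) (analyticAt_inv hξ0) rfl
  · have := analyticAt_qTheta_const_mul h.q_ne_zero h.norm_lt_one one_ne_zero hξ
    simpa only [one_mul] using this

theorem borelContinuation_eventuallyEq {a : Fin 3 → ℂ} {b q : ℂ} (h : IsRegularParam a b q) {ξ : ℂ}
    (hξ : ‖q‖ < ‖ξ‖) (hθ : qTheta q ξ ≠ 0) :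
    borelContinuation a b q =ᶠ[𝓝 ξ] infinityExpansion a b q := by
  have hξ0 : ξ ≠ 0 := norm_pos_iff.1 ((norm_nonneg q).trans_lt hξ)
  have h1 := (continuousAt_qTheta h.q_ne_zero h.norm_lt_one hξ0).eventually_ne hθ
  have h2 := (continuous_norm.tendsto ξ).eventually_const_lt hξ
  filter_upwards [h1, h2] with y hy1 hy2
  rw [borelContinuation]
  split_ifs with hy3
  · rw [infinityExpansion, ← qTheta_mul_tsum_borelCoeff h.q_ne_zero h.norm_lt_one hy2 hy3 h.ne_zero
      h.b_ne_zero h.one_sub_b h.one_sub_div, mul_div_cancel_left₀ _ hy1]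
  · rfl

theorem coeff_qBorel_basicPhi31 {a : Fin 3 → ℂ} {b q : ℂ} (hq0 : q ≠ 0) (n : ℕ) :
    PowerSeries.coeff n (qBorel q (basicPhi31 (a 0) (a 1) (a 2) b q)) = borelCoeff a b q n := by
  rw [qBorel, basicPhi31, PowerSeries.coeff_mk, PowerSeries.coeff_mk, borelCoeff,
    Fin.prod_univ_three, mul_inv, mul_assoc _ _ (q ^ _), mul_assoc _ _ (q ^ _),
    inv_mul_cancel₀ (pow_ne_zero _ hq0), mul_one, ← inv_pow]
  norm_num

theorem ofReal_mul_mem_slitPlane {lam : ℂ} (hlam : lam ∈ Complex.slitPlane) {t : ℝ} (ht : 0 < t) :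
    (t : ℂ) * lam ∈ Complex.slitPlane := by
  rw [Complex.mem_slitPlane_iff, Complex.re_ofReal_mul, Complex.im_ofReal_mul] at *
  rcases hlam with h | h
  · exact Or.inl (mul_pos ht h)
  · exact Or.inr (mul_ne_zero ht.ne' h)

theorem isRayContinuation_borelContinuation {a : Fin 3 → ℂ} {b q lam : ℂ}
    (h : IsRegularParam a b q) (hlam : lam ∈ Complex.slitPlane)
    (hθ : ∀ t : ℝ, 0 < t → qTheta q (t * lam) ≠ 0) :
    IsRayContinuation (qBorel q (basicPhi31 (a 0) (a 1) (a 2) b q)) lam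
      (borelContinuation a b q) := by
  constructor
  · filter_upwards [Metric.ball_mem_nhds (0 : ℂ) one_pos] with ξ hξ
    have hξ' := mem_ball_zero_iff.1 hξ
    simp only [coeff_qBorel_basicPhi31 h.q_ne_zero, borelContinuation, if_pos hξ']
    refine Summable.hasSum (Summable.of_norm ?_)
    simpa using summable_norm_borelCoeff_mul_pow h (norm_nonneg ξ) hξ'
  · rintro ξ ⟨t, ht, rfl⟩
    rcases lt_or_ge ‖(t : ℂ) * lam‖ 1 with h1 | h1
    · obtain ⟨r, hr, hr1⟩ := exists_between h1
      have h2 := analyticAt_tsum_mul_pow (summable_norm_borelCoeff_mul_pow h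
        ((norm_nonneg _).trans hr.le) hr1) hr
      refine h2.congr ?_
      filter_upwards [(continuous_norm.tendsto ((t : ℂ) * lam)).eventually_lt_const h1] with y hy
      rw [borelContinuation, if_pos hy]
    · have ht' : 0 < t := lt_of_le_of_ne ht (by rintro rfl; norm_num at h1)
      exact (analyticAt_infinityExpansion h (ofReal_mul_mem_slitPlane hlam ht') (hθ t ht')).congr
        (borelContinuation_eventuallyEq h (h.norm_lt_one.trans_le h1) (hθ t ht')).symm

theorem convex_openRay (lam : ℂ) : Convex ℝ {ξ : ℂ | ∃ t : ℝ, 0 < t ∧ ξ = t * lam} := by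
  rintro _ ⟨s, hs, rfl⟩ _ ⟨t, ht, rfl⟩ u v hu hv huv
  refine ⟨u * s + v * t, ?_, ?_⟩
  · rcases hu.eq_or_lt with rfl | hu'
    · have : v = 1 := by linarith
      simpa [this] using ht
    · have := mul_pos hu' hs
      have := mul_nonneg hv ht.le
      linarith
  · simp only [Complex.real_smul]
    push_cast
    ring

theorem convex_closedRay (lam : ℂ) : Convex ℝ {ξ : ℂ | ∃ t : ℝ, 0 ≤ t ∧ ξ = t * lam} := by
  rintro _ ⟨s, hs, rfl⟩ _ ⟨t, ht, rfl⟩ u v hu hv huv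
  refine ⟨u * s + v * t, by positivity, ?_⟩
  simp only [Complex.real_smul]
  push_cast
  ring

theorem IsRayContinuation.eqOn {ψ : PowerSeries ℂ} {lam : ℂ} {φ₁ φ₂ : ℂ → ℂ}
    (h₁ : IsRayContinuation ψ lam φ₁) (h₂ : IsRayContinuation ψ lam φ₂) :
    Set.EqOn φ₁ φ₂ {ξ : ℂ | ∃ t : ℝ, 0 ≤ t ∧ ξ = t * lam} := by
  refine h₁.analyticOnNhd.eqOn_of_preconnected_of_eventuallyEq h₂.analyticOnNhd
    (convex_closedRay lam).isPreconnected (z₀ := 0) ⟨0, le_rfl, by simp⟩ ?_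
  filter_upwards [h₁.hasSum_near_zero, h₂.hasSum_near_zero] with ξ hξ₁ hξ₂
  exact hξ₁.unique hξ₂

theorem borelContinuation_eq_infinityExpansion {a : Fin 3 → ℂ} {b q lam : ℂ}
    (h : IsRegularParam a b q) (hlam : lam ∈ Complex.slitPlane)
    (hθ : ∀ t : ℝ, 0 < t → qTheta q (t * lam) ≠ 0) {t : ℝ} (ht : 0 < t) :
    borelContinuation a b q (t * lam) = infinityExpansion a b q (t * lam) := by
  have hlam0 : 0 < ‖lam‖ := norm_pos_iff.2 (Complex.slitPlane_ne_zero hlam)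
  have h1 : AnalyticOnNhd ℂ (borelContinuation a b q) {ξ : ℂ | ∃ t : ℝ, 0 < t ∧ ξ = t * lam} :=
    (isRayContinuation_borelContinuation h hlam hθ).analyticOnNhd.mono
      (by rintro _ ⟨s, hs, rfl⟩; exact ⟨s, hs.le, rfl⟩)
  have h2 : AnalyticOnNhd ℂ (infinityExpansion a b q) {ξ : ℂ | ∃ t : ℝ, 0 < t ∧ ξ = t * lam} := by
    rintro _ ⟨s, hs, rfl⟩
    exact analyticAt_infinityExpansion h (ofReal_mul_mem_slitPlane hlam hs) (hθ s hs)
  refine h1.eqOn_of_preconnected_of_eventuallyEq h2 (convex_openRay lam).isPreconnected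
    (z₀ := (‖lam‖⁻¹ : ℝ) * lam) ⟨‖lam‖⁻¹, by positivity, rfl⟩ ?_ ⟨t, ht, rfl⟩
  refine borelContinuation_eventuallyEq h ?_ (hθ _ (by positivity))
  rw [norm_mul, Complex.norm_real, Real.norm_of_nonneg (by positivity),
    inv_mul_cancel₀ hlam0.ne']
  exact h.norm_lt_one

open Finset in
/-- The coefficients of the convergent series `₃φ₂(aⱼ, q aⱼ / b, 0; q aⱼ / aₗ; q, b q / (a₁ a₂ a₃ x))`
that arise from the `q`-Laplace transform. -/
def laplaceCoeff (a : Fin 3 → ℂ) (b q x : ℂ) (j : Fin 3) (k : ℕ) : ℂ :=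
  (b * q / ((∏ l, a l) * x)) ^ k *
    (qShiftedFactorial (a j) q k * qShiftedFactorial (q * a j / b) q k) /
      ((∏ l ∈ univ.erase j, qShiftedFactorial (q * a j / a l) q k) * qShiftedFactorial q q k)

open Finset in
theorem connectionCoeff_mul_eq_laplaceCoeff {a : Fin 3 → ℂ} {b q x : ℂ} (hq0 : q ≠ 0) (j : Fin 3)
    (k : ℕ) :
    connectionCoeff a b q j k * ((a j * x)⁻¹ ^ k / q ^ (k + 1).choose 2) =
      laplaceCoeff a b q x j k := by
  have hT : q ^ (k + 1).choose 2 ≠ 0 := pow_ne_zero _ hq0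
  rw [connectionCoeff, laplaceCoeff, ← mul_prod_erase univ a (mem_univ j),
    show b * q / (a j * (∏ l ∈ univ.erase j, a l) * x) =
      b * q / (∏ l ∈ univ.erase j, a l) * (a j * x)⁻¹ by
        simp only [div_eq_mul_inv, mul_inv]; ring, mul_pow]
  field_simp

theorem hasSum_laplace_term {a : Fin 3 → ℂ} {b q lam x : ℂ} (h : IsRegularParam a b q)
    (hlam : lam ≠ 0) (hx : x ≠ 0) (j : Fin 3) (hs : Summable fun k => ‖laplaceCoeff a b q x j k‖) :
    HasSum (fun n : ℤ => (∑' k : ℕ, connectionCoeff a b q j k * ((lam * q ^ n)⁻¹) ^ k) *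
        (q ^ (n * (n - 1) / 2) * (lam / (a j * x)) ^ n))
      ((∑' k : ℕ, laplaceCoeff a b q x j k) * qTheta q (lam / (a j * x))) := by
  have hq0 := h.q_ne_zero
  have hy : lam / (a j * x) ≠ 0 := div_ne_zero hlam (mul_ne_zero (h.ne_zero j) hx)
  have h2 := summable_norm_qTheta_term hq0 h.norm_lt_one hy
  let e : ℤ × ℕ ≃ ℕ × ℤ :=
    { toFun := fun p => (p.2, p.1 - p.2)
      invFun := fun p => (p.2 + p.1, p.1)
      left_inv := fun p => by simp
      right_inv := fun p => by simp }
  have h3 := summable_mul_of_summable_norm hs h2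
  have h4 := e.summable_iff.2 h3
  rw [qTheta, tsum_mul_tsum_of_summable_norm hs h2, ← e.tsum_eq]
  have h5 := h4.hasSum.prod_fiberwise fun n => (h4.prod_factor n).hasSum
  suffices h6 : ∀ n : ℤ, (∑' k : ℕ, connectionCoeff a b q j k * ((lam * q ^ n)⁻¹) ^ k) *
      (q ^ (n * (n - 1) / 2) * (lam / (a j * x)) ^ n) = ∑' k : ℕ, ((fun p : ℕ × ℤ =>
        laplaceCoeff a b q x j p.1 * (q ^ (p.2 * (p.2 - 1) / 2) * (lam / (a j * x)) ^ p.2)) ∘ e)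
          (n, k) by
    simp only [h6]
    exact h5
  intro n
  rw [← tsum_mul_right]
  refine tsum_congr fun k => ?_
  simp only [Function.comp_apply, e, Equiv.coe_fn_mk]
  rw [← connectionCoeff_mul_eq_laplaceCoeff hq0]
  have e1 : q ^ (n * (n - 1) / 2) =
      q ^ ((n - k) * (n - k - 1) / 2) * (q ^ n) ^ k / q ^ (k + 1).choose 2 := by
    rw [← zpow_natCast q, ← zpow_natCast (q ^ n), ← zpow_mul, ← zpow_add₀ hq0, ← zpow_sub₀ hq0]
    congr 1
    have h1 := tri_add (n - k) k
    rw [sub_add_cancel] at h1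
    have h2 := two_mul_tri k
    have h3 := two_mul_choose_succ_two k
    nlinarith
  rw [e1, zpow_sub₀ hy, zpow_natCast]
  have hqn : q ^ n ≠ 0 := zpow_ne_zero n hq0
  have hj := h.ne_zero j
  rw [inv_pow, inv_pow, mul_pow lam, div_pow]
  field_simp

theorem hasSum_qLaplaceTerm {a : Fin 3 → ℂ} {b lam x : ℂ} {q : ℝ} (hq0 : 0 < q)
    (h : IsRegularParam a b q) (hlam : lam ∈ Complex.slitPlane) (hx : x ≠ 0)
    (hθ : ∀ t : ℝ, 0 < t → qTheta q (t * lam) ≠ 0) (hθx : qTheta q (lam / x) ≠ 0)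
    (hs : ∀ j, Summable fun k => ‖laplaceCoeff a b q x j k‖) {φ : ℂ → ℂ}
    (hφ : IsRayContinuation (qBorel q (basicPhi31 (a 0) (a 1) (a 2) b q)) lam φ) :
    HasSum (qLaplaceTerm q lam φ x)
      (∑ j, connectionConst a b q j * (qTheta q (a j * lam) / qTheta q lam) *
        (qTheta q (lam / (a j * x)) / qTheta q (lam / x)) * ∑' k : ℕ, laplaceCoeff a b q x j k) := by
  have hlam0 := Complex.slitPlane_ne_zero hlam
  have hqc := h.q_ne_zero
  have hθ1 : qTheta q lam ≠ 0 := by simpa using hθ 1 one_pos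
  have hsum := hasSum_sum (s := Finset.univ) fun j (_ : j ∈ Finset.univ) =>
    (hasSum_laplace_term h hlam0 hx j (hs j)).mul_left
      (connectionConst a b q j * (qTheta q (a j * lam) / qTheta q lam) / qTheta q (lam / x))
  convert hsum using 1
  · rfl
  · funext n
    have hpos : 0 < q ^ n := zpow_pos hq0 n
    have e0 : lam * (q : ℂ) ^ n = ((q ^ n : ℝ) : ℂ) * lam := by push_cast; ring
    have e1 : φ (lam * (q : ℂ) ^ n) = infinityExpansion a b q (lam * (q : ℂ) ^ n) := by
      rw [e0, hφ.eqOn (isRayContinuation_borelContinuation h hlam hθ) ⟨_, hpos.le, rfl⟩,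
        borelContinuation_eq_infinityExpansion h hlam hθ hpos]
    rw [qLaplaceTerm, e1, infinityExpansion, Finset.sum_div, Finset.sum_div]
    refine Finset.sum_congr rfl fun j _ => ?_
    have hj := h.ne_zero j
    have hQ : (q : ℂ) ^ (n * (n - 1) / 2) ≠ 0 := zpow_ne_zero _ hqc
    have t1 := qTheta_mul_zpow hqc (mul_ne_zero hj hlam0) n
    have t2 := qTheta_mul_zpow hqc hlam0 n
    have t3 := qTheta_mul_zpow hqc (div_ne_zero hlam0 hx) n
    have hl : lam ^ n ≠ 0 := zpow_ne_zero _ hlam0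
    have hjn : (a j) ^ n ≠ 0 := zpow_ne_zero _ hj
    have hxn : x ^ n ≠ 0 := zpow_ne_zero _ hx
    have n2 := (qTheta_ne_zero_mul_zpow_iff hqc hlam0 n).2 hθ1
    have n3 := (qTheta_ne_zero_mul_zpow_iff hqc (div_ne_zero hlam0 hx) n).2 hθx
    rw [← t1, ← t2, ← t3, mul_div_right_comm lam, ← mul_assoc (a j)]
    rw [mul_zpow (a j), div_zpow, div_zpow, mul_zpow (a j)]
    field_simp
  · refine Finset.sum_congr rfl fun j _ => ?_
    ring

theorem resummedF31_eq {a : Fin 3 → ℂ} {b lam x : ℂ} {q : ℝ} (hq0 : 0 < q)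
    (h : IsRegularParam a b q) (hlam : lam ∈ Complex.slitPlane) (hx : x ≠ 0)
    (hθ : ∀ t : ℝ, 0 < t → qTheta q (t * lam) ≠ 0) (hθx : qTheta q (lam / x) ≠ 0)
    (hs : ∀ j, Summable fun k => ‖laplaceCoeff a b q x j k‖) :
    resummedF31 (a 0) (a 1) (a 2) b q lam x =
      ∑ j, connectionConst a b q j * (qTheta q (a j * lam) / qTheta q lam) *
        (qTheta q (lam / (a j * x)) / qTheta q (lam / x)) *
          ∑' k : ℕ, laplaceCoeff a b q x j k := by
  have hex : ∃ φ, IsRayContinuation (qBorel q (basicPhi31 (a 0) (a 1) (a 2) b q)) lam φ :=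
    ⟨_, isRayContinuation_borelContinuation h hlam hθ⟩
  rw [resummedF31, qBorelLaplace, dif_pos hex]
  exact (hasSum_qLaplaceTerm hq0 h hlam hx hθ hθx hs hex.choose_spec).tsum_eq

/-- The theta factor at the cusp `q = 1` in the modular transformation of `θ_q(e^w)`,
`q = e^(-t)`. -/
def dualTheta (t : ℝ) (w : ℂ) : ℂ :=
  jacobiTheta₂ (-(w + t / 2) / t) (2 * Real.pi / t * Complex.I)

theorem qTheta_exp_eq_dualTheta {t : ℝ} (ht : 0 < t) (w : ℂ) :
    qTheta (Complex.exp (-t)) (Complex.exp w) =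
      1 / ((t / (2 * Real.pi) : ℂ)) ^ (1 / 2 : ℂ) * Complex.exp ((w + t / 2) ^ 2 / (2 * t)) *
        dualTheta t w := by
  have hpi : (Real.pi : ℂ) ≠ 0 := by exact_mod_cast Real.pi_ne_zero
  have ht0 : (t : ℂ) ≠ 0 := by exact_mod_cast ht.ne'
  have hI := Complex.I_ne_zero
  have hτ : Complex.I * t / (2 * Real.pi) ≠ 0 :=
    div_ne_zero (mul_ne_zero hI ht0) (mul_ne_zero two_ne_zero hpi)
  have h1 : -Complex.I * (Complex.I * t / (2 * Real.pi)) = t / (2 * Real.pi) := by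
    linear_combination (-(t / (2 * Real.pi) : ℂ)) * Complex.I_mul_I
  have h2 : -Real.pi * Complex.I * ((w + t / 2) / (2 * Real.pi * Complex.I)) ^ 2 /
      (Complex.I * t / (2 * Real.pi)) = (w + t / 2) ^ 2 / (2 * t) := by
    rw [div_pow, mul_pow, Complex.I_sq, div_eq_iff hτ]
    generalize w + t / 2 = u
    field_simp
  have h3 : (w + t / 2) / (2 * Real.pi * Complex.I) / (Complex.I * t / (2 * Real.pi)) =
      -(w + t / 2) / t := by
    have : 2 * Real.pi * Complex.I * (Complex.I * t / (2 * Real.pi)) = -t := by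
      field_simp
      rw [Complex.I_sq]
    rw [div_div, this, div_neg, neg_div]
  have h4 : -1 / (Complex.I * t / (2 * Real.pi)) = 2 * Real.pi / t * Complex.I := by
    rw [div_eq_iff hτ]
    field_simp
    rw [Complex.I_sq]
  rw [qTheta_exp, jacobiTheta₂_functional_equation, dualTheta, h1, h2, h3, h4]

theorem tendsto_dualTheta {ι : Type*} {l : Filter ι} {t : ι → ℝ} {w : ι → ℂ} {δ : ℝ} (hδ : 0 < δ)
    (ht : Tendsto t l (𝓝[>] 0)) (hw : ∀ᶠ i in l, |(w i).im| ≤ Real.pi - δ) :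
    Tendsto (fun i => dualTheta (t i) (w i)) l (𝓝 1) := by
  have hnorm : ∀ i, 0 < t i → |(w i).im| ≤ Real.pi - δ → ∀ n : ℤ,
      ‖jacobiTheta₂_term n (-(w i + t i / 2) / t i) (2 * Real.pi / t i * Complex.I)‖ ≤
        Real.exp (-(2 * Real.pi * δ) * |(n : ℝ)| / t i) := by
    intro i hi hwi n
    rw [norm_jacobiTheta₂_term, Real.exp_le_exp]
    have e1 : (2 * Real.pi / (t i : ℂ) * Complex.I).im = 2 * Real.pi / t i := by
      have : (2 * Real.pi / (t i : ℂ) * Complex.I) = ((2 * Real.pi / t i : ℝ) : ℂ) * Complex.I := by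
        push_cast; ring
      rw [this, Complex.im_ofReal_mul]; simp
    have e2 : (-(w i + t i / 2) / (t i : ℂ)).im = -(w i).im / t i := by
      rw [Complex.div_ofReal_im]
      congr 1
      have : (t i : ℂ) / 2 = ((t i / 2 : ℝ) : ℂ) := by push_cast; ring
      rw [Complex.neg_im, Complex.add_im, this, Complex.ofReal_im, add_zero]
    rw [e1, e2, div_eq_mul_inv _ (t i), div_eq_mul_inv _ (t i), div_eq_mul_inv _ (t i)]
    have h1 : (n : ℝ) * (w i).im ≤ |(n : ℝ)| * (Real.pi - δ) := by
      calc _ ≤ |(n : ℝ) * (w i).im| := le_abs_self _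
        _ = |(n : ℝ)| * |(w i).im| := abs_mul _ _
        _ ≤ _ := by gcongr
    have h2 : |(n : ℝ)| ≤ (n : ℝ) ^ 2 := by
      rw [← sq_abs]
      rcases eq_or_ne n 0 with rfl | h0
      · simp
      · have : (1 : ℝ) ≤ |(n : ℝ)| := by exact_mod_cast Int.one_le_abs h0
        nlinarith
    have hti : 0 < (t i)⁻¹ := inv_pos.2 hi
    have hp := Real.pi_pos
    have h3 : -Real.pi * n ^ 2 * (2 * Real.pi) - 2 * Real.pi * n * -(w i).im ≤
        -(2 * Real.pi * δ) * |(n : ℝ)| := by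
      nlinarith [mul_le_mul_of_nonneg_left h1 hp.le, mul_le_mul_of_nonneg_left h2 (mul_pos hp hp).le]
    calc _ = (-Real.pi * n ^ 2 * (2 * Real.pi) - 2 * Real.pi * n * -(w i).im) * (t i)⁻¹ := by ring
      _ ≤ _ := mul_le_mul_of_nonneg_right h3 hti.le
  have hpos : 0 < 2 * Real.pi * δ := by positivity
  have htp : ∀ᶠ i in l, 0 < t i := ht.eventually self_mem_nhdsWithin
  have hsum : Summable fun n : ℤ => Real.exp (-(2 * Real.pi * δ) * |(n : ℝ)|) := by
    have h1 : Summable fun n : ℕ => Real.exp (-(2 * Real.pi * δ)) ^ n :=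
      summable_geometric_of_lt_one (Real.exp_pos _).le (Real.exp_lt_one_iff.2 (by linarith))
    apply Summable.of_nat_of_neg
    · refine h1.congr fun n => ?_
      rw [← Real.exp_nat_mul, Int.cast_natCast, Nat.abs_cast, mul_comm]
    · refine h1.congr fun n => ?_
      rw [← Real.exp_nat_mul, Int.cast_neg, abs_neg, Int.cast_natCast, Nat.abs_cast, mul_comm]
  have key := tendsto_tsum_of_dominated_convergence (𝓕 := l)
    (f := fun i n => jacobiTheta₂_term n (-(w i + t i / 2) / t i) (2 * Real.pi / t i * Complex.I))
    (g := fun n => if n = 0 then 1 else 0) hsum (fun n => ?_) ?_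
  · simpa [dualTheta, jacobiTheta₂] using key
  · rcases eq_or_ne n 0 with rfl | h0
    · simpa [jacobiTheta₂_term] using tendsto_const_nhds
    · rw [if_neg h0]
      have hn : 0 < |(n : ℝ)| := by positivity
      have h1 : Tendsto (fun i => Real.exp (-(2 * Real.pi * δ) * |(n : ℝ)| / t i)) l (𝓝 0) := by
        refine Real.tendsto_exp_atBot.comp ?_
        simp_rw [div_eq_mul_inv]
        exact (tendsto_inv_nhdsGT_zero.comp ht).const_mul_atTop_of_neg (by nlinarith)
      refine squeeze_zero_norm' ?_ h1
      filter_upwards [htp, hw] with i hi hwi using hnorm i hi hwi n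
  · have hle1 : ∀ᶠ i in l, t i ≤ 1 :=
      (ht.mono_right nhdsWithin_le_nhds).eventually_le_const one_pos
    filter_upwards [htp, hw, hle1] with i hi hwi hi1 n
    refine (hnorm i hi hwi n).trans (Real.exp_le_exp.2 ?_)
    rw [div_le_iff₀ hi]
    have : 0 ≤ 2 * Real.pi * δ * |(n : ℝ)| := by positivity
    nlinarith

theorem tendsto_neg_log_nhdsLT_one : Tendsto (fun q : ℝ => -Real.log q) (𝓝[<] 1) (𝓝[>] 0) := by
  refine tendsto_nhdsWithin_iff.2 ⟨?_, ?_⟩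
  · have : ContinuousAt (fun q : ℝ => -Real.log q) 1 := by
      exact (Real.continuousAt_log one_ne_zero).neg
    have h := this.tendsto
    simp only [Real.log_one, neg_zero] at h
    exact h.mono_left nhdsWithin_le_nhds
  · filter_upwards [Ioo_mem_nhdsLT (zero_lt_one : (0 : ℝ) < 1)] with q hq
    simpa using Real.log_neg hq.1 hq.2

theorem ofReal_eq_exp_neg {q : ℝ} (hq : 0 < q) :
    (q : ℂ) = Complex.exp (-((-Real.log q : ℝ) : ℂ)) := by
  rw [Complex.ofReal_neg, neg_neg, ← Complex.ofReal_exp, Real.exp_log hq]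

/-- `θ_q` has no zeros in a given closed sector around the positive axis, for `q` near `1`. -/
theorem eventually_qTheta_exp_ne_zero {δ : ℝ} (hδ : 0 < δ) :
    ∀ᶠ q : ℝ in 𝓝[<] 1, ∀ w : ℂ, |w.im| ≤ Real.pi - δ → qTheta q (Complex.exp w) ≠ 0 := by
  have h := tendsto_dualTheta (l := (𝓝[<] (1 : ℝ)) ×ˢ 𝓟 {w : ℂ | |w.im| ≤ Real.pi - δ})
    (t := fun p => -Real.log p.1) (w := fun p => p.2) hδ
    (tendsto_neg_log_nhdsLT_one.comp tendsto_fst)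
    (eventually_prod_principal_iff.2 (Eventually.of_forall fun q w hw => hw))
  have h2 := eventually_prod_principal_iff.1 (h.eventually_ne one_ne_zero)
  filter_upwards [h2, Ioo_mem_nhdsLT (zero_lt_one : (0 : ℝ) < 1)] with q hq hq1 w hw
  have ht : 0 < -Real.log q := by simpa using Real.log_neg hq1.1 hq1.2
  rw [ofReal_eq_exp_neg hq1.1, qTheta_exp_eq_dualTheta ht]
  refine mul_ne_zero (mul_ne_zero (one_div_ne_zero ?_) (Complex.exp_ne_zero _)) (hq w hw)
  rw [Complex.cpow_ne_zero_iff]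
  left
  have h3 : (((-Real.log q : ℝ) : ℂ)) ≠ 0 := Complex.ofReal_ne_zero.2 ht.ne'
  have hpi : (Real.pi : ℂ) ≠ 0 := by exact_mod_cast Real.pi_ne_zero
  exact div_ne_zero h3 (mul_ne_zero two_ne_zero hpi)

theorem qTheta_exp_sub_div {t : ℝ} (ht : 0 < t) (α w : ℂ) :
    qTheta (Complex.exp (-t)) (Complex.exp (w - α * t)) /
        qTheta (Complex.exp (-t)) (Complex.exp w) =
      Complex.exp (-α * (w + t / 2) + α ^ 2 * t / 2) *
        (dualTheta t (w - α * t) / dualTheta t w) := by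
  have hpi : (Real.pi : ℂ) ≠ 0 := by exact_mod_cast Real.pi_ne_zero
  have ht0 : (t : ℂ) ≠ 0 := by exact_mod_cast ht.ne'
  have hc : (1 / ((t / (2 * Real.pi) : ℂ)) ^ (1 / 2 : ℂ)) ≠ 0 := by
    refine one_div_ne_zero ?_
    rw [Complex.cpow_ne_zero_iff]
    exact Or.inl (div_ne_zero ht0 (mul_ne_zero two_ne_zero hpi))
  have he : Complex.exp ((w - α * t + t / 2) ^ 2 / (2 * t)) =
      Complex.exp (-α * (w + t / 2) + α ^ 2 * t / 2) * Complex.exp ((w + t / 2) ^ 2 / (2 * t)) := by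
    rw [← Complex.exp_add]
    congr 1
    field_simp
    ring
  rw [qTheta_exp_eq_dualTheta ht, qTheta_exp_eq_dualTheta ht, he]
  have := Complex.exp_ne_zero ((w + t / 2) ^ 2 / (2 * t))
  generalize (1 / ((t / (2 * Real.pi) : ℂ)) ^ (1 / 2 : ℂ)) = c at *
  generalize Complex.exp ((w + t / 2) ^ 2 / (2 * t)) = E at *
  rw [mul_div_mul_comm, mul_comm _ E, ← mul_assoc c, mul_div_cancel_left₀ _ (mul_ne_zero hc this)]

/-- The asymptotic behaviour as `q → 1` of the theta quotients in the connection formula of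
the `q`-Laplace transform. -/
theorem tendsto_qTheta_quotients (α : ℂ) {lam x : ℂ} (hlam₀ : lam ≠ 0)
    (hlam : |Complex.arg lam| < Real.pi) (hx₀ : x ≠ 0)
    (hxlam : |Complex.arg x - Complex.arg lam| < Real.pi) :
    Tendsto (fun q : ℝ => qTheta q ((q : ℂ) ^ α * lam) / qTheta q lam *
      (qTheta q (lam / ((q : ℂ) ^ α * (x / (1 - q)))) / qTheta q (lam / (x / (1 - q)))) *
        (1 - q : ℂ) ^ (-α)) (𝓝[<] 1) (𝓝 (x ^ (-α))) := by
  set w₁ : ℂ := Complex.log lam with hw₁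
  set w₂ : ℝ → ℂ := fun q => Complex.log lam - Complex.log x + (Real.log (1 - q) : ℝ) with hw₂
  set t : ℝ → ℝ := fun q => -Real.log q with ht
  have htend : Tendsto t (𝓝[<] 1) (𝓝[>] 0) := tendsto_neg_log_nhdsLT_one
  have htend0 : Tendsto t (𝓝[<] 1) (𝓝 0) := htend.mono_right nhdsWithin_le_nhds
  set δ := min (Real.pi - |Complex.arg lam|) (Real.pi - |Complex.arg x - Complex.arg lam|) / 2 with hδ
  have hδ0 : 0 < δ := half_pos (lt_min (by linarith) (by linarith))
  have hδ1 : |Complex.arg lam| ≤ Real.pi - 2 * δ := by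
    have := min_le_left (Real.pi - |Complex.arg lam|) (Real.pi - |Complex.arg x - Complex.arg lam|)
    linarith
  have hδ2 : |Complex.arg x - Complex.arg lam| ≤ Real.pi - 2 * δ := by
    have := min_le_right (Real.pi - |Complex.arg lam|) (Real.pi - |Complex.arg x - Complex.arg lam|)
    linarith
  have him₂ : ∀ q, |(w₂ q).im| ≤ Real.pi - 2 * δ := fun q => by
    rw [hw₂, Complex.add_im, Complex.sub_im, Complex.ofReal_im, add_zero, Complex.log_im,
      Complex.log_im, abs_sub_comm]
    exact hδ2
  have hsmall : ∀ γ : ℂ, ∀ᶠ q in 𝓝[<] (1 : ℝ), |(γ * t q).im| ≤ δ := fun γ => by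
    have h : Tendsto (fun q => |(γ * t q).im|) (𝓝[<] 1) (𝓝 |(γ * ((0 : ℝ) : ℂ)).im|) := by
      have hc : Continuous fun y : ℝ => |(γ * (y : ℂ)).im| := by fun_prop
      exact (hc.tendsto 0).comp htend0
    rw [Complex.ofReal_zero, mul_zero, Complex.zero_im, abs_zero] at h
    exact h.eventually_le_const hδ0
  have J : ∀ w : ℝ → ℂ, (∀ q, |(w q).im| ≤ Real.pi - 2 * δ) → ∀ γ : ℂ,
      Tendsto (fun q => dualTheta (t q) (w q - γ * t q)) (𝓝[<] 1) (𝓝 1) := fun w hw γ =>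
    tendsto_dualTheta hδ0 htend (by
      filter_upwards [hsmall γ] with q hq
      rw [Complex.sub_im]
      have := abs_sub (w q).im (γ * t q).im
      have := hw q
      linarith)
  have J0 : ∀ w : ℝ → ℂ, (∀ q, |(w q).im| ≤ Real.pi - 2 * δ) →
      Tendsto (fun q => dualTheta (t q) (w q)) (𝓝[<] 1) (𝓝 1) := fun w hw => by
    simpa using J w hw 0
  have hw₁im : ∀ q : ℝ, |((fun _ : ℝ => w₁) q).im| ≤ Real.pi - 2 * δ := fun q => by
    simpa [hw₁, Complex.log_im] using hδ1
  have main := ((((J _ hw₁im α).div (J0 _ hw₁im) one_ne_zero).mul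
    ((J w₂ him₂ (-α)).div (J0 w₂ him₂) one_ne_zero)).mul
    ((Complex.continuous_exp.tendsto _).comp ((tendsto_const_nhds (x := -α * Complex.log x)).add
      (((Complex.continuous_ofReal.tendsto 0).comp htend0).const_mul (α ^ 2)))))
  simp only [Complex.ofReal_zero, mul_zero, add_zero, div_one, one_mul] at main
  rw [Complex.cpow_def_of_ne_zero hx₀, mul_comm (Complex.log x)]
  refine main.congr' ?_
  filter_upwards [Ioo_mem_nhdsLT (zero_lt_one : (0 : ℝ) < 1)] with q hq
  have htq : 0 < t q := by simpa [ht] using Real.log_neg hq.1 hq.2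
  have hq1 : (0 : ℝ) < 1 - q := by linarith [hq.2]
  have hq1c : (1 - q : ℂ) ≠ 0 := by
    have := Complex.ofReal_ne_zero.2 hq1.ne'
    simpa using this
  have hqc : (q : ℂ) ≠ 0 := Complex.ofReal_ne_zero.2 hq.1.ne'
  have eq1 : (q : ℂ) = Complex.exp (-(t q : ℂ)) := ofReal_eq_exp_neg hq.1
  have eqα : (q : ℂ) ^ α = Complex.exp (-(α * t q)) := by
    rw [Complex.cpow_def_of_ne_zero hqc, ← Complex.ofReal_log hq.1.le, ht]
    push_cast
    ring_nf
  have e1 : lam = Complex.exp w₁ := (Complex.exp_log hlam₀).symm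
  have e1' : (q : ℂ) ^ α * lam = Complex.exp (w₁ - α * t q) := by
    rw [eqα, sub_eq_add_neg, Complex.exp_add, ← e1, mul_comm]
  have e2 : lam / (x / (1 - q)) = Complex.exp (w₂ q) := by
    rw [hw₂, Complex.exp_add, Complex.exp_sub, Complex.exp_log hlam₀, Complex.exp_log hx₀,
      ← Complex.ofReal_exp, Real.exp_log hq1]
    push_cast
    field_simp
  have e2' : lam / ((q : ℂ) ^ α * (x / (1 - q))) = Complex.exp (w₂ q - (-α) * t q) := by
    rw [show w₂ q - (-α) * t q = w₂ q - -(α * t q) by ring, Complex.exp_sub, ← eqα, ← e2]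
    field_simp
  have e3 : (1 - q : ℂ) ^ (-α) = Complex.exp (-α * (Real.log (1 - q) : ℝ)) := by
    rw [Complex.cpow_def_of_ne_zero hq1c, Complex.ofReal_log hq1.le, mul_comm]
    push_cast
    rfl
  have r1 := qTheta_exp_sub_div htq α w₁
  have r2 := qTheta_exp_sub_div htq (-α) (w₂ q)
  rw [← eq1, ← e1', ← e1] at r1
  rw [← eq1, ← e2', ← e2] at r2
  rw [r1, r2, e3]
  have e4 : Complex.exp (-α * Complex.log x + α ^ 2 * (t q : ℂ)) =
      Complex.exp (-α * (w₁ + t q / 2) + α ^ 2 * t q / 2) *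
      Complex.exp (- -α * (w₂ q + t q / 2) + (-α) ^ 2 * t q / 2) *
        Complex.exp (-α * (Real.log (1 - q) : ℝ)) := by
    rw [← Complex.exp_add, ← Complex.exp_add, hw₁, hw₂]
    congr 1
    ring
  simp only [Pi.div_apply, Function.comp_apply]
  rw [e4]
  ring

/-- The quantity `(1 - q^(m+1)) / (1 - q^m) - 1` for `m = n + 1`. -/
def qStep (q : ℝ) (n : ℕ) : ℝ := q ^ (n + 1) * (1 - q) / (1 - q ^ (n + 1))

/-- The factors of the infinite product of `1 / Γ_q(s + 1)`. -/
def qGammaFactor (s : ℂ) (q : ℝ) (n : ℕ) : ℂ :=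
  (1 + qStep q n * ((1 - (q : ℂ) ^ s) / (1 - q))) *
    Complex.exp (-s * (Real.log (1 + qStep q n) : ℝ))

theorem pow_mul_binomial_le_one {p : ℝ} (hp0 : 0 ≤ p) (hp1 : p ≤ 1) (m : ℕ) :
    (1 - p) ^ m * (1 + m * p + m * (m - 1) / 2 * p ^ 2) ≤ 1 := by
  induction m with
  | zero => simp
  | succ m ih =>
    refine le_trans ?_ ih
    rw [pow_succ, mul_assoc]
    refine mul_le_mul_of_nonneg_left ?_ (pow_nonneg (by linarith) m)
    push_cast
    have h1 : 0 ≤ p ^ 2 := by positivity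
    have h2 : 0 ≤ p ^ 3 * (m * (m + 1)) := by positivity
    nlinarith

theorem one_sub_pow_pos {q : ℝ} (hq0 : 0 < q) (hq1 : q < 1) (n : ℕ) : 0 < 1 - q ^ (n + 1) := by
  have : q ^ (n + 1) < 1 := pow_lt_one₀ hq0.le hq1 (Nat.succ_ne_zero n)
  linarith

theorem qStep_nonneg {q : ℝ} (hq0 : 0 < q) (hq1 : q < 1) (n : ℕ) : 0 ≤ qStep q n :=
  div_nonneg (mul_nonneg (by positivity) (by linarith)) (one_sub_pow_pos hq0 hq1 n).le

theorem qStep_le {q : ℝ} (hq0 : 0 < q) (hq1 : q < 1) (n : ℕ) : qStep q n ≤ 1 / (n + 1) := by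
  have h := pow_mul_binomial_le_one (p := 1 - q) (by linarith) (by linarith) (n + 1)
  rw [sub_sub_cancel] at h
  push_cast at h
  rw [qStep, div_le_div_iff₀ (one_sub_pow_pos hq0 hq1 n) (by positivity)]
  have : 0 ≤ q ^ (n + 1) * (((n : ℝ) + 1) * (n + 1 - 1) / 2 * (1 - q) ^ 2) := by
    rw [add_sub_cancel_right]; positivity
  nlinarith

theorem one_sub_mul_qStep_le {q : ℝ} (hq0 : 0 < q) (hq1 : q < 1) (n : ℕ) :
    (1 - q) * qStep q n ≤ 2 * (1 / (n + 1)) ^ 2 := by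
  have h := pow_mul_binomial_le_one (p := 1 - q) (by linarith) (by linarith) (n + 1)
  rw [sub_sub_cancel] at h
  push_cast at h
  rw [qStep, mul_div_assoc', one_div_pow, mul_one_div, div_le_div_iff₀
    (one_sub_pow_pos hq0 hq1 n) (by positivity)]
  have h1 : 0 ≤ q ^ (n + 1) * ((n + 1) * ((1 - q) * q)) := by
    have : 0 ≤ 1 - q := by linarith
    positivity
  have h2 : 0 ≤ q ^ (n + 1) * ((n + 1) * (1 - q) ^ 2) := by positivity
  nlinarith

theorem one_add_qStep {q : ℝ} (hq0 : 0 < q) (hq1 : q < 1) (n : ℕ) :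
    1 + qStep q n = (1 - q ^ (n + 1 + 1)) / (1 - q ^ (n + 1)) := by
  have := (one_sub_pow_pos hq0 hq1 n).ne'
  rw [qStep]
  field_simp
  ring

theorem norm_exp_sub_one_sub_le (z : ℂ) :
    ‖Complex.exp z - 1 - z‖ ≤ ‖z‖ ^ 2 * Real.exp ‖z‖ := by
  have := Complex.norm_exp_sub_sum_le_norm_mul_exp z 2
  simpa [Finset.sum_range_succ, sub_sub] using this

theorem norm_one_sub_cpow_sub_le (s : ℂ) {q : ℝ} (hq0 : 1 / 2 ≤ q) (hq1 : q < 1) :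
    ‖1 - (q : ℂ) ^ s - s * (1 - q)‖ ≤
      (4 * ‖s‖ ^ 2 * Real.exp ‖s‖ + 2 * ‖s‖) * (1 - q) ^ 2 := by
  have hq : 0 < q := by linarith
  have hqc : (q : ℂ) ≠ 0 := Complex.ofReal_ne_zero.2 hq.ne'
  have l1 : Real.log q ≤ -(1 - q) := by
    have := Real.log_le_sub_one_of_pos hq; linarith
  have hinv : q⁻¹ ≤ 2 := by
    rw [inv_le_comm₀ hq two_pos]; linarith
  have l2 : -Real.log q ≤ (1 - q) * q⁻¹ := by
    have := Real.log_le_sub_one_of_pos (inv_pos.2 hq)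
    rw [Real.log_inv] at this
    have e : (1 - q) * q⁻¹ = q⁻¹ - 1 := by field_simp
    linarith
  have hp : 0 < 1 - q := by linarith
  have habs : |Real.log q| ≤ 2 * (1 - q) := by
    rw [abs_of_nonpos (by linarith)]; nlinarith
  have habs1 : |Real.log q| ≤ 1 := by linarith
  have habs2 : |Real.log q + (1 - q)| ≤ 2 * (1 - q) ^ 2 := by
    rw [abs_of_nonpos (by linarith)]
    have e : (1 - q) * q⁻¹ = (1 - q) + (1 - q) ^ 2 * q⁻¹ := by field_simp; ring
    nlinarith [sq_nonneg (1 - q)]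
  have hz := norm_exp_sub_one_sub_le (Real.log q * s)
  have hzn : ‖(Real.log q : ℂ) * s‖ = |Real.log q| * ‖s‖ := by
    rw [norm_mul, Complex.norm_real, Real.norm_eq_abs]
  have e : 1 - (q : ℂ) ^ s - s * (1 - q) = -(Complex.exp (Real.log q * s) - 1 - Real.log q * s) -
      s * ((Real.log q + (1 - q) : ℝ) : ℂ) := by
    rw [Complex.cpow_def_of_ne_zero hqc, ← Complex.ofReal_log hq.le]
    push_cast
    ring
  rw [e]
  refine (norm_sub_le _ _).trans ?_
  rw [norm_neg, norm_mul s, Complex.norm_real, Real.norm_eq_abs, add_mul]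
  refine add_le_add (hz.trans ?_) ?_
  · rw [hzn]
    have h1 : |Real.log q| * ‖s‖ ≤ ‖s‖ := mul_le_of_le_one_left (norm_nonneg s) habs1
    calc (|Real.log q| * ‖s‖) ^ 2 * Real.exp (|Real.log q| * ‖s‖)
        ≤ (2 * (1 - q) * ‖s‖) ^ 2 * Real.exp ‖s‖ := by gcongr
      _ = _ := by ring
  · nlinarith [mul_le_mul_of_nonneg_left habs2 (norm_nonneg s)]

theorem exists_norm_qGammaFactor_sub_one_le (s : ℂ) :
    ∃ C : ℝ, ∀ q : ℝ, 1 / 2 ≤ q → q < 1 → ∀ n : ℕ,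
      ‖qGammaFactor s q n - 1‖ ≤ C * (1 / (n + 1)) ^ 2 := by
  set C₁ := 4 * ‖s‖ ^ 2 * Real.exp ‖s‖ + 2 * ‖s‖ with hC₁
  have hC₁0 : 0 ≤ C₁ := by positivity
  set C₂ := ‖s‖ + C₁ with hC₂
  set C₃ := ‖s‖ ^ 2 * Real.exp ‖s‖ with hC₃
  refine ⟨2 * C₁ + ‖s‖ + C₂ * ‖s‖ + (1 + C₂) * C₃, fun q hq hq1 n => ?_⟩
  have hq0 : 0 < q := by linarith
  have hp : 0 < 1 - q := by linarith
  set ε := qStep q n with hε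
  set σ := (1 - (q : ℂ) ^ s) / (1 - q) with hσ
  have hε0 : 0 ≤ ε := qStep_nonneg hq0 hq1 n
  have hε1 : ε ≤ 1 / (n + 1) := qStep_le hq0 hq1 n
  have hu1 : (1 / ((n : ℝ) + 1)) ≤ 1 := by
    rw [div_le_one (by positivity)]; linarith [(Nat.cast_nonneg n : (0 : ℝ) ≤ n)]
  have hε2 := one_sub_mul_qStep_le hq0 hq1 n
  rw [← hε] at hε2
  set u := 1 / ((n : ℝ) + 1) with hu
  have hu0 : 0 ≤ u := by positivity
  have hε3 : ε ≤ 1 := hε1.trans hu1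
  have hεu : ε ^ 2 ≤ u ^ 2 := by gcongr
  have hpc : (1 - q : ℂ) ≠ 0 := by
    have := Complex.ofReal_ne_zero.2 hp.ne'
    simpa using this
  have hnp : ‖(1 - q : ℂ)‖ = 1 - q := by
    have : (1 - q : ℂ) = ((1 - q : ℝ) : ℂ) := by push_cast; rfl
    rw [this, Complex.norm_real, Real.norm_of_nonneg hp.le]
  have hσs : ‖σ - s‖ ≤ C₁ * (1 - q) := by
    have e : σ - s = (1 - (q : ℂ) ^ s - s * (1 - q)) / (1 - q) := by
      rw [hσ]; field_simp
    rw [e, norm_div, hnp, div_le_iff₀ hp]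
    refine (norm_one_sub_cpow_sub_le s hq hq1).trans (le_of_eq ?_)
    rw [hC₁]; ring
  have hσ2 : ‖σ‖ ≤ C₂ := by
    have : σ = s + (σ - s) := by ring
    rw [this]
    refine (norm_add_le _ _).trans ?_
    rw [hC₂]
    nlinarith
  set L := Real.log (1 + ε) with hL
  have hL0 : 0 ≤ L := Real.log_nonneg (by linarith)
  have hL1 : L ≤ ε := by
    have := Real.log_le_sub_one_of_pos (by linarith : 0 < 1 + ε); linarith
  have hL2 : ε - L ≤ ε ^ 2 := by
    have h1 := Real.one_sub_inv_le_log_of_pos (by linarith : 0 < 1 + ε)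
    have h2 : ε - ε ^ 2 ≤ 1 - (1 + ε)⁻¹ := by
      have : (1 + ε)⁻¹ ≤ 1 - ε + ε ^ 2 := by
        rw [inv_le_iff_one_le_mul₀ (by linarith)]
        nlinarith [pow_nonneg hε0 3]
      linarith
    linarith
  set R := Complex.exp (-s * (L : ℂ)) - 1 - (-s * (L : ℂ)) with hR
  have hsL : ‖-s * (L : ℂ)‖ = ‖s‖ * L := by
    rw [norm_mul, norm_neg, Complex.norm_real, Real.norm_of_nonneg hL0]
  have hR1 : ‖R‖ ≤ C₃ * u ^ 2 := by
    refine (norm_exp_sub_one_sub_le _).trans ?_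
    rw [hsL, hC₃]
    have h1 : ‖s‖ * L ≤ ‖s‖ := mul_le_of_le_one_right (norm_nonneg s) (hL1.trans hε3)
    calc (‖s‖ * L) ^ 2 * Real.exp (‖s‖ * L) ≤ (‖s‖ * u) ^ 2 * Real.exp ‖s‖ := by
          gcongr; exact hL1.trans hε1
      _ = _ := by ring
  have e : qGammaFactor s q n - 1 = ε * (σ - s) + s * ((ε - L : ℝ) : ℂ) -
      ε * L * (σ * s) + (1 + ε * σ) * R := by
    rw [qGammaFactor, ← hε, ← hσ, ← hL, hR]
    push_cast
    ring
  have hne : ‖(ε : ℂ)‖ = ε := by rw [Complex.norm_real, Real.norm_of_nonneg hε0]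
  have hnL : ‖(L : ℂ)‖ = L := by rw [Complex.norm_real, Real.norm_of_nonneg hL0]
  rw [e]
  have b1 : ‖(ε : ℂ) * (σ - s)‖ ≤ 2 * C₁ * u ^ 2 := by
    rw [norm_mul, hne]
    calc ε * ‖σ - s‖ ≤ ε * (C₁ * (1 - q)) := by gcongr
      _ = C₁ * ((1 - q) * ε) := by ring
      _ ≤ C₁ * (2 * u ^ 2) := by gcongr
      _ = _ := by ring
  have b2 : ‖s * ((ε - L : ℝ) : ℂ)‖ ≤ ‖s‖ * u ^ 2 := by
    rw [norm_mul, Complex.norm_real, Real.norm_of_nonneg (by linarith)]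
    gcongr
    linarith
  have b3 : ‖(ε : ℂ) * L * (σ * s)‖ ≤ C₂ * ‖s‖ * u ^ 2 := by
    rw [norm_mul, norm_mul, norm_mul, hne, hnL]
    have hC₂0 : 0 ≤ C₂ := (norm_nonneg σ).trans hσ2
    calc ε * L * (‖σ‖ * ‖s‖) ≤ u * u * (C₂ * ‖s‖) := by
          gcongr; exact hL1.trans hε1
      _ = _ := by ring
  have b4 : ‖(1 + (ε : ℂ) * σ) * R‖ ≤ (1 + C₂) * C₃ * u ^ 2 := by
    rw [norm_mul, mul_assoc]
    refine mul_le_mul ?_ hR1 (norm_nonneg _) ?_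
    · refine (norm_add_le _ _).trans ?_
      rw [norm_one, norm_mul, hne]
      gcongr
      exact (mul_le_of_le_one_left (norm_nonneg σ) hε3).trans hσ2
    · have := (norm_nonneg σ).trans hσ2
      linarith
  refine (norm_add_le _ _).trans ((add_le_add_left ((norm_sub_le _ _).trans
    (add_le_add_left (norm_add_le _ _) _)) _).trans ?_)
  linarith

theorem prod_qGammaFactor (s : ℂ) {q : ℝ} (hq0 : 0 < q) (hq1 : q < 1) (N : ℕ) :
    ∏ n ∈ Finset.range N, qGammaFactor s q n =
      qShiftedFactorial (q * (q : ℂ) ^ s) q N / qShiftedFactorial q q N *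
        Complex.exp (-s * ((Real.log (1 - q ^ (N + 1)) - Real.log (1 - q) : ℝ) : ℂ)) := by
  have hpc : (1 - q : ℂ) ≠ 0 := by
    have := Complex.ofReal_ne_zero.2 (by linarith : (1 - q : ℝ) ≠ 0)
    simpa using this
  induction N with
  | zero => simp [qShiftedFactorial_zero]
  | succ N ih =>
    have hN := one_sub_pow_pos hq0 hq1 N
    have hN1 := one_sub_pow_pos hq0 hq1 (N + 1)
    have hNc : (1 - (q : ℂ) * q ^ N) ≠ 0 := by
      have := Complex.ofReal_ne_zero.2 hN.ne'
      rw [pow_succ'] at this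
      simpa using this
    have e1 : 1 + (qStep q N : ℂ) * ((1 - (q : ℂ) ^ s) / (1 - q)) =
        (1 - q * (q : ℂ) ^ s * q ^ N) / (1 - q * q ^ N) := by
      rw [qStep, pow_succ']
      push_cast
      field_simp
      ring
    rw [Finset.prod_range_succ, ih, qShiftedFactorial_succ, qShiftedFactorial_succ, qGammaFactor, e1,
      one_add_qStep hq0 hq1, Real.log_div hN1.ne' hN.ne',
      show Real.log (1 - q ^ (N + 1 + 1)) - Real.log (1 - q) =
        (Real.log (1 - q ^ (N + 1)) - Real.log (1 - q)) +
          (Real.log (1 - q ^ (N + 1 + 1)) - Real.log (1 - q ^ (N + 1))) by ring,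
      Complex.ofReal_add, mul_add, Complex.exp_add, mul_div_mul_comm]
    ring

theorem summable_one_div_succ_sq (C : ℝ) :
    Summable fun n : ℕ => C * (1 / ((n : ℝ) + 1)) ^ 2 := by
  have h := (summable_nat_add_iff 1).2 (Real.summable_one_div_nat_pow.2 one_lt_two)
  refine (h.mul_left C).congr fun n => ?_
  push_cast
  rw [one_div_pow]

theorem tprod_qGammaFactor (s : ℂ) {q : ℝ} (hq0 : 1 / 2 ≤ q) (hq1 : q < 1) :
    ∏' n, qGammaFactor s q n =
      qPochInf (q * (q : ℂ) ^ s) q / qPochInf q q * (1 - q : ℂ) ^ s := by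
  obtain ⟨C, hC⟩ := exists_norm_qGammaFactor_sub_one_le s
  have hq : 0 < q := by linarith
  have hqn : ‖(q : ℂ)‖ < 1 := by
    rwa [Complex.norm_real, Real.norm_of_nonneg hq.le]
  have hm : Multipliable fun n => qGammaFactor s q n := by
    have := multipliable_one_add_of_summable (f := fun n => qGammaFactor s q n - 1)
      (Summable.of_nonneg_of_le (fun _ => norm_nonneg _) (hC q hq0 hq1)
        (summable_one_div_succ_sq C))
    simpa using this
  refine tendsto_nhds_unique hm.tendsto_prod_tprod_nat ?_
  simp_rw [prod_qGammaFactor s hq hq1]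
  refine Tendsto.mul ((tendsto_qShiftedFactorial hqn _).div (tendsto_qShiftedFactorial hqn _)
    (qPochInf_self_ne_zero hqn)) ?_
  have hp : (0 : ℝ) < 1 - q := by linarith
  have hpc : (1 - q : ℂ) ≠ 0 := by
    have := Complex.ofReal_ne_zero.2 hp.ne'
    simpa using this
  have h1 : Tendsto (fun N : ℕ => Real.log (1 - q ^ (N + 1)) - Real.log (1 - q)) atTop
      (𝓝 (Real.log (1 - 0) - Real.log (1 - q))) := by
    have h2 : Tendsto (fun N : ℕ => 1 - q ^ (N + 1)) atTop (𝓝 (1 - 0)) :=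
      ((tendsto_pow_atTop_nhds_zero_of_lt_one hq.le hq1).comp (tendsto_add_atTop_nat 1)).const_sub 1
    exact (h2.log (by norm_num)).sub_const _
  have h3 : (1 - q : ℂ) ^ s = Complex.exp (-s * ((Real.log (1 - 0) - Real.log (1 - q) : ℝ) : ℂ)) := by
    rw [Complex.cpow_def_of_ne_zero hpc]
    congr 1
    have : Complex.log (1 - q) = (Real.log (1 - q) : ℝ) := by
      rw [Complex.ofReal_log hp.le]; push_cast; rfl
    rw [this]
    simp
    ring
  rw [h3]
  exact (Complex.continuous_exp.tendsto _).comp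
    (((Complex.continuous_ofReal.tendsto _).comp h1).const_mul (-s))

theorem tendsto_qStep (n : ℕ) : Tendsto (fun q => qStep q n) (𝓝[<] 1) (𝓝 (1 / (n + 1))) := by
  have h1 : ContinuousAt (fun q : ℝ => q ^ (n + 1) / ∑ i ∈ Finset.range (n + 1), q ^ i) 1 := by
    refine ContinuousAt.div (by fun_prop) (by fun_prop) ?_
    simp
    positivity
  have h2 := h1.tendsto.mono_left (nhdsWithin_le_nhds (s := Set.Iio 1))
  simp only [one_pow, Finset.sum_const, Finset.card_range, nsmul_eq_mul, mul_one] at h2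
  push_cast at h2
  refine h2.congr' ?_
  filter_upwards [Ioo_mem_nhdsLT (zero_lt_one : (0 : ℝ) < 1)] with q hq
  have hp : (1 - q) ≠ 0 := by linarith [hq.2]
  have e : 1 - q ^ (n + 1) = (∑ i ∈ Finset.range (n + 1), q ^ i) * (1 - q) := (geom_sum_mul_neg q _).symm
  rw [qStep, e, mul_div_mul_right _ _ hp]

theorem tendsto_one_sub_cpow_div (s : ℂ) :
    Tendsto (fun q : ℝ => (1 - (q : ℂ) ^ s) / (1 - q)) (𝓝[<] 1) (𝓝 s) := by
  rw [tendsto_iff_norm_sub_tendsto_zero]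
  have h : Tendsto (fun q : ℝ => (4 * ‖s‖ ^ 2 * Real.exp ‖s‖ + 2 * ‖s‖) * (1 - q)) (𝓝[<] 1)
      (𝓝 ((4 * ‖s‖ ^ 2 * Real.exp ‖s‖ + 2 * ‖s‖) * (1 - 1))) := by
    have hc : Continuous fun q : ℝ => (4 * ‖s‖ ^ 2 * Real.exp ‖s‖ + 2 * ‖s‖) * (1 - q) := by fun_prop
    exact (hc.tendsto 1).mono_left nhdsWithin_le_nhds
  rw [sub_self, mul_zero] at h
  refine squeeze_zero' (Eventually.of_forall fun _ => norm_nonneg _) ?_ h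
  filter_upwards [Ioo_mem_nhdsLT (by norm_num : (1 / 2 : ℝ) < 1)] with q hq
  have hp : 0 < 1 - q := by linarith [hq.2]
  have hpc : (1 - q : ℂ) ≠ 0 := by
    have := Complex.ofReal_ne_zero.2 hp.ne'
    simpa using this
  have hnp : ‖(1 - q : ℂ)‖ = 1 - q := by
    have : (1 - q : ℂ) = ((1 - q : ℝ) : ℂ) := by push_cast; rfl
    rw [this, Complex.norm_real, Real.norm_of_nonneg hp.le]
  have e : (1 - (q : ℂ) ^ s) / (1 - q) - s = (1 - (q : ℂ) ^ s - s * (1 - q)) / (1 - q) := by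
    field_simp
  rw [e, norm_div, hnp, div_le_iff₀ hp]
  refine (norm_one_sub_cpow_sub_le s hq.1.le hq.2).trans (le_of_eq ?_)
  ring

/-- The factors of the infinite product of `1 / Γ(s + 1)`. -/
def gammaFactor (s : ℂ) (n : ℕ) : ℂ :=
  (1 + ((1 / (n + 1) : ℝ) : ℂ) * s) * Complex.exp (-s * (Real.log (1 + 1 / (n + 1)) : ℝ))

theorem tendsto_qGammaFactor (s : ℂ) (n : ℕ) :
    Tendsto (fun q => qGammaFactor s q n) (𝓝[<] 1) (𝓝 (gammaFactor s n)) := by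
  have h1 := tendsto_qStep n
  have h2 := (Complex.continuous_ofReal.tendsto _).comp h1
  refine Tendsto.mul ((h2.mul (tendsto_one_sub_cpow_div s)).const_add 1) ?_
  refine (Complex.continuous_exp.tendsto _).comp (Tendsto.const_mul _ ?_)
  refine (Complex.continuous_ofReal.tendsto _).comp ((h1.const_add 1).log ?_)
  positivity

theorem prod_gammaFactor (s : ℂ) (N : ℕ) :
    ∏ n ∈ Finset.range N, gammaFactor s n =
      (∏ n ∈ Finset.range N, (s + 1 + n)) / N.factorial *
        Complex.exp (-s * (Real.log (N + 1) : ℝ)) := by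
  induction N with
  | zero => simp
  | succ N ih =>
    have hN : (N : ℝ) + 1 ≠ 0 := by positivity
    have hNc : (N : ℂ) + 1 ≠ 0 := by exact_mod_cast Nat.succ_ne_zero N
    have hf : (N.factorial : ℂ) ≠ 0 := by exact_mod_cast N.factorial_ne_zero
    have e : Real.log (1 + 1 / (N + 1)) = Real.log (((N + 1 : ℕ) : ℝ) + 1) - Real.log (N + 1) := by
      rw [← Real.log_div (by positivity) hN]
      congr 1
      push_cast
      field_simp
    rw [Finset.prod_range_succ, ih, gammaFactor, e, Finset.prod_range_succ, Nat.factorial_succ,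
      Complex.ofReal_sub, mul_sub, Complex.exp_sub]
    have := Complex.exp_ne_zero (-s * (Real.log (N + 1) : ℝ))
    push_cast
    field_simp
    ring

theorem tendsto_prod_gammaFactor (s : ℂ) :
    Tendsto (fun N => ∏ n ∈ Finset.range N, gammaFactor s n) atTop (𝓝 (Complex.Gamma (s + 1))⁻¹) := by
  rw [← tendsto_add_atTop_iff_nat 1]
  by_cases hs : ∃ m : ℕ, s + 1 = -m
  · obtain ⟨m, hm⟩ := hs
    rw [hm, Complex.Gamma_neg_nat_eq_zero, inv_zero]
    refine tendsto_const_nhds.congr' ?_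
    filter_upwards [eventually_ge_atTop m] with N hN
    rw [prod_gammaFactor, Finset.prod_eq_zero (Finset.mem_range.2 (by omega : m < N + 1))]
    · simp
    · rw [hm]; ring
  · push Not at hs
    have h1 := (Complex.GammaSeq_tendsto_Gamma (s + 1)).inv₀ (Complex.Gamma_ne_zero hs)
    have h2 : Tendsto (fun N : ℕ => ((N / (N + 1) : ℝ) : ℂ)) atTop (𝓝 ((1 : ℝ) : ℂ)) :=
      (Complex.continuous_ofReal.tendsto _).comp (tendsto_natCast_div_add_atTop 1)
    have h3 : Tendsto (fun N : ℕ => Complex.exp (s * (Real.log (N / (N + 2)) : ℝ))) atTop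
        (𝓝 (Complex.exp (s * (Real.log 1 : ℝ)))) := by
      refine (Complex.continuous_exp.tendsto _).comp (Tendsto.const_mul _ ?_)
      exact (Complex.continuous_ofReal.tendsto _).comp
        ((tendsto_natCast_div_add_atTop (2 : ℝ)).log one_ne_zero)
    have h4 := (h1.mul h2).mul h3
    simp only [Real.log_one, Complex.ofReal_zero, mul_zero, Complex.exp_zero, Complex.ofReal_one,
      mul_one] at h4
    refine h4.congr' ?_
    filter_upwards [eventually_gt_atTop 0] with N hN
    have hN0 : (N : ℝ) ≠ 0 := by positivity
    have hNc : (N : ℂ) ≠ 0 := by exact_mod_cast hN.ne'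
    have hNc1 : (N : ℂ) + 1 ≠ 0 := by exact_mod_cast Nat.succ_ne_zero N
    have hf : (N.factorial : ℂ) ≠ 0 := by exact_mod_cast N.factorial_ne_zero
    rw [prod_gammaFactor, Complex.GammaSeq, inv_div, Real.log_div hN0 (by positivity),
      Nat.factorial_succ, Complex.cpow_add _ _ hNc, Complex.cpow_one,
      Complex.cpow_def_of_ne_zero hNc, ← Complex.natCast_log, Complex.ofReal_sub, mul_sub,
      Complex.exp_sub]
    have e : (((N + 1 : ℕ) : ℝ) + 1) = (N : ℝ) + 2 := by push_cast; ring
    rw [e, neg_mul, Complex.exp_neg, mul_comm ((Real.log N : ℝ) : ℂ) s]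
    have h5 := Complex.exp_ne_zero (s * ((Real.log N : ℝ) : ℂ))
    have h6 := Complex.exp_ne_zero (s * ((Real.log (N + 2) : ℝ) : ℂ))
    push_cast
    push_cast at h5 h6
    field_simp

/-- The `q`-Gamma function tends to the Gamma function as `q → 1`. -/
theorem tendsto_qPochInf_cpow_div (s : ℂ) :
    Tendsto (fun q : ℝ => qPochInf ((q : ℂ) ^ s) q / qPochInf q q * (1 - q : ℂ) ^ (s - 1)) (𝓝[<] 1)
      (𝓝 (Complex.Gamma s)⁻¹) := by
  obtain ⟨C, hC⟩ := exists_norm_qGammaFactor_sub_one_le (s - 1)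
  have hmem : Set.Ioo (1 / 2 : ℝ) 1 ∈ 𝓝[<] (1 : ℝ) := Ioo_mem_nhdsLT (by norm_num)
  have hle : ∀ᶠ q : ℝ in 𝓝[<] 1, ∀ n, ‖qGammaFactor (s - 1) q n - 1‖ ≤ C * (1 / (n + 1)) ^ 2 := by
    filter_upwards [hmem] with q hq using hC q hq.1.le hq.2
  have key := tendsto_tprod_one_add_of_dominated_convergence (𝓕 := 𝓝[<] (1 : ℝ))
    (f := fun q n => qGammaFactor (s - 1) q n - 1) (g := fun n => gammaFactor (s - 1) n - 1)
    (summable_one_div_succ_sq C) (fun n => (tendsto_qGammaFactor (s - 1) n).sub_const 1) hle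
  simp only [add_sub_cancel] at key
  have hm : Multipliable fun n => gammaFactor (s - 1) n := by
    have := multipliable_one_add_of_summable (f := fun n => gammaFactor (s - 1) n - 1)
      (Summable.of_nonneg_of_le (fun _ => norm_nonneg _) (fun n =>
        le_of_tendsto ((tendsto_qGammaFactor (s - 1) n).sub_const 1).norm
          (hle.mono fun q hq => hq n)) (summable_one_div_succ_sq C))
    simpa using this
  have hG := tendsto_nhds_unique hm.tendsto_prod_tprod_nat (tendsto_prod_gammaFactor (s - 1))
  rw [sub_add_cancel] at hG
  rw [← hG]
  refine key.congr' ?_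
  filter_upwards [hmem] with q hq
  have hqc : (q : ℂ) ≠ 0 := Complex.ofReal_ne_zero.2 (by linarith [hq.1])
  have e : (q : ℂ) * (q : ℂ) ^ (s - 1) = (q : ℂ) ^ s := by
    rw [Complex.cpow_sub _ _ hqc, Complex.cpow_one, mul_div_cancel₀ _ hqc]
  rw [tprod_qGammaFactor (s - 1) hq.1.le hq.2, e]

theorem norm_ofReal_cpow {q : ℝ} (hq : 0 < q) (s : ℂ) : ‖(q : ℂ) ^ s‖ = q ^ s.re :=
  Complex.norm_cpow_eq_rpow_re_of_pos hq s

theorem norm_one_sub_ofReal {q : ℝ} (hq : q < 1) : ‖(1 - q : ℂ)‖ = 1 - q := by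
  have : (1 - q : ℂ) = ((1 - q : ℝ) : ℂ) := by push_cast; rfl
  rw [this, Complex.norm_real, Real.norm_of_nonneg (by linarith)]

theorem one_sub_ofReal_ne_zero {q : ℝ} (hq : q < 1) : (1 - q : ℂ) ≠ 0 := by
  have := Complex.ofReal_ne_zero.2 (by linarith : (1 - q : ℝ) ≠ 0)
  simpa using this

theorem exists_le_norm_cpow_neg_sub_one_of_lt {γ : ℂ} (hγ : ∀ m : ℕ, γ ≠ -m) (K : ℕ) :
    ∃ c > 0, ∀ᶠ q : ℝ in 𝓝[<] 1, ∀ k < K, c * (1 - q) ≤ ‖(q : ℂ) ^ (-(γ + k)) - 1‖ := by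
  induction K with
  | zero => exact ⟨1, one_pos, by simp⟩
  | succ K ih =>
    obtain ⟨c, hc, h⟩ := ih
    have hne : γ + K ≠ 0 := fun h0 => hγ K (eq_neg_of_add_eq_zero_left h0)
    have hpos : 0 < ‖γ + K‖ := norm_pos_iff.2 hne
    have h1 := (tendsto_one_sub_cpow_div (-(γ + K))).norm.eventually_const_lt
      (u := ‖γ + K‖ / 2) (by rw [norm_neg]; linarith)
    refine ⟨min c (‖γ + K‖ / 2), lt_min hc (by linarith), ?_⟩
    filter_upwards [h, h1, self_mem_nhdsWithin] with q hq1 hq2 hq k hk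
    have hq' : q < 1 := hq
    have hp : 0 < 1 - q := by linarith
    rcases Nat.lt_succ_iff_lt_or_eq.1 hk with hk | rfl
    · exact (mul_le_mul_of_nonneg_right (min_le_left _ _) hp.le).trans (hq1 k hk)
    · refine (mul_le_mul_of_nonneg_right (min_le_right _ _) hp.le).trans ?_
      rw [norm_div, norm_one_sub_ofReal hq', lt_div_iff₀ hp] at hq2
      rw [norm_sub_rev]
      exact hq2.le

theorem exists_le_norm_cpow_neg_sub_one {γ : ℂ} (hγ : ∀ m : ℕ, γ ≠ -m) :
    ∃ c > 0, ∀ᶠ q : ℝ in 𝓝[<] 1, ∀ k : ℕ, c * (1 - q) ≤ ‖(q : ℂ) ^ (-(γ + k)) - 1‖ := by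
  obtain ⟨K, hK⟩ := exists_nat_ge (1 - γ.re)
  obtain ⟨c, hc, h⟩ := exists_le_norm_cpow_neg_sub_one_of_lt hγ K
  refine ⟨min c 1, lt_min hc one_pos, ?_⟩
  filter_upwards [h, Ioo_mem_nhdsLT (zero_lt_one : (0 : ℝ) < 1)] with q hq hq01 k
  have hp : 0 < 1 - q := by linarith [hq01.2]
  rcases lt_or_ge k K with hk | hk
  · exact (mul_le_mul_of_nonneg_right (min_le_left _ _) hp.le).trans (hq k hk)
  · refine (mul_le_mul_of_nonneg_right (min_le_right _ _) hp.le).trans ?_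
    have h1 : ‖(q : ℂ) ^ (-(γ + k))‖ - 1 ≤ ‖(q : ℂ) ^ (-(γ + k)) - 1‖ := by
      simpa using norm_sub_norm_le ((q : ℂ) ^ (-(γ + k))) 1
    refine le_trans ?_ h1
    rw [norm_ofReal_cpow hq01.1]
    have hk' : (K : ℝ) ≤ k := by exact_mod_cast hk
    have h2 : q ^ (-1 : ℝ) ≤ q ^ (-(γ + k)).re := by
      refine Real.rpow_le_rpow_of_exponent_ge hq01.1 hq01.2.le ?_
      simp
      linarith
    rw [Real.rpow_neg_one] at h2
    have h3 : 2 - q ≤ q⁻¹ := by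
      rw [le_inv_comm₀ (by linarith [hq01.2]) hq01.1, inv_eq_one_div,
        le_div_iff₀ (by linarith [hq01.2])]
      nlinarith [sq_nonneg (1 - q)]
    linarith

theorem cpow_add_natCast {q : ℂ} (hq : q ≠ 0) (s : ℂ) (k : ℕ) : q ^ (s + k) = q ^ s * q ^ k := by
  rw [Complex.cpow_add _ _ hq, Complex.cpow_natCast]

theorem cpow_neg_sub_one {q : ℂ} (hq : q ≠ 0) (s : ℂ) : 1 - q ^ s = q ^ s * (q ^ (-s) - 1) := by
  rw [mul_sub, ← Complex.cpow_add _ _ hq, add_neg_cancel, Complex.cpow_zero, mul_one]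

theorem eventually_one_sub_cpow_ne_zero {γ : ℂ} (hγ : ∀ m : ℕ, γ ≠ -m) :
    ∀ᶠ q : ℝ in 𝓝[<] 1, ∀ k : ℕ, 1 - (q : ℂ) ^ γ * (q : ℂ) ^ k ≠ 0 := by
  obtain ⟨c, hc, h⟩ := exists_le_norm_cpow_neg_sub_one hγ
  filter_upwards [h, Ioo_mem_nhdsLT (zero_lt_one : (0 : ℝ) < 1)] with q hq hq01 k
  have hqc : (q : ℂ) ≠ 0 := Complex.ofReal_ne_zero.2 hq01.1.ne'
  have hp : 0 < 1 - q := by linarith [hq01.2]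
  rw [← cpow_add_natCast hqc, cpow_neg_sub_one hqc]
  refine mul_ne_zero (by simp [Complex.cpow_eq_zero_iff, hqc]) (norm_pos_iff.1 ?_)
  exact (mul_pos hc hp).trans_le (hq k)

/-- Comparison, uniform in `k` and in `q` near `1`, of `1 - q^(α + k)` with `1 - q^(γ + k)`. -/
theorem exists_norm_one_sub_cpow_le (α : ℂ) {γ : ℂ} (hγ : ∀ m : ℕ, γ ≠ -m) :
    ∃ C > 0, ∀ᶠ q : ℝ in 𝓝[<] 1, ∀ k : ℕ,
      ‖1 - (q : ℂ) ^ α * (q : ℂ) ^ k‖ ≤ C * ‖1 - (q : ℂ) ^ γ * (q : ℂ) ^ k‖ := by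
  obtain ⟨c, hc, h⟩ := exists_le_norm_cpow_neg_sub_one hγ
  have h1 := (tendsto_one_sub_cpow_div (α - γ)).norm.eventually_lt_const (lt_add_one ‖α - γ‖)
  refine ⟨1 + (‖α - γ‖ + 1) / c, by positivity, ?_⟩
  filter_upwards [h, h1, Ioo_mem_nhdsLT (zero_lt_one : (0 : ℝ) < 1)] with q hq hq1 hq01 k
  have hqc : (q : ℂ) ≠ 0 := Complex.ofReal_ne_zero.2 hq01.1.ne'
  have hp : 0 < 1 - q := by linarith [hq01.2]
  rw [norm_div, norm_one_sub_ofReal hq01.2, div_lt_iff₀ hp] at hq1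
  rw [← cpow_add_natCast hqc, ← cpow_add_natCast hqc]
  have e : 1 - (q : ℂ) ^ (α + k) = (1 - (q : ℂ) ^ (γ + k)) +
      (q : ℂ) ^ (γ + k) * (1 - (q : ℂ) ^ (α - γ)) := by
    rw [mul_sub, ← Complex.cpow_add _ _ hqc]
    ring_nf
  rw [e]
  refine (norm_add_le _ _).trans ?_
  rw [add_mul, one_mul]
  gcongr
  rw [norm_mul, cpow_neg_sub_one hqc (γ + k), norm_mul, mul_left_comm]
  refine mul_le_mul_of_nonneg_left (hq1.le.trans ?_) (norm_nonneg _)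
  rw [div_mul_eq_mul_div, le_div_iff₀ hc, mul_assoc, mul_comm (1 - q)]
  exact mul_le_mul_of_nonneg_left (hq k) (by positivity)

/-- Dominated convergence for series whose terms satisfy a uniform ratio test. -/
theorem tendsto_tsum_of_ratio {ι : Type*} {l : Filter ι} {t : ι → ℕ → ℂ} {T : ℕ → ℂ} {C : ℝ} {K : ℕ}
    (hC : 1 ≤ C) (hT : ∀ k, Tendsto (t · k) l (𝓝 (T k))) (h0 : ∀ i, t i 0 = 1)
    (h1 : ∀ᶠ i in l, ∀ k, ‖t i (k + 1)‖ ≤ C * ‖t i k‖)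
    (h2 : ∀ᶠ i in l, ∀ k, K ≤ k → ‖t i (k + 1)‖ ≤ 1 / 2 * ‖t i k‖) :
    (∀ᶠ i in l, Summable fun k => ‖t i k‖) ∧
      Tendsto (fun i => ∑' k, t i k) l (𝓝 (∑' k, T k)) := by
  have hb : ∀ᶠ i in l, ∀ k, ‖t i k‖ ≤ (2 * C) ^ K * (1 / 2) ^ k := by
    filter_upwards [h1, h2] with i h1 h2
    have hle : ∀ k ≤ K, ‖t i k‖ ≤ C ^ k := by
      intro k
      induction k with
      | zero => simp [h0]
      | succ k ih =>
        intro hk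
        rw [pow_succ']
        exact (h1 k).trans (mul_le_mul_of_nonneg_left (ih (by omega)) (by linarith))
    intro k
    rcases le_total k K with hk | hk
    · calc ‖t i k‖ ≤ C ^ k := hle k hk
        _ = (2 * C) ^ k * (1 / 2) ^ k := by rw [← mul_pow]; congr 1; ring
        _ ≤ (2 * C) ^ K * (1 / 2) ^ k := by
          gcongr
          linarith
    · induction k, hk using Nat.le_induction with
      | base =>
        refine (hle K le_rfl).trans (le_of_eq ?_)
        rw [← mul_pow]; congr 1; ring
      | succ k hk ih =>
        refine (h2 k hk).trans ?_
        rw [pow_succ]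
        linarith
  have hs : Summable fun k : ℕ => (2 * C) ^ K * (1 / 2 : ℝ) ^ k :=
    (summable_geometric_of_lt_one (by norm_num) (by norm_num)).mul_left _
  exact ⟨hb.mono fun i hi => Summable.of_nonneg_of_le (fun _ => norm_nonneg _) hi hs,
    tendsto_tsum_of_dominated_convergence hs hT hb⟩

theorem tendsto_ofReal_cpow (s : ℂ) : Tendsto (fun q : ℝ => (q : ℂ) ^ s) (𝓝[<] 1) (𝓝 1) := by
  have h : ContinuousAt (fun q : ℝ => (q : ℂ) ^ s) 1 := by
    refine ContinuousAt.cpow (by fun_prop) (by fun_prop) ?_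
    simp
  have := h.tendsto.mono_left (nhdsWithin_le_nhds (s := Set.Iio 1))
  simpa using this

theorem tendsto_qShiftedFactorial_cpow_div (s : ℂ) (k : ℕ) :
    Tendsto (fun q : ℝ => qShiftedFactorial ((q : ℂ) ^ s) q k / (1 - q) ^ k) (𝓝[<] 1)
      (𝓝 ((ascPochhammer ℂ k).eval s)) := by
  induction k with
  | zero => simp [qShiftedFactorial]
  | succ k ih =>
    rw [ascPochhammer_succ_eval]
    refine (ih.mul (tendsto_one_sub_cpow_div (s + k))).congr' ?_
    filter_upwards [Ioo_mem_nhdsLT (zero_lt_one : (0 : ℝ) < 1)] with q hq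
    have hqc : (q : ℂ) ≠ 0 := Complex.ofReal_ne_zero.2 hq.1.ne'
    rw [qShiftedFactorial_succ, pow_succ, ← cpow_add_natCast hqc, mul_div_mul_comm]

open Finset in
/-- The coefficients of the generalized hypergeometric series at the `j`-th exponent. -/
def hypergeomCoeff (α : Fin 3 → ℂ) (β x : ℂ) (j : Fin 3) (k : ℕ) : ℂ :=
  (1 / x) ^ k * ((ascPochhammer ℂ k).eval (α j) * (ascPochhammer ℂ k).eval (α j + 1 - β)) /
    ((∏ l ∈ univ.erase j, (ascPochhammer ℂ k).eval (α j + 1 - α l)) * (k.factorial : ℂ))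

theorem mul_cpow_div_cpow {q : ℂ} (hq : q ≠ 0) (s t : ℂ) : q * q ^ s / q ^ t = q ^ (s + 1 - t) := by
  rw [Complex.cpow_sub _ _ hq, Complex.cpow_add _ _ hq, Complex.cpow_one, mul_comm q]

theorem ascPochhammer_eval_ne_zero {s : ℂ} (hs : ∀ m : ℕ, s ≠ -m) (k : ℕ) :
    (ascPochhammer ℂ k).eval s ≠ 0 := by
  induction k with
  | zero => simp
  | succ k ih =>
    rw [ascPochhammer_succ_eval]
    exact mul_ne_zero ih fun h => hs k (eq_neg_of_add_eq_zero_left h)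

open Finset in
theorem tendsto_laplaceCoeff {α : Fin 3 → ℂ} {β x : ℂ} (j : Fin 3)
    (hne : ∀ j l, j ≠ l → ∀ m : ℤ, α j - α l ≠ m) (k : ℕ) :
    Tendsto (fun q : ℝ => laplaceCoeff (fun l => (q : ℂ) ^ α l) ((q : ℂ) ^ β) q (x / (1 - q)) j k)
      (𝓝[<] 1) (𝓝 (hypergeomCoeff α β x j k)) := by
  have hκ : Tendsto (fun q : ℝ => (q : ℂ) ^ β * (q : ℂ) ^ (1 : ℂ) / (∏ l, (q : ℂ) ^ α l) * (1 / x))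
      (𝓝[<] 1) (𝓝 (1 * 1 / (∏ _l : Fin 3, 1) * (1 / x))) := by
    refine (((tendsto_ofReal_cpow β).mul (tendsto_ofReal_cpow 1)).div
      (tendsto_finsetProd univ fun l _ => tendsto_ofReal_cpow (α l)) ?_).mul_const _
    simp
  simp only [mul_one, prod_const_one, div_one, one_mul] at hκ
  have hd : ∀ l ∈ univ.erase j, (ascPochhammer ℂ k).eval (α j + 1 - α l) ≠ 0 := fun l hl =>
    ascPochhammer_eval_ne_zero (fun m hm => hne j l (ne_of_mem_erase hl).symm (-m - 1) (by
      push_cast; linear_combination hm)) k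
  have hf : (ascPochhammer ℂ k).eval 1 = (k.factorial : ℂ) := ascPochhammer_eval_one ℂ k
  have hf0 : (k.factorial : ℂ) ≠ 0 := by exact_mod_cast k.factorial_ne_zero
  have main := ((hκ.pow k).mul ((tendsto_qShiftedFactorial_cpow_div (α j) k).mul
    (tendsto_qShiftedFactorial_cpow_div (α j + 1 - β) k))).div
    ((tendsto_finsetProd (univ.erase j) fun l _ =>
      tendsto_qShiftedFactorial_cpow_div (α j + 1 - α l) k).mul
      (tendsto_qShiftedFactorial_cpow_div 1 k))
    (mul_ne_zero (prod_ne_zero_iff.2 hd) (by rw [hf]; exact hf0))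
  rw [hf] at main
  refine main.congr' ?_
  filter_upwards [Ioo_mem_nhdsLT (zero_lt_one : (0 : ℝ) < 1)] with q hq
  have hqc : (q : ℂ) ≠ 0 := Complex.ofReal_ne_zero.2 hq.1.ne'
  have hp := pow_ne_zero k (one_sub_ofReal_ne_zero hq.2)
  simp only [laplaceCoeff, Pi.div_apply]
  simp only [mul_cpow_div_cpow hqc, Complex.cpow_one, prod_div_distrib, prod_const,
    card_erase_of_mem (mem_univ j), card_univ, Fintype.card_fin, Nat.add_one_sub_one]
  have e1 : (q : ℂ) ^ β * q / ((∏ l, (q : ℂ) ^ α l) * (x / (1 - q))) =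
      (q : ℂ) ^ β * q / (∏ l, (q : ℂ) ^ α l) * (1 / x) * (1 - q) := by
    simp only [div_eq_mul_inv, mul_inv, inv_inv, one_mul]
    ring
  rw [e1, mul_pow _ (1 - (q : ℂ))]
  generalize (1 - (q : ℂ)) ^ k = p at hp ⊢
  field_simp

open Finset in
theorem tendsto_tsum_laplaceCoeff {α : Fin 3 → ℂ} {β x : ℂ} (j : Fin 3)
    (hne : ∀ j l, j ≠ l → ∀ m : ℤ, α j - α l ≠ m) :
    (∀ᶠ q : ℝ in 𝓝[<] 1, Summable fun k =>
      ‖laplaceCoeff (fun l => (q : ℂ) ^ α l) ((q : ℂ) ^ β) q (x / (1 - q)) j k‖) ∧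
    Tendsto (fun q : ℝ => ∑' k,
      laplaceCoeff (fun l => (q : ℂ) ^ α l) ((q : ℂ) ^ β) q (x / (1 - q)) j k)
      (𝓝[<] 1) (𝓝 (∑' k, hypergeomCoeff α β x j k)) := by
  have hone : ∀ m : ℕ, (1 : ℂ) ≠ -m := fun m h => by
    have h2 : ((m + 1 : ℕ) : ℂ) = 0 := by push_cast; linear_combination h
    exact Nat.succ_ne_zero m (by exact_mod_cast h2)
  have hl : ∀ l ∈ univ.erase j, ∀ m : ℕ, α j + 1 - α l ≠ -m := fun l hl m hm =>
    hne j l (ne_of_mem_erase hl).symm (-m - 1) (by push_cast; linear_combination hm)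
  obtain ⟨C₁, hC₁, h₁⟩ := exists_norm_one_sub_cpow_le (α j) hone
  obtain ⟨C₂, hC₂, h₂⟩ := exists_norm_one_sub_cpow_le (α j + 1 - β) hone
  have : ∀ l : Fin 3, ∃ C > 0, l ∈ univ.erase j → ∀ᶠ q : ℝ in 𝓝[<] 1, ∀ k : ℕ,
      ‖1 - (q : ℂ) ^ (1 : ℂ) * (q : ℂ) ^ k‖ ≤ C * ‖1 - (q : ℂ) ^ (α j + 1 - α l) * (q : ℂ) ^ k‖ := by
    intro l
    by_cases h : l ∈ univ.erase j
    · obtain ⟨C, hC, hh⟩ := exists_norm_one_sub_cpow_le 1 (hl l h)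
      exact ⟨C, hC, fun _ => hh⟩
    · exact ⟨1, one_pos, fun h' => absurd h' h⟩
  choose C₃ hC₃ h₃ using this
  have hκ : Tendsto (fun q : ℝ => (q : ℂ) ^ β * (q : ℂ) ^ (1 : ℂ) / (∏ l, (q : ℂ) ^ α l) * (1 / x))
      (𝓝[<] 1) (𝓝 (1 * 1 / (∏ _l : Fin 3, 1) * (1 / x))) := by
    refine (((tendsto_ofReal_cpow β).mul (tendsto_ofReal_cpow 1)).div
      (tendsto_finsetProd univ fun l _ => tendsto_ofReal_cpow (α l)) ?_).mul_const _
    simp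
  simp only [mul_one, prod_const_one, div_one, one_mul] at hκ
  have h₄ := hκ.norm.eventually_lt_const (lt_add_one ‖1 / x‖)
  have hC₃' : 0 < ∏ l ∈ univ.erase j, C₃ l := prod_pos fun l _ => hC₃ l
  set B := (‖1 / x‖ + 1) * (C₁ * C₂ * ∏ l ∈ univ.erase j, C₃ l) with hB
  have hB0 : 0 ≤ B := by positivity
  obtain ⟨K, hK⟩ := exists_nat_ge (4 * B)
  have hreg : ∀ᶠ q : ℝ in 𝓝[<] 1, ∀ l ∈ univ.erase j, ∀ k : ℕ,
      1 - (q : ℂ) ^ (α j + 1 - α l) * (q : ℂ) ^ k ≠ 0 :=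
    (Filter.eventually_all_finset _).2 fun l h => eventually_one_sub_cpow_ne_zero (hl l h)
  have h₃' : ∀ᶠ q : ℝ in 𝓝[<] 1, ∀ l ∈ univ.erase j, ∀ k : ℕ,
      ‖1 - (q : ℂ) ^ (1 : ℂ) * (q : ℂ) ^ k‖ ≤
        C₃ l * ‖1 - (q : ℂ) ^ (α j + 1 - α l) * (q : ℂ) ^ k‖ :=
    (Filter.eventually_all_finset _).2 fun l h => h₃ l h
  have hratio : ∀ᶠ q : ℝ in 𝓝[<] 1, ∀ k : ℕ,
      ‖laplaceCoeff (fun l => (q : ℂ) ^ α l) ((q : ℂ) ^ β) q (x / (1 - q)) j (k + 1)‖ ≤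
        B * ((1 - q) / (1 - q ^ (k + 1))) *
          ‖laplaceCoeff (fun l => (q : ℂ) ^ α l) ((q : ℂ) ^ β) q (x / (1 - q)) j k‖ := by
    filter_upwards [h₁, h₂, h₃', h₄, hreg, Ioo_mem_nhdsLT (zero_lt_one : (0 : ℝ) < 1)]
      with q h₁ h₂ h₃ h₄ hreg hq k
    have hqc : (q : ℂ) ≠ 0 := Complex.ofReal_ne_zero.2 hq.1.ne'
    have hp : 0 < 1 - q := by linarith [hq.2]
    have hP := one_sub_pow_pos hq.1 hq.2 k
    have eP : ‖1 - (q : ℂ) ^ (1 : ℂ) * (q : ℂ) ^ k‖ = 1 - q ^ (k + 1) := by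
      have : 1 - (q : ℂ) ^ (1 : ℂ) * (q : ℂ) ^ k = ((1 - q ^ (k + 1) : ℝ) : ℂ) := by
        rw [Complex.cpow_one]; push_cast; ring
      rw [this, Complex.norm_real, Real.norm_of_nonneg hP.le]
    have h₁ := h₁ k
    have h₂ := h₂ k
    have h₃ : ∀ l ∈ univ.erase j, _ := fun l hl => h₃ l hl k
    simp only [eP] at h₁ h₂ h₃
    have hrec : laplaceCoeff (fun l => (q : ℂ) ^ α l) ((q : ℂ) ^ β) q (x / (1 - q)) j (k + 1) =
        ((q : ℂ) ^ β * (q : ℂ) ^ (1 : ℂ) / (∏ l, (q : ℂ) ^ α l) * (1 / x) * (1 - q)) *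
        ((1 - (q : ℂ) ^ α j * (q : ℂ) ^ k) * (1 - (q : ℂ) ^ (α j + 1 - β) * (q : ℂ) ^ k)) *
        ((∏ l ∈ univ.erase j, (1 - (q : ℂ) ^ (α j + 1 - α l) * (q : ℂ) ^ k)) *
          (1 - (q : ℂ) ^ (1 : ℂ) * (q : ℂ) ^ k))⁻¹ *
        laplaceCoeff (fun l => (q : ℂ) ^ α l) ((q : ℂ) ^ β) q (x / (1 - q)) j k := by
      simp only [laplaceCoeff, mul_cpow_div_cpow hqc, qShiftedFactorial_succ, pow_succ _ k,
        prod_mul_distrib, Complex.cpow_one, div_eq_mul_inv, mul_inv, inv_inv]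
      ring
    rw [hrec, norm_mul _ (laplaceCoeff _ _ _ _ _ _)]
    refine mul_le_mul_of_nonneg_right ?_ (norm_nonneg _)
    rw [norm_mul, norm_mul, norm_mul _ (1 - (q : ℂ)), norm_one_sub_ofReal hq.2, norm_mul (1 - _),
      norm_inv, norm_mul (Finset.prod _ _), eP, norm_prod]
    have hD : (1 - q ^ (k + 1)) ^ 2 ≤ (∏ l ∈ univ.erase j, C₃ l) *
        ∏ l ∈ univ.erase j, ‖1 - (q : ℂ) ^ (α j + 1 - α l) * (q : ℂ) ^ k‖ := by
      rw [← prod_mul_distrib]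
      calc (1 - q ^ (k + 1)) ^ 2 = ∏ _l ∈ univ.erase j, (1 - q ^ (k + 1)) := by
            rw [prod_const, card_erase_of_mem (mem_univ j)]; simp
        _ ≤ _ := prod_le_prod (fun _ _ => hP.le) fun l hl => h₃ l hl
    have hDpos : 0 < ∏ l ∈ univ.erase j, ‖1 - (q : ℂ) ^ (α j + 1 - α l) * (q : ℂ) ^ k‖ :=
      prod_pos fun l hl => norm_pos_iff.2 (hreg l hl k)
    generalize ∏ l ∈ univ.erase j, ‖1 - (q : ℂ) ^ (α j + 1 - α l) * (q : ℂ) ^ k‖ = D at hD hDpos ⊢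
    have hN : ‖1 - (q : ℂ) ^ α j * (q : ℂ) ^ k‖ * ‖1 - (q : ℂ) ^ (α j + 1 - β) * (q : ℂ) ^ k‖ ≤
        C₁ * C₂ * ((∏ l ∈ univ.erase j, C₃ l) * D) := by
      calc _ ≤ (C₁ * (1 - q ^ (k + 1))) * (C₂ * (1 - q ^ (k + 1))) :=
            mul_le_mul h₁ h₂ (norm_nonneg _) (by positivity)
        _ = C₁ * C₂ * (1 - q ^ (k + 1)) ^ 2 := by ring
        _ ≤ _ := by gcongr
    have hN0 := mul_nonneg (norm_nonneg (1 - (q : ℂ) ^ α j * (q : ℂ) ^ k))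
      (norm_nonneg (1 - (q : ℂ) ^ (α j + 1 - β) * (q : ℂ) ^ k))
    generalize ‖1 - (q : ℂ) ^ α j * (q : ℂ) ^ k‖ * ‖1 - (q : ℂ) ^ (α j + 1 - β) * (q : ℂ) ^ k‖ = N
      at hN hN0 ⊢
    generalize 1 - q ^ (k + 1) = P at *
    rw [mul_inv]
    calc _ ≤ (‖1 / x‖ + 1) * (1 - q) * (C₁ * C₂ * ((∏ l ∈ univ.erase j, C₃ l) * D)) *
          (D⁻¹ * P⁻¹) := by gcongr
      _ = _ := by
        rw [hB]
        field_simp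
  have hK1 : ∀ᶠ q : ℝ in 𝓝[<] 1, (1 - q) / (1 - q ^ (K + 1)) ≤ 2 / (K + 1) := by
    have h1 : ContinuousAt (fun q : ℝ => 1 / ∑ i ∈ Finset.range (K + 1), q ^ i) 1 := by
      refine ContinuousAt.div (by fun_prop) (by fun_prop) ?_
      simp
      positivity
    have h2 := h1.tendsto.mono_left (nhdsWithin_le_nhds (s := Set.Iio 1))
    simp only [one_pow, Finset.sum_const, Finset.card_range, nsmul_eq_mul, mul_one] at h2
    push_cast at h2
    have h3 := h2.eventually_lt_const (u := 2 / ((K : ℝ) + 1)) (by gcongr; norm_num)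
    filter_upwards [h3, Ioo_mem_nhdsLT (zero_lt_one : (0 : ℝ) < 1)] with q hq3 hq
    have hp : (1 - q) ≠ 0 := by linarith [hq.2]
    refine le_trans (le_of_eq ?_) hq3.le
    rw [← geom_sum_mul_neg q (K + 1), div_mul_cancel_right₀ hp, one_div]
  refine tendsto_tsum_of_ratio (C := B + 1) (K := K) (by linarith)
    (tendsto_laplaceCoeff j hne) (fun q => by simp [laplaceCoeff, qShiftedFactorial_zero]) ?_ ?_
  · filter_upwards [hratio, Ioo_mem_nhdsLT (zero_lt_one : (0 : ℝ) < 1)] with q hq1 hq k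
    refine (hq1 k).trans (mul_le_mul_of_nonneg_right ?_ (norm_nonneg _))
    have hP := one_sub_pow_pos hq.1 hq.2 k
    have : (1 - q) / (1 - q ^ (k + 1)) ≤ 1 := by
      rw [div_le_one hP]
      have : q ^ (k + 1) ≤ q := pow_le_of_le_one hq.1.le hq.2.le (Nat.succ_ne_zero k)
      linarith
    nlinarith
  · filter_upwards [hratio, hK1, Ioo_mem_nhdsLT (zero_lt_one : (0 : ℝ) < 1)] with q hq1 hq2 hq k hk
    refine (hq1 k).trans (mul_le_mul_of_nonneg_right ?_ (norm_nonneg _))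
    have hPK := one_sub_pow_pos hq.1 hq.2 K
    have h1 : (1 - q) / (1 - q ^ (k + 1)) ≤ (1 - q) / (1 - q ^ (K + 1)) := by
      have h0 : 0 ≤ 1 - q := by linarith [hq.2]
      have : q ^ (k + 1) ≤ q ^ (K + 1) := pow_le_pow_of_le_one hq.1.le hq.2.le (by omega)
      gcongr
    calc _ ≤ B * (2 / (K + 1)) := mul_le_mul_of_nonneg_left (h1.trans hq2) hB0
      _ ≤ 1 / 2 := by
          rw [← mul_div_assoc, div_le_iff₀ (by positivity)]
          linarith

open Finset in
theorem tendsto_connectionConst {α : Fin 3 → ℂ} {β : ℂ} (hβ : ∀ m : ℕ, β ≠ -m) (j : Fin 3)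
    (hne : ∀ j l, j ≠ l → ∀ m : ℤ, α j - α l ≠ m) :
    Tendsto (fun q : ℝ => connectionConst (fun l => (q : ℂ) ^ α l) ((q : ℂ) ^ β) q j *
      (1 - q : ℂ) ^ α j) (𝓝[<] 1)
      (𝓝 ((∏ l ∈ univ.erase j, (Complex.Gamma (α l))⁻¹) * (Complex.Gamma (β - α j))⁻¹ /
        ((Complex.Gamma β)⁻¹ * ∏ l ∈ univ.erase j, (Complex.Gamma (α l - α j))⁻¹))) := by
  have hlim := ((tendsto_finsetProd (univ.erase j) fun l _ => tendsto_qPochInf_cpow_div (α l)).mul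
    (tendsto_qPochInf_cpow_div (β - α j))).div ((tendsto_qPochInf_cpow_div β).mul
    (tendsto_finsetProd (univ.erase j) fun l _ => tendsto_qPochInf_cpow_div (α l - α j)))
    (mul_ne_zero (inv_ne_zero (Complex.Gamma_ne_zero hβ)) (prod_ne_zero_iff.2 fun l hl =>
      inv_ne_zero (Complex.Gamma_ne_zero fun m h =>
        hne l j (ne_of_mem_erase hl) (-m) (by rw [h]; push_cast; ring))))
  refine hlim.congr' ?_
  filter_upwards [Ioo_mem_nhdsLT (zero_lt_one : (0 : ℝ) < 1)] with q hq
  have hqc : (q : ℂ) ≠ 0 := Complex.ofReal_ne_zero.2 hq.1.ne'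
  have hp : (1 - q : ℂ) ≠ 0 := one_sub_ofReal_ne_zero hq.2
  have hE : qPochInf (q : ℂ) q ≠ 0 := by
    refine qPochInf_ne_zero ?_ fun k h => ?_
    · rw [Complex.norm_real, Real.norm_of_nonneg hq.1.le]
      exact hq.2
    · have h' : 1 - q ^ (k + 1) = 0 := by
        rw [pow_succ']
        exact_mod_cast h
      exact (one_sub_pow_pos hq.1 hq.2 k).ne' h'
  simp only [Pi.div_apply, connectionConst, prod_mul_distrib, prod_div_distrib, prod_const,
    card_erase_of_mem (mem_univ j), ← Complex.cpow_sub _ _ hqc, Complex.cpow_sub _ _ hp,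
    Complex.cpow_one]
  have h0 : ∀ s : ℂ, (1 - q : ℂ) ^ s ≠ 0 := fun s => by
    rw [Ne, Complex.cpow_eq_zero_iff]; tauto
  have h1 : ∏ l ∈ univ.erase j, (1 - q : ℂ) ^ α l ≠ 0 := prod_ne_zero_iff.2 fun l _ => h0 _
  have h2 := h0 β
  have h3 := h0 (α j)
  simp only [card_univ, Fintype.card_fin]
  generalize ∏ l ∈ univ.erase j, (1 - q : ℂ) ^ α l = P1 at *
  generalize (1 - q : ℂ) ^ β = P2 at *
  generalize (1 - q : ℂ) ^ (α j) = P3 at *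
  field_simp

theorem eventually_isRegularParam {α : Fin 3 → ℂ} {β : ℂ} (hβ : ∀ m : ℕ, β ≠ -m)
    (hne : ∀ j l, j ≠ l → ∀ m : ℤ, α j - α l ≠ m) :
    ∀ᶠ q : ℝ in 𝓝[<] 1, IsRegularParam (fun l => (q : ℂ) ^ α l) ((q : ℂ) ^ β) q := by
  have h1 : ∀ᶠ q : ℝ in 𝓝[<] 1, ∀ j l : Fin 3, j ≠ l → ∀ k : ℕ,
      1 - (q : ℂ) ^ (α l - α j) * (q : ℂ) ^ k ≠ 0 := by
    refine eventually_all.2 fun j => eventually_all.2 fun l => ?_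
    by_cases h : j = l
    · simp [h]
    · refine (eventually_one_sub_cpow_ne_zero (γ := α l - α j) fun m hm =>
        hne l j (Ne.symm h) (-m) (by rw [hm]; push_cast; ring)).mono fun q hq _ => hq
  filter_upwards [eventually_one_sub_cpow_ne_zero hβ, h1,
    Ioo_mem_nhdsLT (zero_lt_one : (0 : ℝ) < 1)] with q hqβ hqα hq
  have hqc : (q : ℂ) ≠ 0 := Complex.ofReal_ne_zero.2 hq.1.ne'
  have hpow : ∀ s : ℂ, (q : ℂ) ^ s ≠ 0 := fun s => by
    rw [Ne, Complex.cpow_eq_zero_iff]; tauto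
  refine ⟨hqc, ?_, fun j => hpow _, hpow _, hqβ, fun j l hjl m => ?_⟩
  · rw [Complex.norm_real, Real.norm_of_nonneg hq.1.le]
    exact hq.2
  · obtain ⟨k, rfl | rfl⟩ := m.eq_nat_or_neg
    · rw [← Complex.cpow_sub _ _ hqc, zpow_natCast]
      exact hqα j l hjl k
    · have h := hqα l j hjl.symm k
      rw [Complex.cpow_sub _ _ hqc] at h
      rw [zpow_neg, zpow_natCast]
      intro h0
      apply h
      have hk : (q : ℂ) ^ k ≠ 0 := pow_ne_zero _ hqc
      have ha := hpow (α j)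
      have hb := hpow (α l)
      field_simp at h0 ⊢
      linear_combination -h0

theorem eventually_qTheta_ray_ne_zero {lam : ℂ} (hlam₀ : lam ≠ 0)
    (hlam : |Complex.arg lam| < Real.pi) :
    ∀ᶠ q : ℝ in 𝓝[<] 1, ∀ t : ℝ, 0 < t → qTheta q (t * lam) ≠ 0 := by
  filter_upwards [eventually_qTheta_exp_ne_zero (sub_pos.2 hlam)] with q hq t ht
  have h := hq ((Real.log t : ℝ) + Complex.log lam) (by simp [Complex.log_im])
  rwa [Complex.exp_add, Complex.exp_log hlam₀, ← Complex.ofReal_exp, Real.exp_log ht] at h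

theorem eventually_qTheta_div_ne_zero {lam x : ℂ} (hlam₀ : lam ≠ 0) (hx₀ : x ≠ 0)
    (hxlam : |Complex.arg x - Complex.arg lam| < Real.pi) :
    ∀ᶠ q : ℝ in 𝓝[<] 1, qTheta q (lam / (x / (1 - q))) ≠ 0 := by
  filter_upwards [eventually_qTheta_exp_ne_zero (sub_pos.2 hxlam), self_mem_nhdsWithin]
    with q hq (hq1 : q < 1)
  have h := hq ((Real.log (1 - q) : ℝ) + (Complex.log lam - Complex.log x)) (by
    simp [Complex.log_im, abs_sub_comm])
  rw [Complex.exp_add, Complex.exp_sub, Complex.exp_log hlam₀, Complex.exp_log hx₀,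
    ← Complex.ofReal_exp, Real.exp_log (sub_pos.2 hq1)] at h
  convert h using 2
  rw [div_div_eq_mul_div]
  push_cast
  ring

/-- The limit of the resummed function, in indexed form. -/
theorem tendsto_resummedF31 {α : Fin 3 → ℂ} {β lam x : ℂ}
    (hne : ∀ j l, j ≠ l → ∀ m : ℤ, α j - α l ≠ m) (hβ : ∀ m : ℕ, β ≠ -m)
    (hlam₀ : lam ≠ 0) (hlam : |Complex.arg lam| < Real.pi) (hx₀ : x ≠ 0)
    (hxlam : |Complex.arg x - Complex.arg lam| < Real.pi) :
    (∀ᶠ q : ℝ in 𝓝[<] 1, ∃ φ : ℂ → ℂ,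
      IsRayContinuation
        (qBorel q (basicPhi31 ((q : ℂ) ^ α 0) ((q : ℂ) ^ α 1) ((q : ℂ) ^ α 2) ((q : ℂ) ^ β) q))
        lam φ ∧
      (∀ n : ℤ, qTheta q (lam * (q : ℂ) ^ n / (x / (1 - q))) ≠ 0) ∧
      Summable (qLaplaceTerm q lam φ (x / (1 - q)))) ∧
    Tendsto
      (fun q : ℝ =>
        resummedF31 ((q : ℂ) ^ α 0) ((q : ℂ) ^ α 1) ((q : ℂ) ^ α 2) ((q : ℂ) ^ β) q lam
          (x / (1 - q)))
      (𝓝[<] 1)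
      (𝓝 (∑ j, (∏ l ∈ Finset.univ.erase j, (Complex.Gamma (α l))⁻¹) *
        (Complex.Gamma (β - α j))⁻¹ /
        ((Complex.Gamma β)⁻¹ * ∏ l ∈ Finset.univ.erase j, (Complex.Gamma (α l - α j))⁻¹) *
        x ^ (-α j) * ∑' k, hypergeomCoeff α β x j k)) := by
  have hslit : lam ∈ Complex.slitPlane := by
    rw [Complex.mem_slitPlane_iff_arg]
    exact ⟨fun h => by rw [h, abs_of_pos Real.pi_pos] at hlam; exact lt_irrefl _ hlam, hlam₀⟩
  have hreg := eventually_isRegularParam hβ hne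
  have hray := eventually_qTheta_ray_ne_zero hlam₀ hlam
  have hdiv := eventually_qTheta_div_ne_zero hlam₀ hx₀ hxlam
  have hsum := eventually_all.2 fun j => (tendsto_tsum_laplaceCoeff (β := β) (x := x) j hne).1
  have h01 : ∀ᶠ q : ℝ in 𝓝[<] 1, q ∈ Set.Ioo (0 : ℝ) 1 := Ioo_mem_nhdsLT zero_lt_one
  refine ⟨?_, ?_⟩
  · filter_upwards [hreg, hray, hdiv, hsum, h01] with q hreg hray hdiv hsum hq
    have hX : x / (1 - q : ℂ) ≠ 0 := div_ne_zero hx₀ (one_sub_ofReal_ne_zero hq.2)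
    have hcont := isRayContinuation_borelContinuation hreg hslit hray
    refine ⟨_, hcont, fun n => ?_,
      (hasSum_qLaplaceTerm hq.1 hreg hslit hX hray hdiv hsum hcont).summable⟩
    rw [mul_div_right_comm,
      qTheta_ne_zero_mul_zpow_iff hreg.q_ne_zero (div_ne_zero hlam₀ hX)]
    exact hdiv
  · have hlim := tendsto_finsetSum Finset.univ fun j _ =>
      (((tendsto_connectionConst hβ j hne).mul
        (tendsto_qTheta_quotients (α j) hlam₀ hlam hx₀ hxlam)).mul
        (tendsto_tsum_laplaceCoeff (β := β) (x := x) j hne).2)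
    refine hlim.congr' ?_
    filter_upwards [hreg, hray, hdiv, hsum, h01] with q hreg hray hdiv hsum hq
    have hp : (1 - q : ℂ) ≠ 0 := one_sub_ofReal_ne_zero hq.2
    have hX : x / (1 - q : ℂ) ≠ 0 := div_ne_zero hx₀ hp
    rw [resummedF31_eq hq.1 hreg hslit hX hray hdiv hsum]
    refine Finset.sum_congr rfl fun j _ => ?_
    have hmul : (1 - q : ℂ) ^ α j * (1 - q : ℂ) ^ (-α j) = 1 := by
      rw [← Complex.cpow_add _ _ hp, add_neg_cancel, Complex.cpow_zero]
    linear_combination (connectionConst (fun l => (q : ℂ) ^ α l) ((q : ℂ) ^ β) q j *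
      (qTheta q ((q : ℂ) ^ α j * lam) / qTheta q lam) *
      (qTheta q (lam / ((q : ℂ) ^ α j * (x / (1 - q)))) / qTheta q (lam / (x / (1 - q)))) *
      ∑' k, laplaceCoeff (fun l => (q : ℂ) ^ α l) ((q : ℂ) ^ β) q (x / (1 - q)) j k) * hmul

theorem Fin.prod_univ_erase_zero (f : Fin 3 → ℂ) : ∏ l ∈ Finset.univ.erase 0, f l = f 1 * f 2 := by
  rw [show (Finset.univ.erase 0 : Finset (Fin 3)) = {1, 2} by decide,
    Finset.prod_pair (by decide)]

theorem Fin.prod_univ_erase_one (f : Fin 3 → ℂ) : ∏ l ∈ Finset.univ.erase 1, f l = f 0 * f 2 := by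
  rw [show (Finset.univ.erase 1 : Finset (Fin 3)) = {0, 2} by decide,
    Finset.prod_pair (by decide)]

theorem Fin.prod_univ_erase_two (f : Fin 3 → ℂ) : ∏ l ∈ Finset.univ.erase 2, f l = f 0 * f 1 := by
  rw [show (Finset.univ.erase 2 : Finset (Fin 3)) = {0, 1} by decide,
    Finset.prod_pair (by decide)]

theorem theorem4p1 (α₁ α₂ α₃ β₁ lam x : ℂ)
    (h₁₂ : ∀ m : ℤ, α₁ - α₂ ≠ m) (h₁₃ : ∀ m : ℤ, α₁ - α₃ ≠ m) (h₂₃ : ∀ m : ℤ, α₂ - α₃ ≠ m)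
    (hβ : ∀ m : ℕ, β₁ ≠ -(m : ℂ))
    (hlam₀ : lam ≠ 0) (hlam : |Complex.arg lam| < Real.pi)
    (hx₀ : x ≠ 0) (hx : |Complex.arg x| < Real.pi)
    (hxlam : |Complex.arg x - Complex.arg lam| < Real.pi) :
    (∀ᶠ q : ℝ in 𝓝[<] 1, ∃ φ : ℂ → ℂ,
      IsRayContinuation
        (qBorel q (basicPhi31 ((q : ℂ) ^ α₁) ((q : ℂ) ^ α₂) ((q : ℂ) ^ α₃) ((q : ℂ) ^ β₁) q))
        lam φ ∧
      (∀ n : ℤ, qTheta q (lam * (q : ℂ) ^ n / (x / (1 - q))) ≠ 0) ∧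
      Summable (qLaplaceTerm q lam φ (x / (1 - q)))) ∧
    Tendsto
      (fun q : ℝ =>
        resummedF31 ((q : ℂ) ^ α₁) ((q : ℂ) ^ α₂) ((q : ℂ) ^ α₃) ((q : ℂ) ^ β₁) q lam
          (x / (1 - q)))
      (𝓝[<] 1)
      (𝓝
        (Complex.Gamma β₁ * Complex.Gamma (α₂ - α₁) * Complex.Gamma (α₃ - α₁) /
            (Complex.Gamma α₂ * Complex.Gamma α₃ * Complex.Gamma (β₁ - α₁)) *
            x ^ (-α₁) *
            hypergeom22 α₁ (α₁ + 1 - β₁) (α₁ + 1 - α₂) (α₁ + 1 - α₃) (1 / x) +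
          Complex.Gamma β₁ * Complex.Gamma (α₁ - α₂) * Complex.Gamma (α₃ - α₂) /
            (Complex.Gamma α₁ * Complex.Gamma α₃ * Complex.Gamma (β₁ - α₂)) *
            x ^ (-α₂) *
            hypergeom22 α₂ (α₂ + 1 - β₁) (α₂ + 1 - α₁) (α₂ + 1 - α₃) (1 / x) +
          Complex.Gamma β₁ * Complex.Gamma (α₂ - α₃) * Complex.Gamma (α₁ - α₃) /
            (Complex.Gamma α₂ * Complex.Gamma α₁ * Complex.Gamma (β₁ - α₃)) *
            x ^ (-α₃) *
            hypergeom22 α₃ (α₃ + 1 - β₁) (α₃ + 1 - α₂) (α₃ + 1 - α₁) (1 / x))) := by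

  have hne : ∀ j l : Fin 3, j ≠ l → ∀ m : ℤ, ![α₁, α₂, α₃] j - ![α₁, α₂, α₃] l ≠ m := by
    have hsymm : ∀ {u v : ℂ}, (∀ m : ℤ, u - v ≠ m) → ∀ m : ℤ, v - u ≠ m := fun h m hm =>
      h (-m) (by push_cast; linear_combination -hm)
    intro j l hjl
    fin_cases j <;> fin_cases l <;>
      first
        | exact absurd rfl hjl
        | assumption
        | exact hsymm h₁₂
        | exact hsymm h₁₃
        | exact hsymm h₂₃
  obtain ⟨h1, h2⟩ := tendsto_resummedF31 hne hβ hlam₀ hlam hx₀ hxlam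
  refine ⟨h1, ?_⟩
  have hterm : ∀ A B C D E F G H : ℂ, A⁻¹ * B⁻¹ * C⁻¹ / (D⁻¹ * (E⁻¹ * F⁻¹)) * G * H =
      D * E * F / (A * B * C) * G * H := fun A B C D E F G H => by
    simp only [div_eq_mul_inv, mul_inv, inv_inv]
    ring
  have hcoeff : ∀ a b c d : ℂ, ∑' k : ℕ, (1 / x) ^ k * ((ascPochhammer ℂ k).eval a *
      (ascPochhammer ℂ k).eval b) / ((ascPochhammer ℂ k).eval c * (ascPochhammer ℂ k).eval d *
        (k.factorial : ℂ)) = hypergeom22 a b c d (1 / x) := fun a b c d =>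
    tsum_congr fun k => by ring
  simp only [Fin.sum_univ_three, hypergeomCoeff, Fin.prod_univ_erase_zero,
    Fin.prod_univ_erase_one, Fin.prod_univ_erase_two, Matrix.cons_val_zero, Matrix.cons_val_one,
    Matrix.cons_val, hcoeff, hterm] at h2
  rw [mul_comm (Complex.Gamma α₂) (Complex.Gamma α₁)]
  rw [mul_right_comm _ (Complex.Gamma (α₂ - α₃)), ← hcoeff α₃, tsum_congr fun k => by
    rw [mul_comm ((ascPochhammer ℂ k).eval (α₃ + 1 - α₂))], hcoeff α₃]
  exact h2

end
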